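/- Let $k$ be an algebraically closed field, $X$ an integral projective $k$-scheme, $\sigma$ a $k$-automorphism of $X$, $\mathcal{L}$ an invertible sheaf on $X$, and $c\in X$ a closed point of infinite order under $\sigma$ (that is, $\sigma^n(c)\neq c$ for all $n\neq 0$). Put $c_i=\sigma^{-i}(c)$ for $i\in\mathbb{Z}$, let $\mathcal{I}$ be the ideal sheaf of $c$, write $\mathcal{F}^{\sigma^i}=(\sigma^i)^*\mathcal{F}$ (so $\mathcal{I}^{\sigma^i}$ is the ideal sheaf of $c_i$), and for $n\ge 0$ set $$\mathcal{I}_n=\mathcal{I}\,\mathcal{I}^{\sigma}\cdots\mathcal{I}^{\sigma^{n-1}},\qquad \mathcal{L}_n=\mathcal{L}\otimes\mathcal{L}^{\sigma}\otimes\cdots\otimes\mathcal{L}^{\sigma^{n-1}},\qquad \mathcal{E}_n=\mathcal{I}_n\otimes\mathcal{L}_n=\mathcal{I}_n\mathcal{L}_n\subseteq\mathcal{L}_n .$$ Here ${}_1(\mathcal{G})_{\tau}$ denotes the $\mathcal{O}_X$-bimodule with left structure $\mathcal{G}$ and right structure $\tau_*\mathcal{G}$. Let $\mathcal{R}=\mathcal{R}(X,c,\mathcal{L},\sigma)=\bigoplus_{n\ge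 0}{}_1(\mathcal{E}_n)_{\sigma^n}$ be the graded bimodule algebra whose multiplication is given by the natural maps $\mathcal{E}_n\otimes\mathcal{E}_m^{\sigma^n}\to\mathcal{E}_{n+m}$. A graded right $\mathcal{R}$-module is $\mathcal{M}=\bigoplus_{n\in\mathbb{Z}}{}_1(\mathcal{G}_n)_{\sigma^n}$ with $\mathcal{G}_n$ quasi-coherent and with action maps $\mathcal{G}_n\otimes\mathcal{E}_m^{\sigma^n}\to\mathcal{G}_{n+m}$ satisfying the usual axioms; graded left modules are defined similarly, with action maps $\mathcal{E}_m\otimes\mathcal{G}_n^{\sigma^m}\to\mathcal{G}_{m+n}$. A right (left) ideal is a graded right (left) submodule of $\mathcal{R}$. A graded right (left) module $\mathcal{M}$ is coherent if there are a coherent $\mathcal{O}_X$-module $\mathcal{F}$ and a surjective, not necessarily graded, homomorphism $\mathcal{F}\otimes\mathcal{R}\to\mathcal{M}$ (respectively $\mathcal{R}\otimes\mathcal{F}\to\mathcal{M}$) of right (left) $\mathcal{R}$-modules. The algebra $\mathcal{R}$ is right (left) noetherian if every right (left) ideal is coherent, and noetherian if it is both. A graded right module is bounded if all but finitely many of its components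 vanish, and torsion if every coherent submodule of it is bounded. A set of closed points of $X$ is critically dense if it is infinite and each of its infinite subsets has Zariski closure $X$. Then: 1. $\mathcal{R}$ is right noetherian if and only if $\{c_i\}_{i\ge 0}$ is critically dense in $X$. 2. $\mathcal{R}$ is left noetherian if and only if $\{c_i\}_{i<0}$ is critically dense in $X$. 3. $\mathcal{R}$ is noetherian if and only if $\{c_i\}_{i\in\mathbb{Z}}$ is critically dense in $X$. 4. If $\mathcal{R}$ is not right noetherian, then there is an infinite ascending chain $\mathcal{J}_0\subset\mathcal{J}_1\subset\mathcal{J}_2\subset\cdots$ of coherent right ideals of $\mathcal{R}$ such that no factor $\mathcal{J}_{j+1}/\mathcal{J}_j$ is torsion. -/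

import Mathlib

open CategoryTheory AlgebraicGeometry TopologicalSpace
open scoped TensorProduct

universe u

noncomputable section

namespace NaiveBlowup
variable {X : Scheme.{u}}

/-- Restriction of sections of a sheaf of modules. -/
def res (M : X.Modules) {V U : X.Opens} (h : V ≤ U) : Γ(M, U) →+ Γ(M, V) :=
  (M.presheaf.map (homOfLE h).op).hom

/-- Restriction of regular functions. -/
def resO {V U : X.Opens} (h : V ≤ U) : Γ(X, U) →+* Γ(X, V) :=
  (X.presheaf.map (homOfLE h).op).hom

lemma res_res (M : X.Modules) {W V U : X.Opens} (h : V ≤ U) (h' : W ≤ V) (s : Γ(M, U)) :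
    res M h' (res M h s) = res M (h'.trans h) s := by
  simp only [res]
  rw [← homOfLE_comp h' h, op_comp, Functor.map_comp]
  rfl

lemma res_self (M : X.Modules) {U : X.Opens} (s : Γ(M, U)) : res M le_rfl s = s := by

  simp [res]

lemma resO_resO {W V U : X.Opens} (h : V ≤ U) (h' : W ≤ V) (s : Γ(X, U)) :
    resO h' (resO h s) = resO (h'.trans h) s := by
  simp only [resO]
  rw [← homOfLE_comp h' h, op_comp, Functor.map_comp]
  rfl

lemma resO_self {U : X.Opens} (s : Γ(X, U)) : resO le_rfl s = s := by

  simp [resO]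

lemma res_smul (M : X.Modules) {V U : X.Opens} (h : V ≤ U) (r : Γ(X, U)) (s : Γ(M, U)) :
    res M h (r • s) = resO h r • res M h s :=
  Scheme.Modules.map_smul M (homOfLE h) r s

lemma eq_of_locally (M : X.Modules) {U : X.Opens} {s t : Γ(M, U)}
    (H : ∀ x ∈ U, ∃ (V : X.Opens) (h : V ≤ U), x ∈ V ∧ res M h s = res M h t) : s = t := by
  choose V hV hx hst using H
  refine TopCat.Sheaf.eq_of_locally_eq' ⟨M.presheaf, M.isSheaf⟩ (fun x : U => V x.1 x.2) U
    (fun x => homOfLE (hV x.1 x.2)) ?_ s t (fun x => hst x.1 x.2)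
  intro x hxU
  simp only [Opens.mem_iSup]
  exact ⟨⟨x, hxU⟩, hx x hxU⟩

lemma exists_glue (M : X.Modules) {ι : Type u} {U : X.Opens} (V : ι → X.Opens) (hV : ∀ i, V i ≤ U)
    (hc : ∀ x ∈ U, ∃ i, x ∈ V i) (s : ∀ i, Γ(M, V i))
    (H : ∀ i j, res M (inf_le_left : V i ⊓ V j ≤ V i) (s i) =
      res M (inf_le_right : V i ⊓ V j ≤ V j) (s j)) :
    ∃ t : Γ(M, U), ∀ i, res M (hV i) t = s i := by
  obtain ⟨t, ht, -⟩ := TopCat.Sheaf.existsUnique_gluing' ⟨M.presheaf, M.isSheaf⟩ V U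
    (fun i => homOfLE (hV i)) (fun x hx => by simpa using hc x hx) s H
  exact ⟨t, ht⟩

/-! ### Tensor products of sheaves of modules -/

/-- The presheaf `U ↦ M(U) ⊗ N(U)`. -/
def ptensor (M N : X.Modules) : X.PresheafOfModules :=
  PresheafOfModules.Monoidal.tensorObj (R := X.presheaf) M.val N.val

/-- The tensor product of two sheaves of modules. -/
def tensor (M N : X.Modules) : X.Modules :=
  (PresheafOfModules.sheafification (𝟙 X.ringCatSheaf.obj)).obj (ptensor M N)

/-- The map from the presheaf tensor product to the tensor product. -/
def tensorUnit (M N : X.Modules) : ptensor M N ⟶ (tensor M N).val :=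
  (PresheafOfModules.sheafificationAdjunction (𝟙 X.ringCatSheaf.obj)).unit.app (ptensor M N)

/-- The map from the presheaf tensor product to the tensor product, on sections. -/
def toTensor (M N : X.Modules) (U : X.Opens) :
    (Γ(M, U) ⊗[Γ(X, U)] Γ(N, U)) →ₗ[Γ(X, U)] Γ(tensor M N, U) :=
  ((tensorUnit M N).app (.op U)).hom

/-- Restriction in the presheaf tensor product. -/
def resT (M N : X.Modules) {V U : X.Opens} (h : V ≤ U) :
    (Γ(M, U) ⊗[Γ(X, U)] Γ(N, U)) →+ (Γ(M, V) ⊗[Γ(X, V)] Γ(N, V)) :=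
  ((ptensor M N).presheaf.map (homOfLE h).op).hom

lemma resT_tmul (M N : X.Modules) {V U : X.Opens} (h : V ≤ U) (m : Γ(M, U)) (n : Γ(N, U)) :
    resT M N h (m ⊗ₜ n) = res M h m ⊗ₜ res N h n := rfl

lemma res_toTensor (M N : X.Modules) {V U : X.Opens} (h : V ≤ U)
    (q : Γ(M, U) ⊗[Γ(X, U)] Γ(N, U)) :
    res _ h (toTensor M N U q) = toTensor M N V (resT M N h q) :=
  (PresheafOfModules.naturality_apply (tensorUnit M N) (homOfLE h).op q).symm

lemma toTensor_locally_surjective (M N : X.Modules) {U : X.Opens} (t : Γ(tensor M N, U))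
    {x : X} (hx : x ∈ U) : ∃ (V : X.Opens) (h : V ≤ U), x ∈ V ∧
      ∃ q, toTensor M N V q = res _ h t := by
  have := Presheaf.imageSieve_mem (Opens.grothendieckTopology X)
    (CategoryTheory.toSheafify (Opens.grothendieckTopology X) (ptensor M N).presheaf)
    (U := .op U) t
  obtain ⟨V, f, ⟨q, hq⟩, hxV⟩ := this x hx
  exact ⟨V, leOfHom f, hxV, q, hq⟩

lemma toTensor_locally_injective (M N : X.Modules) {U : X.Opens}
    (p q : Γ(M, U) ⊗[Γ(X, U)] Γ(N, U)) (hpq : toTensor M N U p = toTensor M N U q)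
    {x : X} (hx : x ∈ U) :
    ∃ (V : X.Opens) (h : V ≤ U), x ∈ V ∧ resT M N h p = resT M N h q := by
  have := Presheaf.equalizerSieve_mem (Opens.grothendieckTopology X)
    (CategoryTheory.toSheafify (Opens.grothendieckTopology X) (ptensor M N).presheaf)
    (X := .op U) p q hpq
  obtain ⟨V, f, hq, hxV⟩ := this x hx
  exact ⟨V, leOfHom f, hxV, hq⟩

/-- The section `m ⊗ n` of the tensor product. -/
def tmul {M N : X.Modules} {U : X.Opens} (m : Γ(M, U)) (n : Γ(N, U)) : Γ(tensor M N, U) :=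
  toTensor M N U (m ⊗ₜ n)


lemma res_tmul {M N : X.Modules} {V U : X.Opens} (h : V ≤ U) (m : Γ(M, U)) (n : Γ(N, U)) :
    res _ h (tmul m n) = tmul (res M h m) (res N h n) := by
  rw [tmul, res_toTensor, resT_tmul]; rfl

lemma add_tmul {M N : X.Modules} {U : X.Opens} (m m' : Γ(M, U)) (n : Γ(N, U)) :
    tmul (m + m') n = tmul m n + tmul m' n := by
  simp [tmul, TensorProduct.add_tmul]

lemma tmul_add {M N : X.Modules} {U : X.Opens} (m : Γ(M, U)) (n n' : Γ(N, U)) :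
    tmul m (n + n') = tmul m n + tmul m n' := by
  simp [tmul, TensorProduct.tmul_add]

lemma smul_tmul {M N : X.Modules} {U : X.Opens} (r : Γ(X, U)) (m : Γ(M, U)) (n : Γ(N, U)) :
    tmul (r • m) n = r • tmul m n := by
  rw [tmul, ← TensorProduct.smul_tmul', map_smul]
  rfl

lemma tmul_smul {M N : X.Modules} {U : X.Opens} (r : Γ(X, U)) (m : Γ(M, U)) (n : Γ(N, U)) :
    tmul m (r • n) = r • tmul m n := by
  simp [tmul]

/-! ### Twisted bilinear maps -/

/-- For an endomorphism `τ` of `X`, a map of `𝒪_X`-modules `M ⊗ τ^* N ⟶ P`, written as a family of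
biadditive maps `M(U) × N(V) → P(W)` for `W ⊆ U ∩ τ⁻¹ V`, compatible with restrictions,
`𝒪_X`-linear in the first variable and `τ`-semilinear in the second. -/
@[ext]
structure Pairing (τ : X ⟶ X) (M N P : X.Modules) where
  toFun {U V W : X.Opens} (hU : W ≤ U) (hV : W ≤ τ ⁻¹ᵁ V) : Γ(M, U) → Γ(N, V) → Γ(P, W)
  add_left {U V W : X.Opens} (hU : W ≤ U) (hV : W ≤ τ ⁻¹ᵁ V) (a a' : Γ(M, U)) (b : Γ(N, V)) :
    toFun hU hV (a + a') b = toFun hU hV a b + toFun hU hV a' b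
  add_right {U V W : X.Opens} (hU : W ≤ U) (hV : W ≤ τ ⁻¹ᵁ V) (a : Γ(M, U)) (b b' : Γ(N, V)) :
    toFun hU hV a (b + b') = toFun hU hV a b + toFun hU hV a b'
  smul_left {U V W : X.Opens} (hU : W ≤ U) (hV : W ≤ τ ⁻¹ᵁ V) (r : Γ(X, U))
    (a : Γ(M, U)) (b : Γ(N, V)) :
    toFun hU hV (r • a) b = resO hU r • toFun hU hV a b
  smul_right {U V W : X.Opens} (hU : W ≤ U) (hV : W ≤ τ ⁻¹ᵁ V) (r : Γ(X, V))
    (a : Γ(M, U)) (b : Γ(N, V)) :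
    toFun hU hV a (r • b) = resO hV ((τ.app V).hom r) • toFun hU hV a b
  res_toFun {U V W W' : X.Opens} (hU : W ≤ U) (hV : W ≤ τ ⁻¹ᵁ V) (hW : W' ≤ W)
    (a : Γ(M, U)) (b : Γ(N, V)) :
    res P hW (toFun hU hV a b) = toFun (hW.trans hU) (hW.trans hV) a b
  toFun_res {U V U' V' W : X.Opens} (hU : U' ≤ U) (hV : V' ≤ V) (hWU : W ≤ U')
    (hWV : W ≤ τ ⁻¹ᵁ V') (a : Γ(M, U)) (b : Γ(N, V)) :
    toFun hWU hWV (res M hU a) (res N hV b) =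
      toFun (hWU.trans hU) (hWV.trans (τ.preimage_mono hV)) a b

section tensorExt

variable {τ : X ⟶ X} {M A P B C : X.Modules} (β : Pairing τ M A P)
  (γ : B ⟶ (Scheme.Modules.pushforward τ).obj C)

/-- The component of `γ` on sections, followed by a restriction. -/
def semi {V W : X.Opens} (hV : W ≤ τ ⁻¹ᵁ V) : Γ(B, V) →+ Γ(C, W) :=
  (res C hV).comp (γ.app V).hom

lemma semi_smul {V W : X.Opens} (hV : W ≤ τ ⁻¹ᵁ V) (r : Γ(X, V)) (b : Γ(B, V)) :
    semi γ hV (r • b) = resO hV ((τ.app V).hom r) • semi γ hV b := by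
  have : γ.app V (r • b) = r • γ.app V b := Scheme.Modules.Hom.app_smul γ r b
  change res C hV (γ.app V (r • b)) = _
  rw [this]
  exact res_smul C hV _ _

lemma res_semi {V W W' : X.Opens} (hV : W ≤ τ ⁻¹ᵁ V) (hW : W' ≤ W) (b : Γ(B, V)) :
    res C hW (semi γ hV b) = semi γ (hW.trans hV) b :=
  res_res _ _ _ _

lemma semi_res {V V' W : X.Opens} (hV : V' ≤ V) (hW : W ≤ τ ⁻¹ᵁ V') (b : Γ(B, V)) :
    semi γ hW (res B hV b) = semi γ (hW.trans (τ.preimage_mono hV)) b := by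
  have : γ.app V' (res B hV b) = res C (τ.preimage_mono hV) (γ.app V b) :=
    NatTrans.naturality_apply γ.mapPresheaf (homOfLE hV).op b
  change res C hW (γ.app V' (res B hV b)) = _
  rw [this]
  exact res_res _ _ _ _

/-- The product of a section of `M` and an element of the presheaf tensor product. -/
def preExt {U V W : X.Opens} (hU : W ≤ U) (hV : W ≤ τ ⁻¹ᵁ V) (a : Γ(M, U)) :
    (Γ(A, V) ⊗[Γ(X, V)] Γ(B, V)) →+ Γ(tensor P C, W) :=
  TensorProduct.liftAddHom
    (AddMonoidHom.mk' (fun x => AddMonoidHom.mk' (fun y => tmul (β.toFun hU hV a x) (semi γ hV y))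
      (fun y y' => by rw [map_add, tmul_add]))
      (fun x x' => by ext y; simp [β.add_right, add_tmul]))
    (fun r x y => by
      simp only [AddMonoidHom.mk'_apply]
      rw [β.smul_right, semi_smul, smul_tmul, tmul_smul])

lemma preExt_tmul {U V W : X.Opens} (hU : W ≤ U) (hV : W ≤ τ ⁻¹ᵁ V) (a : Γ(M, U))
    (x : Γ(A, V)) (y : Γ(B, V)) :
    preExt β γ hU hV a (x ⊗ₜ y) = tmul (β.toFun hU hV a x) (semi γ hV y) := rfl

lemma res_preExt {U V W W' : X.Opens} (hU : W ≤ U) (hV : W ≤ τ ⁻¹ᵁ V) (hW : W' ≤ W)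
    (a : Γ(M, U)) (q) :
    res _ hW (preExt β γ hU hV a q) = preExt β γ (hW.trans hU) (hW.trans hV) a q := by
  induction q with
  | zero => simp
  | tmul x y => simp only [preExt_tmul, res_tmul, β.res_toFun, res_semi]
  | add p q hp hq => simp only [map_add, hp, hq]

lemma preExt_res {U V U' V' W : X.Opens} (hU : U' ≤ U) (hV : V' ≤ V) (hWU : W ≤ U')
    (hWV : W ≤ τ ⁻¹ᵁ V') (a : Γ(M, U)) (q) :
    preExt β γ hWU hWV (res M hU a) (resT A B hV q) =
      preExt β γ (hWU.trans hU) (hWV.trans (τ.preimage_mono hV)) a q := by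
  induction q with
  | zero => simp
  | tmul x y => simp only [preExt_tmul, resT_tmul, β.toFun_res, semi_res]
  | add p q hp hq => simp only [map_add, hp, hq]

lemma preExt_res_right {U V V' W : X.Opens} (hV : V' ≤ V) (hWU : W ≤ U)
    (hWV : W ≤ τ ⁻¹ᵁ V') (a : Γ(M, U)) (q) :
    preExt β γ hWU hWV a (resT A B hV q) =
      preExt β γ hWU (hWV.trans (τ.preimage_mono hV)) a q := by
  have := preExt_res β γ le_rfl hV hWU hWV a q
  rwa [res_self] at this

lemma preExt_add {U V W : X.Opens} (hU : W ≤ U) (hV : W ≤ τ ⁻¹ᵁ V) (a a' : Γ(M, U)) (q) :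
    preExt β γ hU hV (a + a') q = preExt β γ hU hV a q + preExt β γ hU hV a' q := by
  induction q with
  | zero => simp
  | tmul x y => simp only [preExt_tmul, β.add_left, add_tmul]
  | add p q hp hq => simp only [map_add, hp, hq]; abel

lemma preExt_smul_left {U V W : X.Opens} (hU : W ≤ U) (hV : W ≤ τ ⁻¹ᵁ V) (r : Γ(X, U))
    (a : Γ(M, U)) (q) :
    preExt β γ hU hV (r • a) q = resO hU r • preExt β γ hU hV a q := by
  induction q with
  | zero => simp
  | tmul x y => simp only [preExt_tmul, β.smul_left, smul_tmul]
  | add p q hp hq => simp only [map_add, hp, hq, smul_add]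

lemma preExt_smul_right {U V W : X.Opens} (hU : W ≤ U) (hV : W ≤ τ ⁻¹ᵁ V) (r : Γ(X, V))
    (a : Γ(M, U)) (q) :
    preExt β γ hU hV a (r • q) = resO hV ((τ.app V).hom r) • preExt β γ hU hV a q := by
  induction q with
  | zero => simp
  | tmul x y =>
    rw [TensorProduct.smul_tmul', preExt_tmul, β.smul_right, smul_tmul, preExt_tmul]
  | add p q hp hq => simp only [map_add, hp, hq, smul_add]

/-- `y` is the product of `a` and `t`: it restricts to the product with each local
representative of `t`. -/
def IsProd {U V W : X.Opens} (a : Γ(M, U)) (t : Γ(tensor A B, V)) (y : Γ(tensor P C, W)) : Prop :=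
  ∀ ⦃V' W' : X.Opens⦄ (hV' : V' ≤ V) (hW' : W' ≤ W) (hU : W' ≤ U) (h : W' ≤ τ ⁻¹ᵁ V') (q),
    toTensor A B V' q = res _ hV' t → res _ hW' y = preExt β γ hU h a q

lemma isProd_of_local {U V W : X.Opens} (a : Γ(M, U)) (t : Γ(tensor A B, V))
    (y : Γ(tensor P C, W))
    (H : ∀ x ∈ W, ∃ (V' W' : X.Opens) (hV' : V' ≤ V) (hW' : W' ≤ W) (hU : W' ≤ U)
      (h : W' ≤ τ ⁻¹ᵁ V') (q : _), x ∈ W' ∧ toTensor A B V' q = res _ hV' t ∧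
        res _ hW' y = preExt β γ hU h a q) : IsProd β γ a t y := by
  intro V₁ W₁ hV₁ hW₁ hU₁ h₁ q₁ hq₁
  apply eq_of_locally
  intro x hx
  obtain ⟨V₂, W₂, hV₂, hW₂, hU₂, h₂, q₂, hx₂, hq₂, hy₂⟩ := H x (hW₁ hx)
  have e : toTensor A B (V₁ ⊓ V₂) (resT A B inf_le_left q₁) =
      toTensor A B (V₁ ⊓ V₂) (resT A B inf_le_right q₂) := by
    rw [← res_toTensor, ← res_toTensor, hq₁, hq₂, res_res, res_res]
  obtain ⟨V₃, hV₃, hxV₃, e₃⟩ := toTensor_locally_injective A B _ _ e (x := τ x) ⟨h₁ hx, h₂ hx₂⟩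
  refine ⟨W₁ ⊓ W₂ ⊓ τ ⁻¹ᵁ V₃, inf_le_left.trans inf_le_left, ⟨⟨hx, hx₂⟩, hxV₃⟩, ?_⟩
  have a₁ := congrArg (res (tensor P C) (inf_le_left.trans inf_le_right :
    W₁ ⊓ W₂ ⊓ τ ⁻¹ᵁ V₃ ≤ W₂)) hy₂
  rw [res_res, res_preExt] at a₁
  rw [res_res, a₁, res_preExt]
  have b₁ := preExt_res_right β γ (hV₃.trans inf_le_left : V₃ ≤ V₁)
    (inf_le_left.trans (inf_le_left.trans hU₁)) (inf_le_right : W₁ ⊓ W₂ ⊓ τ ⁻¹ᵁ V₃ ≤ τ ⁻¹ᵁ V₃) a q₁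
  have b₂ := preExt_res_right β γ (hV₃.trans inf_le_right : V₃ ≤ V₂)
    (inf_le_left.trans (inf_le_left.trans hU₁)) (inf_le_right : W₁ ⊓ W₂ ⊓ τ ⁻¹ᵁ V₃ ≤ τ ⁻¹ᵁ V₃) a q₂
  rw [← b₁, ← b₂]
  congr 1
  have : ∀ {U V W : X.Opens} (h : V ≤ U) (h' : W ≤ V) (q),
      resT A B h' (resT A B h q) = resT A B (h'.trans h) q := by
    intro U V W h h' q
    simp only [resT]
    rw [← homOfLE_comp h' h, op_comp, Functor.map_comp]
    rfl
  rw [this, this] at e₃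
  exact e₃.symm

lemma IsProd.unique {U V W : X.Opens} (hU : W ≤ U) (hV : W ≤ τ ⁻¹ᵁ V) {a : Γ(M, U)}
    {t : Γ(tensor A B, V)} {y y' : Γ(tensor P C, W)}
    (h : IsProd β γ a t y) (h' : IsProd β γ a t y') : y = y' := by
  apply eq_of_locally
  intro x hx
  obtain ⟨V', hV', hx', q, hq⟩ := toTensor_locally_surjective A B t (hV hx)
  refine ⟨W ⊓ τ ⁻¹ᵁ V', inf_le_left, ⟨hx, hx'⟩, ?_⟩
  rw [h hV' inf_le_left (inf_le_left.trans hU) inf_le_right q hq,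
    h' hV' inf_le_left (inf_le_left.trans hU) inf_le_right q hq]

lemma exists_isProd {U V W : X.Opens} (hU : W ≤ U) (hV : W ≤ τ ⁻¹ᵁ V) (a : Γ(M, U))
    (t : Γ(tensor A B, V)) : ∃ y : Γ(tensor P C, W), IsProd β γ a t y := by
  choose V' hV' hx' q hq using fun x : W => toTensor_locally_surjective A B t (hV x.2)
  obtain ⟨y, hy⟩ := exists_glue (tensor P C) (U := W) (fun x : W => W ⊓ τ ⁻¹ᵁ V' x)
    (fun x => inf_le_left) (fun x hx => ⟨⟨x, hx⟩, hx, hx' ⟨x, hx⟩⟩)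
    (fun x => preExt β γ (inf_le_left.trans hU) inf_le_right a (q x)) (by
      intro i j
      rw [res_preExt]
      have key : IsProd β γ a (res _ (hV' i) t)
          (preExt β γ (inf_le_left.trans hU) inf_le_right a (q i) :
            Γ(tensor P C, W ⊓ τ ⁻¹ᵁ V' i)) := by
        apply isProd_of_local
        intro x hx
        refine ⟨V' i, _, le_rfl, le_rfl, inf_le_left.trans hU, inf_le_right, q i, hx, ?_, ?_⟩
        · rw [hq, res_self]
        · rw [res_self]
      have hle : (W ⊓ τ ⁻¹ᵁ V' i) ⊓ (W ⊓ τ ⁻¹ᵁ V' j) ≤ τ ⁻¹ᵁ (V' i ⊓ V' j) :=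
        fun x hx => ⟨hx.1.2, hx.2.2⟩
      have := key (V' := V' i ⊓ V' j) (W' := (W ⊓ τ ⁻¹ᵁ V' i) ⊓ (W ⊓ τ ⁻¹ᵁ V' j)) inf_le_left
        inf_le_left (inf_le_left.trans (inf_le_left.trans hU))
        hle
        (resT A B inf_le_right (q j)) (by rw [← res_toTensor, hq, res_res, res_res])
      rw [preExt_res_right, res_preExt] at this
      rw [this]
      symm
      apply res_preExt)
  refine ⟨y, isProd_of_local _ _ _ _ _ fun x hx => ?_⟩
  exact ⟨V' ⟨x, hx⟩, W ⊓ τ ⁻¹ᵁ V' ⟨x, hx⟩, hV' _, inf_le_left, inf_le_left.trans hU, inf_le_right,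
    q ⟨x, hx⟩, ⟨hx, hx' _⟩, hq _, hy _⟩

/-- The pairing `M × (A ⊗ B) → P ⊗ C`, `(m, a ⊗ b) ↦ β (m, a) ⊗ γ b`. -/
def tensorExt : Pairing τ M (tensor A B) (tensor P C) where
  toFun hU hV a t := (exists_isProd β γ hU hV a t).choose
  add_left hU hV a a' t := by
    refine (exists_isProd β γ hU hV (a + a') t).choose_spec.unique β γ hU hV ?_
    intro V' W' hV' hW' hU' h q hq
    rw [map_add, (exists_isProd β γ hU hV a t).choose_spec hV' hW' hU' h q hq,
      (exists_isProd β γ hU hV a' t).choose_spec hV' hW' hU' h q hq, preExt_add]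
  add_right {U V W} hU hV a t t' := by
    refine (exists_isProd β γ hU hV a (t + t')).choose_spec.unique β γ hU hV ?_
    refine isProd_of_local _ _ _ _ _ fun x hx => ?_
    obtain ⟨V₁, hV₁, hx₁, q₁, hq₁⟩ := toTensor_locally_surjective A B t (hV hx)
    obtain ⟨V₂, hV₂, hx₂, q₂, hq₂⟩ := toTensor_locally_surjective A B t' (hV hx)
    have e₁ : toTensor A B (V₁ ⊓ V₂) (resT A B inf_le_left q₁) =
      res _ (inf_le_left.trans hV₁) t := by rw [← res_toTensor, hq₁, res_res]
    have e₂ : toTensor A B (V₁ ⊓ V₂) (resT A B inf_le_right q₂) =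
      res _ (inf_le_left.trans hV₁) t' := by rw [← res_toTensor, hq₂, res_res]
    refine ⟨V₁ ⊓ V₂, W ⊓ τ ⁻¹ᵁ (V₁ ⊓ V₂), inf_le_left.trans hV₁, inf_le_left,
      inf_le_left.trans hU, inf_le_right,
      resT A B inf_le_left q₁ + resT A B inf_le_right q₂, ⟨hx, hx₁, hx₂⟩, ?_, ?_⟩
    · rw [map_add, map_add, e₁, e₂]
    · rw [map_add, map_add,
        (exists_isProd β γ hU hV a t).choose_spec _ inf_le_left (inf_le_left.trans hU)
          inf_le_right _ e₁,
        (exists_isProd β γ hU hV a t').choose_spec _ inf_le_left (inf_le_left.trans hU)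
          inf_le_right _ e₂]
  smul_left hU hV r a t := by
    refine (exists_isProd β γ hU hV (r • a) t).choose_spec.unique β γ hU hV ?_
    intro V' W' hV' hW' hU' h q hq
    rw [res_smul, (exists_isProd β γ hU hV a t).choose_spec hV' hW' hU' h q hq, preExt_smul_left,
      resO_resO]
  smul_right {U V W} hU hV r a t := by
    refine (exists_isProd β γ hU hV a (r • t)).choose_spec.unique β γ hU hV ?_
    refine isProd_of_local _ _ _ _ _ fun x hx => ?_
    obtain ⟨V₁, hV₁, hx₁, q₁, hq₁⟩ := toTensor_locally_surjective A B t (hV hx)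
    refine ⟨V₁, W ⊓ τ ⁻¹ᵁ V₁, hV₁, inf_le_left, inf_le_left.trans hU, inf_le_right,
      resO hV₁ r • q₁, ⟨hx, hx₁⟩, ?_, ?_⟩
    · rw [map_smul, hq₁, res_smul]
    · rw [preExt_smul_right, res_smul, (exists_isProd β γ hU hV a t).choose_spec hV₁ inf_le_left
        (inf_le_left.trans hU) inf_le_right q₁ hq₁, resO_resO]
      congr 1
      have := ConcreteCategory.congr_hom (τ.naturality (homOfLE hV₁).op) r
      change (τ.app V₁).hom (resO hV₁ r) = resO (τ.preimage_mono hV₁) ((τ.app V).hom r) at this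
      rw [this, resO_resO]
  res_toFun hU hV hW a t := by
    refine IsProd.unique β γ (hW.trans hU) (hW.trans hV) ?_
      (exists_isProd β γ (hW.trans hU) (hW.trans hV) a t).choose_spec
    intro V' W' hV' hW' hU' h q hq
    rw [res_res, (exists_isProd β γ hU hV a t).choose_spec hV' (hW'.trans hW) hU' h q hq]
  toFun_res {U V U' V' W} hU hV hWU hWV a t := by
    refine IsProd.unique β γ hWU hWV
      (exists_isProd β γ hWU hWV (res M hU a) (res _ hV t)).choose_spec ?_
    intro V₁ W₁ hV₁ hW₁ hU₁ h₁ q hq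
    have b := preExt_res β γ hU le_rfl hU₁ h₁ a q
    have : resT A B (le_refl V₁) q = q := by
      simp [resT]
      rfl
    rw [this] at b
    rw [b]
    exact (exists_isProd β γ (hWU.trans hU) (hWV.trans (τ.preimage_mono hV)) a t).choose_spec (hV₁.trans hV) hW₁ _ h₁ q
      (by rw [hq, res_res])

lemma tensorExt_tmul {U V W : X.Opens} (hU : W ≤ U) (hV : W ≤ τ ⁻¹ᵁ V) (a : Γ(M, U))
    (x : Γ(A, V)) (y : Γ(B, V)) :
    (tensorExt β γ).toFun hU hV a (tmul x y) = tmul (β.toFun hU hV a x) (semi γ hV y) := by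
  have := (exists_isProd β γ hU hV a (tmul x y)).choose_spec le_rfl le_rfl hU hV (x ⊗ₜ y)
    (by rw [res_self]; rfl)
  rw [res_self] at this
  exact this

end tensorExt

/-! ### Powers of an automorphism and twists -/

/-- The morphism `σ ^ n`. -/
def tw (σ : Aut X) (n : ℤ) : X ⟶ X := (σ ^ n).hom

lemma tw_zero (σ : Aut X) : tw σ 0 = 𝟙 X := by simp [tw]; rfl

lemma tw_add (σ : Aut X) {m n k : ℤ} (h : m + n = k) : tw σ k = tw σ n ≫ tw σ m := by
  subst h; simp only [tw, zpow_add]; rfl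

instance (σ : Aut X) (n : ℤ) : IsIso (tw σ n) :=
  ⟨(σ ^ n).inv, (σ ^ n).hom_inv_id, (σ ^ n).inv_hom_id⟩

lemma tw_preimage (σ : Aut X) {m n k : ℤ} (h : m + n = k) (V : X.Opens) :
    tw σ k ⁻¹ᵁ V = tw σ n ⁻¹ᵁ tw σ m ⁻¹ᵁ V := by
  rw [tw_add σ h]; rfl

lemma tw_preimage_zero (σ : Aut X) (V : X.Opens) : tw σ 0 ⁻¹ᵁ V = V := by
  rw [tw_zero]; rfl

/-- The sheaf `M^{σ^n} = (σ^n)^* M`, realised as the direct image of `M` under `σ^{-n}`. -/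
def twist (σ : Aut X) (n : ℤ) (M : X.Modules) : X.Modules :=
  (Scheme.Modules.pushforward (tw σ (-n))).obj M

/-- `twist` is the inverse image. -/
def twistIsoPullback (σ : Aut X) (n : ℤ) (M : X.Modules) :
    twist σ n M ≅ (Scheme.Modules.pullback (tw σ n)).obj M :=
  let e : X.Modules ≌ X.Modules := CategoryTheory.Equivalence.mk
    (Scheme.Modules.pushforward (tw σ (-n))) (Scheme.Modules.pushforward (tw σ n))
    ((Scheme.Modules.pushforwardComp _ _ ≪≫ Scheme.Modules.pushforwardCongr
      (show tw σ (-n) ≫ tw σ n = 𝟙 X by rw [← tw_zero σ, ← tw_add]; simp) ≪≫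
      Scheme.Modules.pushforwardId X).symm)
    (Scheme.Modules.pushforwardComp _ _ ≪≫ Scheme.Modules.pushforwardCongr
      (show tw σ n ≫ tw σ (-n) = 𝟙 X by rw [← tw_zero σ, ← tw_add]; simp) ≪≫
      Scheme.Modules.pushforwardId X)
  (e.toAdjunction.leftAdjointUniq
    (Scheme.Modules.pullbackPushforwardAdjunction (tw σ n))).app M

/-- The canonical `σ^i`-semilinear map `M^{σ^j} → M^{σ^(i + j)}`. -/
def shiftHom (σ : Aut X) (M : X.Modules) {i j k : ℤ} (h : i + j = k) :
    twist σ j M ⟶ (Scheme.Modules.pushforward (tw σ i)).obj (twist σ k M) :=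
  (Scheme.Modules.pushforwardCongr (show tw σ (-j) = tw σ (-k) ≫ tw σ i from
      tw_add σ (by omega))).hom.app M ≫ (Scheme.Modules.pushforwardComp _ _).inv.app M

lemma semi_shiftHom_apply (σ : Aut X) (M : X.Modules) {i j k : ℤ} (h : i + j = k) {V W : X.Opens}
    (hV : W ≤ tw σ i ⁻¹ᵁ V) (s : Γ(twist σ j M, V)) :
    semi (shiftHom σ M h) hV s = res M (show tw σ (-k) ⁻¹ᵁ W ≤ tw σ (-j) ⁻¹ᵁ V by
      rw [tw_preimage σ (show i + -k = -j by omega) V]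
      exact (tw σ (-k)).preimage_mono hV) s := by
  have h1 : (shiftHom σ M h).app V s =
      res M (le_of_eq (tw_preimage σ (show i + -k = -j by omega) V).symm) s := rfl
  change res M ((tw σ (-k)).preimage_mono hV) ((shiftHom σ M h).app V s) = _
  rw [h1]
  exact res_res M _ _ _

lemma semi_shiftHom_semi_shiftHom (σ : Aut X) (M : X.Modules) {i j k l m : ℤ} (h : i + j = k)
    (h' : l + k = m) {n : ℤ} (hn : l + i = n) {V W Z : X.Opens} (hV : W ≤ tw σ i ⁻¹ᵁ V)
    (hW : Z ≤ tw σ l ⁻¹ᵁ W) (hZ : Z ≤ tw σ n ⁻¹ᵁ V) (s : Γ(twist σ j M, V)) :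
    semi (shiftHom σ M h') hW (semi (shiftHom σ M h) hV s) =
      semi (shiftHom σ M (show n + j = m by omega)) hZ s := by
  rw [semi_shiftHom_apply, semi_shiftHom_apply, semi_shiftHom_apply]
  exact res_res M _ _ _

/-! ### Graded bimodule algebras -/

variable (X) in
/-- The structure sheaf as a module over itself. -/
def structureModule : X.Modules := SheafOfModules.unit X.ringCatSheaf

/-- A regular function as a section of the structure sheaf. -/
def ofFun {U : X.Opens} (f : Γ(X, U)) : Γ(structureModule X, U) := f

/-- A section of the structure sheaf as a regular function. -/
def toFn {U : X.Opens} (f : Γ(structureModule X, U)) : Γ(X, U) := f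

/-- A graded `(𝒪_X, σ)`-bimodule algebra `⨁_{n ≥ 0} ₁(E_n)_{σ^n}`, described by its left sheaves
`E n` and the multiplication maps `E_n ⊗ (σ^n)^* E_m ⟶ E_{n + m}`. -/
structure GradedBimoduleAlgebra (σ : Aut X) where
  E : ℕ → X.Modules
  mul {n m k : ℕ} (h : n + m = k) : Pairing (tw σ n) (E n) (E m) (E k)
  one : Γ(E 0, ⊤)
  /-- The degree zero part is `𝒪_X`, via the unit map. -/
  bijective_one (U : X.Opens) :
    Function.Bijective fun f : Γ(X, U) => f • res (E 0) (le_top : U ≤ ⊤) one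
  one_mul {m : ℕ} {V W : X.Opens} (hV : W ≤ tw σ (0 : ℕ) ⁻¹ᵁ V) (hV' : W ≤ V) (b : Γ(E m, V)) :
    (mul (Nat.zero_add m)).toFun le_top hV one b = res (E m) hV' b
  mul_one {n : ℕ} {U W : X.Opens} (hU : W ≤ U) (a : Γ(E n, U)) :
    (mul (Nat.add_zero n)).toFun hU le_top a one = res (E n) hU a
  mul_assoc {n m p i j k : ℕ} (h₁ : n + m = i) (h₂ : i + p = k) (h₃ : m + p = j) (h₄ : n + j = k)
    {U V W U' V' Z : X.Opens} (hU : U' ≤ U) (hV : U' ≤ tw σ n ⁻¹ᵁ V) (hU' : Z ≤ U')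
    (hW : Z ≤ tw σ i ⁻¹ᵁ W) (hV' : V' ≤ V) (hW' : V' ≤ tw σ m ⁻¹ᵁ W) (hZ : Z ≤ U)
    (hZ' : Z ≤ tw σ n ⁻¹ᵁ V') (a : Γ(E n, U)) (b : Γ(E m, V)) (c : Γ(E p, W)) :
    (mul h₂).toFun hU' hW ((mul h₁).toFun hU hV a b) c =
      (mul h₄).toFun hZ hZ' a ((mul h₃).toFun hV' hW' b c)

/-! ### The bimodule algebra `⨁ L ⊗ L^σ ⊗ ⋯ ⊗ L^{σ^{n-1}}` -/

/-- The sheaf `L_n = L ⊗ L^σ ⊗ ⋯ ⊗ L^{σ^{n-1}}`. -/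
def Lpow (σ : Aut X) (L : X.Modules) : ℕ → X.Modules
  | 0 => structureModule X
  | n + 1 => tensor (Lpow σ L n) (twist σ n L)

/-- The multiplication `M × 𝒪_X → M`, `(a, f) ↦ a f^τ`. -/
def scalarPairing (τ : X ⟶ X) (M : X.Modules) : Pairing τ M (structureModule X) M where
  toFun {U V W} hU hV a f := resO hV ((τ.app V).hom (toFn f)) • res M hU a
  add_left hU hV a a' b := by rw [map_add, smul_add]
  add_right {U V W} hU hV a b b' := by
    have : toFn (b + b') = toFn b + toFn b' := rfl
    rw [this, map_add, map_add, add_smul]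
  smul_left hU hV r a b := by rw [res_smul, smul_comm]
  smul_right {U V W} hU hV r a b := by
    have : toFn (r • b) = r * toFn b := rfl
    rw [this, map_mul, map_mul, mul_smul]
  res_toFun hU hV hW a b := by rw [res_smul, resO_resO, res_res]
  toFun_res {U V U' V' W} hU hV hWU hWV a b := by
    have h : toFn (res _ hV b) = resO hV (toFn b) := rfl
    have := ConcreteCategory.congr_hom (τ.naturality (homOfLE hV).op) (toFn b)
    change (τ.app V').hom (resO hV (toFn b)) =
      resO (τ.preimage_mono hV) ((τ.app V).hom (toFn b)) at this
    rw [res_res, h, this, resO_resO]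

/-- The multiplication `L_n ⊗ (σ^n)^* L_m → L_{n + m}`, given by
`(l₀ ⊗ ⋯ ⊗ l_{n-1}) · (l'₀ ⊗ ⋯ ⊗ l'_{m-1}) = l₀ ⊗ ⋯ ⊗ l_{n-1} ⊗ l'₀^{σ^n} ⊗ ⋯ ⊗ l'_{m-1}^{σ^n}`. -/
def Lmul (σ : Aut X) (L : X.Modules) (n : ℕ) :
    ∀ m : ℕ, Pairing (tw σ n) (Lpow σ L n) (Lpow σ L m) (Lpow σ L (n + m))
  | 0 => scalarPairing _ _
  | m + 1 => tensorExt (Lmul σ L n m)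
      (shiftHom σ L (i := n) (j := m) (k := (n + m : ℕ)) (by push_cast; rfl))

/-- Sections of `P i` as sections of `P j`. -/
def castSec (P : ℕ → X.Modules) {i j : ℕ} (h : i = j) {W : X.Opens} (s : Γ(P i, W)) : Γ(P j, W) :=
  h ▸ s

lemma castSec_rfl (P : ℕ → X.Modules) {i : ℕ} {W : X.Opens} (s : Γ(P i, W)) :
    castSec P rfl s = s := rfl

/-- The tensor product of sections, as a map `L_n × L^{σ^n} → L_{n+1}`. -/
def tmulL (σ : Aut X) (L : X.Modules) {i : ℕ} {W : X.Opens}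
    (s : Γ(Lpow σ L i, W)) (t : Γ(twist σ i L, W)) : Γ(Lpow σ L (i + 1), W) :=
  tmul (M := Lpow σ L i) (N := twist σ i L) s t

lemma castSec_tmulL (σ : Aut X) (L : X.Modules) {i j : ℕ} (h : i = j) {W : X.Opens}
    (s : Γ(Lpow σ L i, W)) (t : Γ(twist σ i L, W)) :
    castSec (Lpow σ L) (congrArg (· + 1) h) (tmulL σ L s t) =
      tmulL σ L (castSec (Lpow σ L) h s) (h ▸ t) := by
  subst h; rfl

lemma Pairing.toFun_zero_left {τ : X ⟶ X} {M N P : X.Modules} (β : Pairing τ M N P)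
    {U V W : X.Opens} (hU : W ≤ U) (hV : W ≤ τ ⁻¹ᵁ V) (b : Γ(N, V)) :
    β.toFun hU hV 0 b = 0 := by
  have := β.add_left hU hV 0 0 b
  rwa [add_zero, left_eq_add] at this

lemma Pairing.toFun_zero_right {τ : X ⟶ X} {M N P : X.Modules} (β : Pairing τ M N P)
    {U V W : X.Opens} (hU : W ≤ U) (hV : W ≤ τ ⁻¹ᵁ V) (a : Γ(M, U)) :
    β.toFun hU hV a 0 = 0 := by
  have := β.add_right hU hV a 0 0
  rwa [add_zero, left_eq_add] at this

lemma Lmul_tmul (σ : Aut X) (L : X.Modules) (n m : ℕ) {U V W : X.Opens} (hU : W ≤ U)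
    (hV : W ≤ tw σ n ⁻¹ᵁ V) (a : Γ(Lpow σ L n, U)) (x : Γ(Lpow σ L m, V))
    (y : Γ(twist σ m L, V)) :
    (Lmul σ L n (m + 1)).toFun hU hV a (tmulL σ L x y) =
      (tmulL σ L ((Lmul σ L n m).toFun hU hV a x)
        (semi (shiftHom σ L (i := n) (j := m) (k := (n + m : ℕ)) (by push_cast; rfl)) hV y) :
        Γ(Lpow σ L (n + m + 1), W)) :=
  tensorExt_tmul _ _ hU hV a x y

lemma castSec_semi (σ : Aut X) (L : X.Modules) {i j : ℕ} (h : i = j) {W V : X.Opens}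
    {n m : ℤ} (h' : n + m = i) (h'' : n + m = j) (hV : W ≤ tw σ n ⁻¹ᵁ V) (y : Γ(twist σ m L, V)) :
    (h ▸ (semi (shiftHom σ L h') hV y : Γ(twist σ (i : ℤ) L, W)) : Γ(twist σ (j : ℤ) L, W)) =
      semi (shiftHom σ L h'') hV y := by
  subst h; rfl

lemma castSec_res (P : ℕ → X.Modules) {i j : ℕ} (h : i = j) {V W : X.Opens} (hW : W ≤ V)
    (s : Γ(P i, V)) : res (P j) hW (castSec P h s) = castSec P h (res (P i) hW s) := by
  subst h; rfl

lemma castSec_add (P : ℕ → X.Modules) {i j : ℕ} (h : i = j) {W : X.Opens}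
    (s t : Γ(P i, W)) : castSec P h (s + t) = castSec P h s + castSec P h t := by
  subst h; rfl

lemma castSec_zero (P : ℕ → X.Modules) {i j : ℕ} (h : i = j) {W : X.Opens} :
    castSec P h (0 : Γ(P i, W)) = 0 := by
  subst h; rfl

lemma castSec_smul (P : ℕ → X.Modules) {i j : ℕ} (h : i = j) {W : X.Opens} (r : Γ(X, W))
    (s : Γ(P i, W)) : castSec P h (r • s) = r • castSec P h s := by
  subst h; rfl

lemma Lmul_assoc (σ : Aut X) (L : X.Modules) (n m : ℕ) (p : ℕ)
    {U V W U' V' Z : X.Opens} (hU : U' ≤ U) (hV : U' ≤ tw σ n ⁻¹ᵁ V) (hU' : Z ≤ U')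
    (hW : Z ≤ tw σ (n + m : ℕ) ⁻¹ᵁ W) (hV' : V' ≤ V) (hW' : V' ≤ tw σ m ⁻¹ᵁ W) (hZ : Z ≤ U)
    (hZ' : Z ≤ tw σ n ⁻¹ᵁ V') (a : Γ(Lpow σ L n, U)) (b : Γ(Lpow σ L m, V))
    (c : Γ(Lpow σ L p, W)) :
    (Lmul σ L (n + m) p).toFun hU' hW ((Lmul σ L n m).toFun hU hV a b) c =
      castSec (Lpow σ L) (Nat.add_assoc n m p).symm
        ((Lmul σ L n (m + p)).toFun hZ hZ' a ((Lmul σ L m p).toFun hV' hW' b c)) := by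
  induction p generalizing U V W U' V' Z with
  | zero =>
    change resO hW ((Scheme.Hom.app _ W).hom (toFn c)) • res _ hU' ((Lmul σ L n m).toFun hU hV a b) =
      (Lmul σ L n m).toFun hZ hZ' a (resO hW' ((Scheme.Hom.app _ W).hom (toFn c)) • res _ hV' b)
    have e1 := (Lmul σ L n m).toFun_res (le_refl U) hV' hZ hZ' a b
    rw [res_self] at e1
    rw [Pairing.res_toFun, Pairing.smul_right, e1]
    congr 1
    have h1 := ConcreteCategory.congr_hom ((tw σ n).naturality (homOfLE hW').op)
      ((Scheme.Hom.app (tw σ m) W).hom (toFn c))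
    change ((tw σ n).app V').hom (resO hW' (((tw σ m).app W).hom (toFn c))) =
      resO ((tw σ n).preimage_mono hW') (((tw σ n).app _).hom (((tw σ m).app W).hom (toFn c))) at h1
    rw [h1, resO_resO]
    have key : ∀ (τ : X ⟶ X) (_ : τ = tw σ n ≫ tw σ m) (h : Z ≤ τ ⁻¹ᵁ W),
        resO h ((τ.app W).hom (toFn c)) =
          resO (hZ'.trans ((tw σ n).preimage_mono hW'))
            (((tw σ n).app _).hom (((tw σ m).app W).hom (toFn c))) := by
      rintro _ rfl h
      rw [Scheme.Hom.comp_app]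
      rfl
    exact key _ (tw_add σ (by push_cast; ring)) hW
  | succ p ih =>
    have claim : ∀ {W Z V' : X.Opens} (hU' : Z ≤ U')
        (hW : Z ≤ tw σ (n + m : ℕ) ⁻¹ᵁ W) (hV' : V' ≤ V) (hW' : V' ≤ tw σ m ⁻¹ᵁ W) (hZ : Z ≤ U)
        (hZ' : Z ≤ tw σ n ⁻¹ᵁ V') (q : Γ(Lpow σ L p, W) ⊗[Γ(X, W)] Γ(twist σ p L, W)),
        (Lmul σ L (n + m) (p + 1)).toFun hU' hW ((Lmul σ L n m).toFun hU hV a b)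
            (toTensor _ _ W q : Γ(Lpow σ L (p + 1), W)) =
          castSec (Lpow σ L) (Nat.add_assoc n m (p + 1)).symm
            ((Lmul σ L n (m + (p + 1))).toFun hZ hZ' a ((Lmul σ L m (p + 1)).toFun hV' hW' b
              (toTensor _ _ W q : Γ(Lpow σ L (p + 1), W)))) := by
      intro W Z V' hU' hW hV' hW' hZ hZ' q
      induction q with
      | zero =>
        rw [map_zero]
        erw [Pairing.toFun_zero_right, Pairing.toFun_zero_right, Pairing.toFun_zero_right]
        exact (castSec_zero _ _).symm
      | add q q' hq hq' =>
        rw [map_add]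
        erw [Pairing.add_right, Pairing.add_right, Pairing.add_right, castSec_add]
        exact congrArg₂ (· + ·) hq hq'
      | tmul y z =>
        have h1 := Lmul_tmul σ L (n + m) p hU' hW ((Lmul σ L n m).toFun hU hV a b) y z
        have h2 := Lmul_tmul σ L m p hV' hW' b y z
        have h3 := Lmul_tmul σ L n (m + p) hZ hZ' a ((Lmul σ L m p).toFun hV' hW' b y)
          (semi (shiftHom σ L (i := m) (j := p) (k := (m + p : ℕ)) (by push_cast; rfl)) hW' z)
        have h4 := ih hU hV hU' hW hV' hW' hZ hZ' a b y
        refine h1.trans ?_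
        rw [h4]
        refine Eq.trans ?_ (congrArg (fun t => castSec (Lpow σ L)
          (Nat.add_assoc n m (p + 1)).symm ((Lmul σ L n (m + (p + 1))).toFun hZ hZ' a t)) h2.symm)
        refine Eq.trans ?_ (congrArg (castSec (Lpow σ L) (Nat.add_assoc n m (p + 1)).symm) h3.symm)
        refine Eq.trans ?_ (castSec_tmulL σ L (Nat.add_assoc n m p).symm _ _).symm
        rw [castSec_semi σ L (Nat.add_assoc n m p).symm _ (by push_cast; ring),
          semi_shiftHom_semi_shiftHom σ L _ _ (n := ((n + m : ℕ) : ℤ)) (by push_cast; rfl)]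
    apply eq_of_locally
    intro x hx
    obtain ⟨W₁, hW₁, hxW₁, q, hq⟩ := toTensor_locally_surjective _ _ c (hW hx)
    have hpre : Z ⊓ tw σ (n + m : ℕ) ⁻¹ᵁ W₁ ≤ tw σ n ⁻¹ᵁ (V' ⊓ tw σ m ⁻¹ᵁ W₁) := by
      intro z hz
      refine ⟨hZ' hz.1, ?_⟩
      have := hz.2
      rwa [tw_preimage σ (show (m : ℤ) + n = (n + m : ℕ) by push_cast; ring)] at this
    have := claim (W := W₁) (Z := Z ⊓ tw σ (n + m : ℕ) ⁻¹ᵁ W₁) (V' := V' ⊓ tw σ m ⁻¹ᵁ W₁)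
      (inf_le_left.trans hU') inf_le_right (inf_le_left.trans hV') inf_le_right
      (inf_le_left.trans hZ) hpre q
    refine ⟨Z ⊓ tw σ (n + m : ℕ) ⁻¹ᵁ W₁, inf_le_left, ⟨hx, hxW₁⟩, ?_⟩
    rw [hq] at this
    rw [Pairing.res_toFun, castSec_res, Pairing.res_toFun]
    have e1 := (Lmul σ L (n + m) (p + 1)).toFun_res (le_refl U') hW₁
      (inf_le_left.trans hU' : Z ⊓ tw σ (n + m : ℕ) ⁻¹ᵁ W₁ ≤ U') inf_le_right
      ((Lmul σ L n m).toFun hU hV a b) c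
    rw [res_self] at e1
    have e2 := (Lmul σ L m (p + 1)).toFun_res (le_refl V) hW₁
      (inf_le_left.trans hV' : V' ⊓ tw σ m ⁻¹ᵁ W₁ ≤ V) inf_le_right b c
    rw [res_self] at e2
    have e3 := (Lmul σ L m (p + 1)).res_toFun hV' hW'
      (inf_le_left : V' ⊓ tw σ m ⁻¹ᵁ W₁ ≤ V') b c
    have e4 := (Lmul σ L n (m + (p + 1))).toFun_res (le_refl U)
      (inf_le_left : V' ⊓ tw σ m ⁻¹ᵁ W₁ ≤ V') (inf_le_left.trans hZ) hpre a
      ((Lmul σ L m (p + 1)).toFun hV' hW' b c)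
    rw [res_self, e3] at e4
    refine e1.symm.trans (this.trans ?_)
    refine congrArg _ ?_
    refine Eq.trans ?_ e4
    exact congrArg _ e2

/-- The unit section of `L_0 = 𝒪_X`. -/
def Lone (σ : Aut X) (L : X.Modules) : Γ(Lpow σ L 0, ⊤) := ofFun (1 : Γ(X, ⊤))

lemma Lmul_one_left (σ : Aut X) (L : X.Modules) (m : ℕ) {V W : X.Opens}
    (hV : W ≤ tw σ (0 : ℕ) ⁻¹ᵁ V) (hV' : W ≤ V) (b : Γ(Lpow σ L m, V)) :
    castSec (Lpow σ L) (Nat.zero_add m)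
      ((Lmul σ L 0 m).toFun le_top hV (Lone σ L) b) =
      res (Lpow σ L m) hV' b := by
  induction m generalizing V W with
  | zero =>
    have h1 : resO (le_top : W ≤ ⊤) (1 : Γ(X, ⊤)) = 1 := map_one _
    have h2 : resO hV ((Scheme.Hom.app _ V).hom (toFn b)) * resO le_top 1 =
        resO hV ((Scheme.Hom.app _ V).hom (toFn b)) :=
      (congrArg _ h1).trans (_root_.mul_one _)
    refine Eq.trans h2 ?_
    have key : ∀ (τ : X ⟶ X) (_ : τ = 𝟙 X) (h : W ≤ τ ⁻¹ᵁ V),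
        resO h ((τ.app V).hom (toFn b)) = resO hV' (toFn b) := by
      rintro _ rfl h
      rw [Scheme.Hom.id_app]
      rfl
    exact key _ (tw_zero σ) hV
  | succ m ih =>
    have claim : ∀ {V W : X.Opens} (hV : W ≤ tw σ (0 : ℕ) ⁻¹ᵁ V) (hV' : W ≤ V)
        (q : Γ(Lpow σ L m, V) ⊗[Γ(X, V)] Γ(twist σ m L, V)),
        castSec (Lpow σ L) (Nat.zero_add (m + 1))
          ((Lmul σ L 0 (m + 1)).toFun le_top hV (Lone σ L)
            (toTensor _ _ V q : Γ(Lpow σ L (m + 1), V))) =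
          res (Lpow σ L (m + 1)) hV' (toTensor _ _ V q : Γ(Lpow σ L (m + 1), V)) := by
      intro V W hV hV' q
      induction q with
      | zero =>
        rw [map_zero]
        erw [Pairing.toFun_zero_right, map_zero]
        exact castSec_zero _ _
      | add q q' hq hq' =>
        rw [map_add]
        erw [Pairing.add_right, castSec_add, map_add]
        exact congrArg₂ (· + ·) hq hq'
      | tmul y z =>
        have h1 := Lmul_tmul σ L 0 m (le_top : W ≤ ⊤) hV
          (Lone σ L) y z
        refine (congrArg (castSec (Lpow σ L) (Nat.zero_add (m + 1))) h1).trans ?_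
        refine (castSec_tmulL σ L (Nat.zero_add m) _ _).trans ?_
        rw [ih hV hV' y, castSec_semi σ L (Nat.zero_add m) _ (by simp)]
        refine Eq.trans ?_ (res_tmul hV' y z).symm
        rw [semi_shiftHom_apply]
        rfl
    apply eq_of_locally
    intro x hx
    obtain ⟨V₁, hV₁, hxV₁, q, hq⟩ := toTensor_locally_surjective _ _ b (hV' hx)
    have hpre : W ⊓ V₁ ≤ tw σ (0 : ℕ) ⁻¹ᵁ V₁ := by
      have := tw_preimage_zero σ V₁
      rw [Nat.cast_zero, this]
      exact inf_le_right
    have := claim hpre inf_le_right q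
    refine ⟨W ⊓ V₁, inf_le_left, ⟨hx, hxV₁⟩, ?_⟩
    rw [hq] at this
    rw [castSec_res, Pairing.res_toFun, res_res]
    have e1 := (Lmul σ L 0 (m + 1)).toFun_res (le_refl ⊤) hV₁ (le_top : W ⊓ V₁ ≤ ⊤) hpre
      (Lone σ L) b
    rw [res_self] at e1
    exact (congrArg _ e1.symm).trans (this.trans (res_res _ _ _ _))

/-- Transport of a pairing along an equality of indices. -/
def Pairing.castTo {τ : X ⟶ X} {M N : X.Modules} (P : ℕ → X.Modules) {i j : ℕ} (h : i = j)
    (β : Pairing τ M N (P i)) : Pairing τ M N (P j) :=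
  h ▸ β

lemma Pairing.castTo_toFun {τ : X ⟶ X} {M N : X.Modules} (P : ℕ → X.Modules) {i j : ℕ} (h : i = j)
    (β : Pairing τ M N (P i)) {U V W : X.Opens} (hU : W ≤ U) (hV : W ≤ τ ⁻¹ᵁ V)
    (a : Γ(M, U)) (b : Γ(N, V)) :
    (β.castTo P h).toFun hU hV a b = castSec P h (β.toFun hU hV a b) := by
  subst h; rfl

/-- The graded bimodule algebra `⨁ ₁(L_n)_{σ^n}` with `L_n = L ⊗ L^σ ⊗ ⋯ ⊗ L^{σ^{n-1}}`. -/
def twistedAlgebra (σ : Aut X) (L : X.Modules) : GradedBimoduleAlgebra σ where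
  E := Lpow σ L
  mul {n m _} h := (Lmul σ L n m).castTo (Lpow σ L) h
  one := Lone σ L
  bijective_one U := by
    have : (fun f : Γ(X, U) => f • res (Lpow σ L 0) (le_top : U ≤ ⊤) (Lone σ L)) =
        (fun f : Γ(X, U) => ofFun f) := by
      funext f
      have h1 : resO (le_top : U ≤ ⊤) (1 : Γ(X, ⊤)) = 1 := map_one _
      exact (congrArg (fun g => f * g) h1).trans (_root_.mul_one f)
    rw [this]
    exact Function.bijective_id
  one_mul hV hV' b := by
    rw [Pairing.castTo_toFun]
    exact Lmul_one_left σ L _ hV hV' b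
  mul_one {n U W} hU a := by
    have h1 : resO (le_top : W ≤ tw σ n ⁻¹ᵁ ⊤) ((Scheme.Hom.app (tw σ n) ⊤).hom 1) = 1 :=
      (congrArg _ (map_one _)).trans (map_one _)
    exact (congrArg (fun r : Γ(X, W) => r • res (Lpow σ L n) hU a) h1).trans (one_smul _ _)
  mul_assoc {n m p i j k} h₁ h₂ h₃ h₄ {U V W U' V' Z} hU hV hU' hW hV' hW' hZ hZ' a b c := by
    subst h₁ h₂ h₃
    rw [Pairing.castTo_toFun, Pairing.castTo_toFun, Pairing.castTo_toFun, Pairing.castTo_toFun]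
    exact Lmul_assoc σ L n m p hU hV hU' hW hV' hW' hZ hZ' a b c

/-! ### Subsheaves of modules -/

/-- A subsheaf of `𝒪_X`-modules of `M`. -/
structure Subsheaf (M : X.Modules) where
  obj (U : X.Opens) : Submodule Γ(X, U) Γ(M, U)
  res_mem {U V : X.Opens} (h : V ≤ U) {s : Γ(M, U)} (hs : s ∈ obj U) : res M h s ∈ obj V
  mem_of_local {U : X.Opens} (s : Γ(M, U))
    (hs : ∀ x ∈ U, ∃ (V : X.Opens) (h : V ≤ U), x ∈ V ∧ res M h s ∈ obj V) : s ∈ obj U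

namespace Subsheaf

variable {M : X.Modules} (S : Subsheaf M)

/-- The underlying subpresheaf. -/
def toSubmodule : PresheafOfModules.Submodule M.val where
  obj U := S.obj U.unop
  map f _ hs := S.res_mem (leOfHom f.unop) hs

lemma isSheaf : TopCat.Presheaf.IsSheaf S.toSubmodule.toPresheafOfModules.presheaf := by
  rw [TopCat.Presheaf.isSheaf_iff_isSheaf_comp (forget Ab)]
  apply TopCat.Presheaf.isSheaf_of_isSheafUniqueGluing_types
  intro ι U sf hsf
  have hc : TopCat.Presheaf.IsCompatible M.presheaf U
      (fun i => (show S.obj (U i) from sf i).1) := by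
    intro i j
    exact congrArg Subtype.val (hsf i j)
  obtain ⟨s, hs, hs'⟩ := TopCat.Sheaf.existsUnique_gluing ⟨M.presheaf, M.isSheaf⟩ U _ hc
  have hmem : (s : Γ(M, iSup U)) ∈ S.obj (iSup U) := by
    apply S.mem_of_local
    intro x hx
    obtain ⟨i, hi⟩ := Opens.mem_iSup.mp hx
    refine ⟨U i, le_iSup U i, hi, ?_⟩
    have : res M (le_iSup U i) s = (show S.obj (U i) from sf i).1 := hs i
    rw [this]
    exact (show S.obj (U i) from sf i).2
  refine ⟨(⟨s, hmem⟩ : S.obj (iSup U)), fun i => Subtype.ext (hs i), ?_⟩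
  intro t ht
  apply Subtype.ext
  exact hs' _ (fun i => congrArg Subtype.val (ht i))

/-- A subsheaf as a sheaf of modules. -/
def toModules : X.Modules where
  val := S.toSubmodule.toPresheafOfModules
  isSheaf := S.isSheaf

/-- The inclusion on sections. -/
def val {U : X.Opens} (s : Γ(S.toModules, U)) : Γ(M, U) := (s : S.obj U).1

/-- A section of `M` that lies in the subsheaf. -/
def lift {U : X.Opens} (s : Γ(M, U)) (hs : s ∈ S.obj U) : Γ(S.toModules, U) :=
  (⟨s, hs⟩ : S.obj U)

lemma val_mem {U : X.Opens} (s : Γ(S.toModules, U)) : S.val s ∈ S.obj U := (s : S.obj U).2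

lemma val_lift {U : X.Opens} (s : Γ(M, U)) (hs : s ∈ S.obj U) : S.val (S.lift s hs) = s := rfl

lemma val_injective {U : X.Opens} : Function.Injective (S.val (U := U)) :=
  fun _ _ h => Subtype.ext h

lemma val_add {U : X.Opens} (s t : Γ(S.toModules, U)) : S.val (s + t) = S.val s + S.val t := rfl

lemma val_smul {U : X.Opens} (r : Γ(X, U)) (s : Γ(S.toModules, U)) :
    S.val (r • s) = r • S.val s := rfl

lemma val_res {U V : X.Opens} (h : V ≤ U) (s : Γ(S.toModules, U)) :
    S.val (res S.toModules h s) = res M h (S.val s) := rfl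

end Subsheaf

/-- The restriction of a pairing to subsheaves. -/
def Pairing.restrict {τ : X ⟶ X} {M N P : X.Modules} (β : Pairing τ M N P) (S : Subsheaf M)
    (T : Subsheaf N) (Q : Subsheaf P)
    (H : ∀ {U V W : X.Opens} (hU : W ≤ U) (hV : W ≤ τ ⁻¹ᵁ V), ∀ a ∈ S.obj U, ∀ b ∈ T.obj V,
      β.toFun hU hV a b ∈ Q.obj W) :
    Pairing τ S.toModules T.toModules Q.toModules where
  toFun hU hV a b := Q.lift (β.toFun hU hV (S.val a) (T.val b))
    (H hU hV _ (S.val_mem a) _ (T.val_mem b))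
  add_left hU hV _ _ _ := Q.val_injective (β.add_left hU hV _ _ _)
  add_right hU hV _ _ _ := Q.val_injective (β.add_right hU hV _ _ _)
  smul_left hU hV _ _ _ := Q.val_injective (β.smul_left hU hV _ _ _)
  smul_right hU hV _ _ _ := Q.val_injective (β.smul_right hU hV _ _ _)
  res_toFun hU hV hW _ _ := Q.val_injective (β.res_toFun hU hV hW _ _)
  toFun_res hU hV hWU hWV _ _ := Q.val_injective (β.toFun_res hU hV hWU hWV _ _)

/-- The graded sub-bimodule algebra given by subsheaves closed under multiplication, with the same
part in degree zero. -/
def GradedBimoduleAlgebra.sub {σ : Aut X} (B : GradedBimoduleAlgebra σ)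
    (S : ∀ n, Subsheaf (B.E n)) (hS : ∀ U, (S 0).obj U = ⊤)
    (H : ∀ {n m k : ℕ} (h : n + m = k) {U V W : X.Opens} (hU : W ≤ U) (hV : W ≤ tw σ n ⁻¹ᵁ V),
      ∀ a ∈ (S n).obj U, ∀ b ∈ (S m).obj V, (B.mul h).toFun hU hV a b ∈ (S k).obj W) :
    GradedBimoduleAlgebra σ where
  E n := (S n).toModules
  mul {n m k} h := (B.mul h).restrict (S n) (S m) (S k) (H h)
  one := (S 0).lift B.one (by rw [hS]; trivial)
  bijective_one U := by
    refine ⟨fun f g hfg => (B.bijective_one U).1 (congrArg (S 0).val hfg), fun s => ?_⟩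
    obtain ⟨f, hf⟩ := (B.bijective_one U).2 ((S 0).val s)
    exact ⟨f, (S 0).val_injective hf⟩
  one_mul hV hV' b := (S _).val_injective (B.one_mul hV hV' _)
  mul_one hU a := (S _).val_injective (B.mul_one hU _)
  mul_assoc h₁ h₂ h₃ h₄ _ _ _ _ _ _ hU hV hU' hW hV' hW' hZ hZ' a b c :=
    (S _).val_injective (B.mul_assoc h₁ h₂ h₃ h₄ hU hV hU' hW hV' hW' hZ hZ' _ _ _)

/-! ### Products of ideal sheaves with modules -/

lemma exists_affine {U : X.Opens} {x : X} (hx : x ∈ U) :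
    ∃ V : X.affineOpens, x ∈ V.1 ∧ V.1 ≤ U := by
  obtain ⟨_, ⟨V, hV, rfl⟩, hxV, hVU⟩ :=
    X.isBasis_affineOpens.exists_subset_of_mem_open (show x ∈ (U : Set X) from hx) U.2
  exact ⟨⟨V, hV⟩, hxV, hVU⟩

lemma resO_mem_ideal (I : X.IdealSheafData) {U V : X.affineOpens} (h : V.1 ≤ U.1) {f : Γ(X, U.1)}
    (hf : f ∈ I.ideal U) : resO h f ∈ I.ideal V :=
  I.ideal_le_comap_ideal (U := V) (V := U) h hf

lemma res_mem_smul_top (I : X.IdealSheafData) (M : X.Modules) {U V : X.affineOpens} (h : V.1 ≤ U.1)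
    {s : Γ(M, U.1)} (hs : s ∈ I.ideal U • (⊤ : Submodule Γ(X, U.1) Γ(M, U.1))) :
    res M h s ∈ I.ideal V • (⊤ : Submodule Γ(X, V.1) Γ(M, V.1)) := by
  induction hs using Submodule.smul_induction_on' with
  | smul r hr n hn =>
    rw [res_smul]
    exact Submodule.smul_mem_smul (resO_mem_ideal I h hr) trivial
  | add x hx y hy hx' hy' =>
    rw [map_add]
    exact add_mem hx' hy'

/-- The subsheaf `I M` of `M`, for an ideal sheaf `I`: its sections are locally in `I(V) M(V)`. -/
def idealMul (I : X.IdealSheafData) (M : X.Modules) : Subsheaf M where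
  obj U :=
    { carrier := {s | ∀ x ∈ U, ∃ (V : X.affineOpens) (h : V.1 ≤ U), x ∈ V.1 ∧
        res M h s ∈ I.ideal V • (⊤ : Submodule Γ(X, V.1) Γ(M, V.1))}
      add_mem' := by
        intro s t hs ht x hx
        obtain ⟨V, hV, hxV, hsV⟩ := hs x hx
        obtain ⟨W, hW, hxW, htW⟩ := ht x hx
        obtain ⟨Z, hxZ, hZ⟩ := exists_affine (U := V.1 ⊓ W.1) ⟨hxV, hxW⟩
        refine ⟨Z, (hZ.trans inf_le_left).trans hV, hxZ, ?_⟩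
        have h1 := res_mem_smul_top I M (hZ.trans inf_le_left) hsV
        have h2 := res_mem_smul_top I M (hZ.trans inf_le_right) htW
        rw [res_res] at h1 h2
        rw [map_add]
        exact add_mem h1 h2
      zero_mem' := by
        intro x hx
        obtain ⟨Z, hxZ, hZ⟩ := exists_affine hx
        refine ⟨Z, hZ, hxZ, ?_⟩
        rw [map_zero]
        exact zero_mem _
      smul_mem' := by
        intro r s hs x hx
        obtain ⟨V, hV, hxV, hsV⟩ := hs x hx
        refine ⟨V, hV, hxV, ?_⟩
        rw [res_smul]
        exact Submodule.smul_mem _ _ hsV }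
  res_mem := by
    intro U U' h s hs x hx
    obtain ⟨V, hV, hxV, hsV⟩ := hs x (h hx)
    obtain ⟨Z, hxZ, hZ⟩ := exists_affine (U := V.1 ⊓ U') ⟨hxV, hx⟩
    refine ⟨Z, hZ.trans inf_le_right, hxZ, ?_⟩
    have h1 := res_mem_smul_top I M (hZ.trans inf_le_left) hsV
    rw [res_res] at h1 ⊢
    exact h1
  mem_of_local := by
    intro U s hs x hx
    obtain ⟨V, hV, hxV, hsV⟩ := hs x hx
    obtain ⟨W, hW, hxW, hsW⟩ := hsV x hxV
    refine ⟨W, hW.trans hV, hxW, ?_⟩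
    rw [res_res] at hsW
    exact hsW

lemma comap_mul (I J : X.IdealSheafData) (τ : X ⟶ X) [IsIso τ] :
    (I * J).comap τ = I.comap τ * J.comap τ := by
  ext U : 2
  have h : ∀ K : X.IdealSheafData, (K.comap τ).ideal U =
      (K.ideal ⟨τ ''ᵁ U, U.2.image_of_isOpenImmersion τ⟩).map
        (τ.appIso U).commRingCatIsoToRingEquiv := by
    intro K
    rw [Scheme.IdealSheafData.ideal_comap_of_isOpenImmersion]
    exact Ideal.comap_symm (τ.appIso U).commRingCatIsoToRingEquiv
  rw [h, Scheme.IdealSheafData.ideal_mul, Pi.mul_apply, Ideal.map_mul,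
    Scheme.IdealSheafData.ideal_mul, Pi.mul_apply, h, h]

lemma app_mem_comap (J : X.IdealSheafData) (τ : X ⟶ X) [IsIso τ] {V W : X.affineOpens}
    (h : W.1 ≤ τ ⁻¹ᵁ V.1) {g : Γ(X, V.1)} (hg : g ∈ J.ideal V) :
    resO h ((τ.app V.1).hom g) ∈ (J.comap τ).ideal W := by
  have h1 : J ≤ (J.comap τ).map τ := J.le_map_comap τ
  have h2 := h1 V hg
  rw [Scheme.IdealSheafData.ideal_map_of_isAffineHom] at h2
  exact resO_mem_ideal (J.comap τ) (U := ⟨_, V.2.preimage τ⟩) h h2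

/-- The ideal sheaf of a closed point, with its reduced structure. -/
def pointIdeal (c : X) (hc : IsClosed {c}) : X.IdealSheafData :=
  Scheme.IdealSheafData.vanishingIdeal ⟨{c}, hc⟩

/-- The ideal sheaf `I_n = I I^σ ⋯ I^{σ^{n-1}}`, where `I^{σ^i}` is the inverse image ideal sheaf
under `σ^i`. -/
def Ipow (σ : Aut X) (I : X.IdealSheafData) : ℕ → X.IdealSheafData
  | 0 => ⊤
  | n + 1 => Ipow σ I n * I.comap (tw σ n)

lemma Ipow_mul (σ : Aut X) (I : X.IdealSheafData) (n m : ℕ) :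
    Ipow σ I n * (Ipow σ I m).comap (tw σ n) = Ipow σ I (n + m) := by
  induction m with
  | zero => simp [Ipow]
  | succ m ih =>
    rw [Ipow, comap_mul, ← mul_assoc, ih, ← Scheme.IdealSheafData.comap_comp,
      ← tw_add σ (show (m : ℤ) + n = ((n + m : ℕ) : ℤ) by push_cast; ring)]
    rfl

lemma Pairing.mem_idealMul {τ : X ⟶ X} [IsIso τ] {M N P : X.Modules} (β : Pairing τ M N P)
    (I J K : X.IdealSheafData) (hIJ : I * J.comap τ ≤ K) {U V W : X.Opens} (hU : W ≤ U)
    (hV : W ≤ τ ⁻¹ᵁ V) {a : Γ(M, U)} (ha : a ∈ (idealMul I M).obj U) {b : Γ(N, V)}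
    (hb : b ∈ (idealMul J N).obj V) : β.toFun hU hV a b ∈ (idealMul K P).obj W := by
  intro x hx
  obtain ⟨U₁, hU₁, hx₁, ha₁⟩ := ha x (hU hx)
  obtain ⟨V₁, hV₁, hx₂, hb₁⟩ := hb (τ x) (hV hx)
  obtain ⟨Z, hxZ, hZ⟩ := exists_affine (U := W ⊓ (U₁.1 ⊓ τ ⁻¹ᵁ V₁.1)) ⟨hx, hx₁, hx₂⟩
  have hZU : Z.1 ≤ U₁.1 := fun z hz => (hZ hz).2.1
  have hZV : Z.1 ≤ τ ⁻¹ᵁ V₁.1 := fun z hz => (hZ hz).2.2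
  refine ⟨Z, hZ.trans inf_le_left, hxZ, ?_⟩
  rw [β.res_toFun, ← β.toFun_res hU₁ hV₁ hZU hZV]
  have key : ∀ a ∈ I.ideal U₁ • (⊤ : Submodule Γ(X, U₁.1) Γ(M, U₁.1)),
      ∀ b ∈ J.ideal V₁ • (⊤ : Submodule Γ(X, V₁.1) Γ(N, V₁.1)),
      β.toFun hZU hZV a b ∈ K.ideal Z • (⊤ : Submodule Γ(X, Z.1) Γ(P, Z.1)) := by
    intro a ha b hb
    induction ha using Submodule.smul_induction_on' with
    | add a a' _ _ h h' => rw [β.add_left]; exact add_mem h h'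
    | smul r hr m _ =>
      induction hb using Submodule.smul_induction_on' with
      | add b b' _ _ h h' => rw [β.add_right]; exact add_mem h h'
      | smul g hg n _ =>
        rw [β.smul_left, β.smul_right, smul_smul]
        refine Submodule.smul_mem_smul (hIJ Z ?_) trivial
        exact Ideal.mul_mem_mul (resO_mem_ideal I hZU hr) (app_mem_comap J τ hZV hg)
  exact key _ ha₁ _ hb₁

lemma idealMul_top (M : X.Modules) (U : X.Opens) :
    (idealMul (⊤ : X.IdealSheafData) M).obj U = ⊤ := by
  rw [eq_top_iff]
  rintro s -
  intro x hx
  obtain ⟨Z, hxZ, hZ⟩ := exists_affine hx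
  refine ⟨Z, hZ, hxZ, ?_⟩
  simp

/-- The bimodule algebra `𝓡(X, c, L, σ) = ⨁ ₁(I_n L_n)_{σ^n}`, a sub-bimodule algebra of
`⨁ ₁(L_n)_{σ^n}`. For invertible `L` the sheaf `I_n L_n ⊆ L_n` is `I_n ⊗ L_n`. -/
def rees (σ : Aut X) (c : X) (hc : IsClosed {c}) (L : X.Modules) : GradedBimoduleAlgebra σ :=
  (twistedAlgebra σ L).sub (fun n => idealMul (Ipow σ (pointIdeal c hc) n) (Lpow σ L n))
    (fun U => idealMul_top _ U)
    (by
      intro n m k h U V W hU hV a ha b hb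
      refine Pairing.mem_idealMul _ _ _ _ ?_ hU hV ha hb
      rw [← h, Ipow_mul])

/-! ### Graded modules over a graded bimodule algebra -/

/-- Quasi-coherent sheaves of modules. -/
def IsQuasicoherentSheaf (F : X.Modules) : Prop :=
  SheafOfModules.IsQuasicoherent.{u} (R := X.ringCatSheaf) F

/-- Coherent sheaves on a (locally noetherian) scheme: quasi-coherent and of finite type. -/
def IsCoherentSheaf (F : X.Modules) : Prop :=
  IsQuasicoherentSheaf F ∧ SheafOfModules.IsFiniteType.{u} (R := X.ringCatSheaf) F

variable {σ : Aut X}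

/-- A graded right module `⨁_{n ∈ ℤ} ₁(G_n)_{σ^n}` over `B`, with the quasi-coherent left sheaves
`G n` and the action maps `G_n ⊗ (σ^n)^* E_m ⟶ G_{n + m}`. -/
structure RightModule (B : GradedBimoduleAlgebra σ) where
  G : ℤ → X.Modules
  quasicoherent (n : ℤ) : IsQuasicoherentSheaf (G n)
  act {n : ℤ} {m : ℕ} {k : ℤ} (h : n + m = k) : Pairing (tw σ n) (G n) (B.E m) (G k)
  act_one {n : ℤ} {U W : X.Opens} (hU : W ≤ U) (a : Γ(G n, U)) :
    (act (by simp : n + (0 : ℕ) = n)).toFun hU le_top a B.one = res (G n) hU a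
  act_mul {n : ℤ} {m p : ℕ} {i : ℤ} {j : ℕ} {k : ℤ} (h₁ : n + m = i) (h₂ : i + p = k)
    (h₃ : m + p = j) (h₄ : n + j = k)
    {U V W U' V' Z : X.Opens} (hU : U' ≤ U) (hV : U' ≤ tw σ n ⁻¹ᵁ V) (hU' : Z ≤ U')
    (hW : Z ≤ tw σ i ⁻¹ᵁ W) (hV' : V' ≤ V) (hW' : V' ≤ tw σ m ⁻¹ᵁ W) (hZ : Z ≤ U)
    (hZ' : Z ≤ tw σ n ⁻¹ᵁ V') (a : Γ(G n, U)) (b : Γ(B.E m, V)) (c : Γ(B.E p, W)) :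
    (act h₂).toFun hU' hW ((act h₁).toFun hU hV a b) c =
      (act h₄).toFun hZ hZ' a ((B.mul h₃).toFun hV' hW' b c)

/-- A graded left module `⨁_{n ∈ ℤ} ₁(G_n)_{σ^n}` over `B`, with the quasi-coherent left sheaves
`G n` and the action maps `E_m ⊗ (σ^m)^* G_n ⟶ G_{m + n}`. -/
structure LeftModule (B : GradedBimoduleAlgebra σ) where
  G : ℤ → X.Modules
  quasicoherent (n : ℤ) : IsQuasicoherentSheaf (G n)
  act {m : ℕ} {n k : ℤ} (h : m + n = k) : Pairing (tw σ m) (B.E m) (G n) (G k)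
  one_act {n : ℤ} {V W : X.Opens} (hV : W ≤ tw σ (0 : ℕ) ⁻¹ᵁ V) (hV' : W ≤ V) (a : Γ(G n, V)) :
    (act (by simp : (0 : ℕ) + n = n)).toFun le_top hV B.one a = res (G n) hV' a
  mul_act {m p : ℕ} {n : ℤ} {i : ℕ} {j k : ℤ} (h₁ : m + p = i) (h₂ : i + n = k)
    (h₃ : p + n = j) (h₄ : m + j = k)
    {U V W U' V' Z : X.Opens} (hU : U' ≤ U) (hV : U' ≤ tw σ m ⁻¹ᵁ V) (hU' : Z ≤ U')
    (hW : Z ≤ tw σ i ⁻¹ᵁ W) (hV' : V' ≤ V) (hW' : V' ≤ tw σ p ⁻¹ᵁ W) (hZ : Z ≤ U)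
    (hZ' : Z ≤ tw σ m ⁻¹ᵁ V') (b : Γ(B.E m, U)) (c : Γ(B.E p, V)) (a : Γ(G n, W)) :
    (act h₂).toFun hU' hW ((B.mul h₁).toFun hU hV b c) a =
      (act h₄).toFun hZ hZ' b ((act h₃).toFun hV' hW' c a)

/-- A family of maps `F ⟶ N n` is locally finite if it defines a map `F ⟶ ⨁ N n`: every section
of `F` is locally killed by all but finitely many of the maps. -/
def IsLocallyFiniteFamily {F : X.Modules} {N : ℤ → X.Modules} (θ : ∀ n, F ⟶ N n) : Prop :=
  ∀ (U : X.Opens) (s : Γ(F, U)), ∀ x ∈ U, ∃ (V : X.Opens) (h : V ≤ U), x ∈ V ∧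
    {n : ℤ | (θ n).app V (res F h s) ≠ 0}.Finite

namespace RightModule

variable {B : GradedBimoduleAlgebra σ}

/-- The degree `n` component, over `W`, of the product `θ(s) · e`, where `θ : F ⟶ ⨁ (σ^i)_* G_i` is
a map to the right `𝒪_X`-module underlying `M`, `s` is a section of `F` over `σ^{-m} W`, and `e` is
a section of `E_m` over `σ^{-m} W`. -/
def component (M : RightModule B) {F : X.Modules}
    (θ : ∀ n : ℤ, F ⟶ (Scheme.Modules.pushforward (tw σ n)).obj (M.G n)) (n : ℤ) (W : X.Opens)
    (m : ℕ) (s : Γ(F, tw σ m ⁻¹ᵁ W)) (e : Γ(B.E m, tw σ m ⁻¹ᵁ W)) : Γ(M.G n, tw σ n ⁻¹ᵁ W) :=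
  (M.act (sub_add_cancel n (m : ℤ))).toFun
    (U := tw σ (n - m) ⁻¹ᵁ tw σ m ⁻¹ᵁ W)
    (le_of_eq (tw_preimage σ (add_sub_cancel (m : ℤ) n) W))
    (le_of_eq (tw_preimage σ (add_sub_cancel (m : ℤ) n) W))
    ((θ (n - m)).app (tw σ m ⁻¹ᵁ W) s) e

/-- A graded right module `M` is coherent if there are a coherent sheaf `F` and a surjective map
`F ⊗ B ⟶ M` of ungraded right `B`-modules. Such a map is given by a map `θ` from `F` to the right
`𝒪_X`-module `⨁ (σ^n)_* G_n` underlying `M`; it is surjective if every homogeneous local section is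
locally a finite sum of products `θ(s) · e`. -/
def IsCoherent (M : RightModule B) : Prop :=
  ∃ F : X.Modules, IsCoherentSheaf F ∧
    ∃ θ : ∀ n : ℤ, F ⟶ (Scheme.Modules.pushforward (tw σ n)).obj (M.G n),
      IsLocallyFiniteFamily θ ∧
      ∀ (d : ℤ) (V : X.Opens) (g : Γ(M.G d, tw σ d ⁻¹ᵁ V)), ∀ x ∈ V,
        ∃ (W : X.Opens) (hW : W ≤ V), x ∈ W ∧ ∃ (r : ℕ) (m : Fin r → ℕ)
          (s : ∀ j, Γ(F, tw σ (m j) ⁻¹ᵁ W)) (e : ∀ j, Γ(B.E (m j), tw σ (m j) ⁻¹ᵁ W)),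
          ∑ j, M.component θ d W (m j) (s j) (e j) =
            res (M.G d) ((tw σ d).preimage_mono hW) g ∧
          ∀ n, n ≠ d → ∑ j, M.component θ n W (m j) (s j) (e j) = 0

/-- A graded module is bounded if all but finitely many of its components vanish. -/
def IsBounded (M : RightModule B) : Prop :=
  {n : ℤ | ¬ Limits.IsZero (M.G n)}.Finite

/-- Homomorphisms of graded right modules, of degree zero. -/
structure Hom (M N : RightModule B) where
  app (n : ℤ) : M.G n ⟶ N.G n
  app_act {n : ℤ} {m : ℕ} {k : ℤ} (h : n + m = k) {U V W : X.Opens} (hU : W ≤ U)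
    (hV : W ≤ tw σ n ⁻¹ᵁ V) (a : Γ(M.G n, U)) (b : Γ(B.E m, V)) :
    (app k).app W ((M.act h).toFun hU hV a b) = (N.act h).toFun hU hV ((app n).app U a) b

/-- Injective homomorphisms. -/
def Hom.IsInjective {M N : RightModule B} (f : Hom M N) : Prop :=
  ∀ (n : ℤ) (U : X.Opens), Function.Injective ((f.app n).app U)

/-- Surjective homomorphisms (as maps of sheaves). -/
def Hom.IsSurjective {M N : RightModule B} (f : Hom M N) : Prop :=
  ∀ (n : ℤ) (U : X.Opens) (t : Γ(N.G n, U)), ∀ x ∈ U, ∃ (V : X.Opens) (h : V ≤ U), x ∈ V ∧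
    ∃ s : Γ(M.G n, V), (f.app n).app V s = res (N.G n) h t

/-- A graded right module is torsion if each of its coherent submodules is bounded. -/
def IsTorsion (M : RightModule B) : Prop :=
  ∀ (N : RightModule B) (i : Hom N M), i.IsInjective → N.IsCoherent → N.IsBounded

end RightModule

namespace LeftModule

variable {B : GradedBimoduleAlgebra σ}

/-- The degree `n` component, over `W`, of the product `e · θ(s)`, where `θ : F ⟶ ⨁ G_i` is a map to
the left `𝒪_X`-module underlying `M`, `e` is a section of `E_m` over `W`, and `s` is a section of
`F^{σ^m}` over `W`. -/
def component (M : LeftModule B) {F : X.Modules} (θ : ∀ n : ℤ, F ⟶ M.G n) (n : ℤ) (W : X.Opens)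
    (m : ℕ) (e : Γ(B.E m, W)) (s : Γ(twist σ m F, W)) : Γ(M.G n, W) :=
  (M.act (add_sub_cancel (m : ℤ) n)).toFun (V := tw σ (-(m : ℤ)) ⁻¹ᵁ W) le_rfl
    (le_of_eq (by rw [← tw_preimage σ (neg_add_cancel (m : ℤ)), tw_preimage_zero]))
    e ((θ (n - m)).app (tw σ (-(m : ℤ)) ⁻¹ᵁ W) s)

/-- A graded left module `M` is coherent if there are a coherent sheaf `F` and a surjective map
`B ⊗ F ⟶ M` of ungraded left `B`-modules. Such a map is given by a map `θ` from `F` to the left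
`𝒪_X`-module `⨁ G_n` underlying `M`; it is surjective if every homogeneous local section is locally
a finite sum of products `e · θ(s)`. -/
def IsCoherent (M : LeftModule B) : Prop :=
  ∃ F : X.Modules, IsCoherentSheaf F ∧
    ∃ θ : ∀ n : ℤ, F ⟶ M.G n,
      IsLocallyFiniteFamily θ ∧
      ∀ (d : ℤ) (V : X.Opens) (g : Γ(M.G d, V)), ∀ x ∈ V,
        ∃ (W : X.Opens) (hW : W ≤ V), x ∈ W ∧ ∃ (r : ℕ) (m : Fin r → ℕ)
          (e : ∀ j, Γ(B.E (m j), W)) (s : ∀ j, Γ(twist σ (m j) F, W)),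
          ∑ j, M.component θ d W (m j) (e j) (s j) = res (M.G d) hW g ∧
          ∀ n, n ≠ d → ∑ j, M.component θ n W (m j) (e j) (s j) = 0

end LeftModule

/-! ### Ideals and noetherian bimodule algebras -/

/-- A graded right ideal of `B`: a graded right module with an embedding into `B`. -/
structure RightIdeal (B : GradedBimoduleAlgebra σ) extends RightModule B where
  isZero_of_neg (n : ℤ) (hn : n < 0) : Limits.IsZero (G n)
  incl (n : ℕ) : G n ⟶ B.E n
  incl_injective (n : ℕ) (U : X.Opens) : Function.Injective ((incl n).app U)
  incl_act {n m k : ℕ} (h : n + m = k) {U V W : X.Opens} (hU : W ≤ U) (hV : W ≤ tw σ n ⁻¹ᵁ V)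
    (a : Γ(G n, U)) (b : Γ(B.E m, V)) :
    (incl k).app W ((act (by exact_mod_cast h : (n : ℤ) + m = k)).toFun hU hV a b) =
      (B.mul h).toFun hU hV ((incl n).app U a) b

/-- A graded left ideal of `B`: a graded left module with an embedding into `B`. -/
structure LeftIdeal (B : GradedBimoduleAlgebra σ) extends LeftModule B where
  isZero_of_neg (n : ℤ) (hn : n < 0) : Limits.IsZero (G n)
  incl (n : ℕ) : G n ⟶ B.E n
  incl_injective (n : ℕ) (U : X.Opens) : Function.Injective ((incl n).app U)
  incl_act {m n k : ℕ} (h : m + n = k) {U V W : X.Opens} (hU : W ≤ U) (hV : W ≤ tw σ m ⁻¹ᵁ V)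
    (b : Γ(B.E m, U)) (a : Γ(G n, V)) :
    (incl k).app W ((act (by exact_mod_cast h : (m : ℤ) + n = k)).toFun hU hV b a) =
      (B.mul h).toFun hU hV b ((incl n).app V a)

namespace RightIdeal

variable {B : GradedBimoduleAlgebra σ}

/-- The section `t` of `B` belongs to the right ideal `J`. -/
def Mem (J : RightIdeal B) {n : ℕ} {U : X.Opens} (t : Γ(B.E n, U)) : Prop :=
  ∃ s : Γ(J.G n, U), (J.incl n).app U s = t

/-- Inclusion of right ideals. -/
def Le (J J' : RightIdeal B) : Prop :=
  ∀ (n : ℕ) (U : X.Opens) (t : Γ(B.E n, U)), J.Mem t → J'.Mem t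

/-- The homomorphism `π : J' → Q` identifies `Q` with the factor `J' / J`: it is surjective with
kernel `J`. -/
def IsFactor (J J' : RightIdeal B) (Q : RightModule B)
    (π : RightModule.Hom J'.toRightModule Q) : Prop :=
  π.IsSurjective ∧ ∀ (n : ℕ) (U : X.Opens) (s : Γ(J'.G n, U)),
    (π.app n).app U s = 0 ↔ J.Mem ((J'.incl n).app U s)

end RightIdeal

/-- `B` is right noetherian if each of its right ideals is coherent. -/
def IsRightNoetherian (B : GradedBimoduleAlgebra σ) : Prop :=
  ∀ J : RightIdeal B, J.toRightModule.IsCoherent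

/-- `B` is left noetherian if each of its left ideals is coherent. -/
def IsLeftNoetherian (B : GradedBimoduleAlgebra σ) : Prop :=
  ∀ J : LeftIdeal B, J.toLeftModule.IsCoherent

/-- `B` is noetherian if it is left and right noetherian. -/
def IsNoetherianAlgebra (B : GradedBimoduleAlgebra σ) : Prop :=
  IsRightNoetherian B ∧ IsLeftNoetherian B

/-! ### The geometric hypotheses -/

/-- A sheaf of modules is invertible if it is locally free of rank one: locally there is a section
`e` such that `f ↦ f e` is an isomorphism from `𝒪_X`. -/
def IsInvertible (L : X.Modules) : Prop :=
  ∀ x : X, ∃ (U : X.Opens) (e : Γ(L, U)), x ∈ U ∧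
    ∀ (V : X.Opens) (h : V ≤ U), Function.Bijective fun f : Γ(X, V) => f • res L h e

/-- An infinite set of closed points is critically dense if each of its infinite subsets is dense
in `X`. -/
def IsCriticallyDense (C : Set X) : Prop :=
  C.Infinite ∧ (∀ x ∈ C, IsClosed {x}) ∧ ∀ S ⊆ C, S.Infinite → closure S = Set.univ

attribute [local instance] MvPolynomial.gradedAlgebra

/-- Projective space `Proj k[x_0, …, x_n]`. -/
abbrev projectiveSpace (k : Type u) [Field k] (n : ℕ) : Scheme.{u} :=
  Proj (MvPolynomial.homogeneousSubmodule (Fin (n + 1)) k)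

/-- The structure morphism of projective space. -/
def projectiveSpaceHom (k : Type u) [Field k] (n : ℕ) :
    projectiveSpace k n ⟶ Spec (CommRingCat.of k) :=
  Proj.toSpecZero (MvPolynomial.homogeneousSubmodule (Fin (n + 1)) k) ≫
    Spec.map (CommRingCat.ofHom
      (algebraMap k (MvPolynomial.homogeneousSubmodule (Fin (n + 1)) k 0)))

/-- A `k`-scheme is projective if it has a closed immersion over `k` into a projective space. -/
def IsProjectiveScheme {k : Type u} [Field k] (f : X ⟶ Spec (CommRingCat.of k)) : Prop :=
  ∃ (n : ℕ) (i : X ⟶ projectiveSpace k n), IsClosedImmersion i ∧ i ≫ projectiveSpaceHom k n = f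

/-- The points `c_i = σ^{-i}(c)`. -/
def orbitPoint (σ : Aut X) (c : X) (i : ℤ) : X := tw σ (-i) c

end NaiveBlowup

end

/-!
A graded right ideal of `R = ⨁ I_n L_n` is the same thing as a sequence of ideal sheaves
`K_n ≤ I_n` with `K_n I^{σ^n} ≤ K_{n+1}` (`RightIdeal.IsDefinedBy`): a quasi-coherent subsheaf of
the invertible sheaf `L_n` has the form `K_n L_n` (`IsInvertible.exists_eq_idealMul`), and closure
under the action can be tested on local generators. Such an ideal is coherent exactly if
`K_{n+1} = K_n I^{σ^n}` for all large `n` (`RightIdeal.IsDefinedBy.isCoherent`,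
`RightIdeal.IsDefinedBy.exists_le_mul`), since a map out of a coherent sheaf on a quasi-compact
scheme has only finitely many nonzero components. As `I^{σ^n}` is the ideal sheaf `m_n` of the point
`c_n` and `I_n = m_0 ⋯ m_{n-1}`, the question becomes one about ideal sheaves on the noetherian
integral scheme `X`.

If each infinite subset of `{c_n}` is dense, the zero locus of a nonzero `K_n` contains only
finitely many of the points, so that after finitely many steps `K_n` is comaximal with all the
remaining `m_i`. On an affine open the ideals `(K_n : m_0 ⋯ m_{n-1})` then form an ascending chain
from which `K_n` is recovered by multiplication, and the chain becomes stationary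
(`exists_forall_eq_mul_pointIdeal`).

If infinitely many of the points lie on a proper closed subset with ideal sheaf `I_Z`, the sequence
`A_n = I_Z ∩ m_0 ⋯ m_{n-1}` needs a new generator in degree `s + 1` whenever `c_s ∈ Z`: near `c_s`
it is `I_Z` in all degrees, and `I_Z ≠ I_Z m_s` by Nakayama's lemma. Hence the right ideal it
defines is not coherent. Stopping the production of new generators in degree `s` (`truncatedChain`)
gives coherent right ideals, which increase with `s`, and two of them with a degree in which a new
generator is needed between them differ in all large degrees. Their factor is coherent and
unbounded, so it is not torsion (`RightIdeal.exists_isFactor_not_isTorsion`).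

For left ideals the condition reads `I K_n^σ ≤ K_{n+1}`. Pulling `K_n` back along `σ^{-n}` turns it
into the condition above for the points `c_{-1}, c_{-2}, …`, so the same two lemmas on ideal sheaves
apply. An infinite subset of the whole orbit has an infinite part in one of its two halves, which
gives the statement on two-sided noetherianity.
-/

noncomputable section

namespace NaiveBlowup

variable {X : Scheme.{u}}

/-! ### Sections over basic opens -/

section

/-- Sections of `M` over the basic opens of `U` are fractions of sections over `U`. -/
def IsLocalizingOn (M : X.Modules) (U : X.Opens) : Prop :=
  ∀ f : Γ(X, U),
    (∀ s : Γ(M, X.basicOpen f), ∃ (n : ℕ) (t : Γ(M, U)),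
      res M (X.basicOpen_le f) t = resO (X.basicOpen_le f) f ^ n • s) ∧
    ∀ t : Γ(M, U), res M (X.basicOpen_le f) t = 0 → ∃ n : ℕ, f ^ n • t = 0

variable {U : X.Opens} (hU : IsAffineOpen U)

lemma fromSpec_image_le (V : (Spec Γ(X, U)).Opens) : hU.fromSpec ''ᵁ V ≤ U := by
  conv_rhs => rw [← hU.opensRange_fromSpec]
  exact hU.fromSpec.image_le_opensRange V

lemma appIso_inv_restrict (V : (Spec Γ(X, U)).Opens) (r : Γ(X, U)) :
    (hU.fromSpec.appIso V).inv ((Spec Γ(X, U)).presheaf.map V.leTop.op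
      ((Scheme.ΓSpecIso Γ(X, U)).inv r)) = resO (fromSpec_image_le hU V) r := by
  have h1 : hU.fromSpec.app U ≫ (Spec Γ(X, U)).presheaf.map (homOfLE (show V ≤ hU.fromSpec ⁻¹ᵁ U by
      rw [hU.fromSpec_preimage_self]; exact le_top)).op ≫ (hU.fromSpec.appIso V).inv =
      X.presheaf.map (homOfLE (fromSpec_image_le hU V)).op := by
    rw [← cancel_mono (hU.fromSpec.appIso V).hom, Category.assoc, Category.assoc, Iso.inv_hom_id,
      Category.comp_id, Scheme.Hom.appIso_hom, Scheme.Hom.naturality_assoc, ← Functor.map_comp]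
    rfl
  rw [hU.fromSpec_app_self] at h1
  have h2 := ConcreteCategory.congr_hom h1 r
  refine Eq.trans ?_ h2
  simp only [Category.assoc, ← Functor.map_comp_assoc]
  rfl

lemma restrict_smul (M : X.Modules) (V : (Spec Γ(X, U)).Opens) (r : Γ(X, U))
    (x : Γ(M.restrict hU.fromSpec, V)) :
    (r • x : Γ(M.restrict hU.fromSpec, V)) =
      (resO (fromSpec_image_le hU V) r • (show Γ(M, hU.fromSpec ''ᵁ V) from x) :
        Γ(M, hU.fromSpec ''ᵁ V)) := by
  rw [← appIso_inv_restrict]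
  rfl

lemma fromSpec_image_top : hU.fromSpec ''ᵁ ⊤ = U := by
  rw [Scheme.Hom.image_top_eq_opensRange, hU.opensRange_fromSpec]

/-- The criterion `IsLocalizing` on `Spec Γ(X, U)` in terms of sections over opens of `X`. -/
lemma isLocalizingOn_iff (M : X.Modules) :
    IsLocalizing (modulesSpecToSheaf.obj (M.restrict hU.fromSpec)) ↔ IsLocalizingOn M U := by
  refine forall_congr' fun f => ?_
  let D : (Spec Γ(X, U)).Opens := PrimeSpectrum.basicOpen f
  have e1 : hU.fromSpec ''ᵁ ⊤ = U := fromSpec_image_top hU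
  have e2 : hU.fromSpec ''ᵁ D = X.basicOpen f := hU.fromSpec_image_basicOpen f
  have e3 : hU.fromSpec ''ᵁ D ≤ hU.fromSpec ''ᵁ ⊤ := hU.fromSpec.image_mono le_top
  let M' := M.restrict hU.fromSpec
  have hsm : ∀ (V : (Spec Γ(X, U)).Opens) (r : Γ(X, U)) (x : Γ(M, hU.fromSpec ''ᵁ V)),
      (HSMul.hSMul (α := Γ(X, U)) (β := Γ(M', V)) r x : Γ(M', V)) =
        (resO (fromSpec_image_le hU V) r • x : Γ(M, hU.fromSpec ''ᵁ V)) :=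
    fun V r x => restrict_smul hU M V r x
  constructor
  · intro H
    constructor
    · intro s
      obtain ⟨⟨(t : Γ(M, hU.fromSpec ''ᵁ ⊤)), ⟨_, n, rfl⟩⟩, ht⟩ := H.surj (res M e2.le s)
      refine ⟨n, res M e1.ge t, ?_⟩
      have h3 : resO (fromSpec_image_le hU D) (f ^ n) • res M e2.le s = res M e3 t :=
        (hsm D (f ^ n) (res M e2.le s)).symm.trans ht
      have h4 := congrArg (res M e2.ge) h3
      rw [res_smul, resO_resO, res_res, res_res, res_self, map_pow] at h4
      rw [res_res]
      exact h4.symm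
    · intro t ht
      obtain ⟨⟨_, n, rfl⟩, hc⟩ := H.exists_of_eq (x₁ := res M e1.le t)
        (x₂ := (0 : Γ(M, hU.fromSpec ''ᵁ ⊤))) (by
          have : res M e3 (res M e1.le t) = res M e3 0 := by
            rw [map_zero, res_res, ← res_res M (X.basicOpen_le f) e2.le, ht, map_zero]
          exact this)
      refine ⟨n, ?_⟩
      have hc' : resO (fromSpec_image_le hU ⊤) (f ^ n) • res M e1.le t =
        resO (fromSpec_image_le hU ⊤) (f ^ n) • 0 :=
        (hsm ⊤ (f ^ n) (res M e1.le t)).symm.trans (hc.trans (hsm ⊤ (f ^ n) 0))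
      have h4 := congrArg (res M e1.ge) hc'
      rwa [smul_zero, map_zero, res_smul, resO_resO, res_res, res_self, resO_self] at h4
  · rintro ⟨H1, H2⟩
    refine ⟨?_, ?_, ?_⟩
    · rintro ⟨_, n, rfl⟩
      change IsUnit (algebraMap _ _ (f ^ n))
      rw [map_pow]
      exact (M'.isUnit_algebraMap_end_of_le_basicOpen f le_rfl).pow n
    · intro (y : Γ(M, hU.fromSpec ''ᵁ D))
      obtain ⟨n, t, ht⟩ := H1 (res M e2.ge y)
      refine ⟨⟨res M e1.le t, ⟨_, n, rfl⟩⟩, ?_⟩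
      have h4 := congrArg (res M e2.le) ht
      rw [res_smul, res_res, res_res, res_self, ← map_pow, resO_resO] at h4
      exact (hsm D (f ^ n) y).trans (h4.symm.trans (res_res M e1.le e3 t).symm)
    · intro (x₁ : Γ(M, hU.fromSpec ''ᵁ ⊤)) (x₂ : Γ(M, hU.fromSpec ''ᵁ ⊤)) hx
      have hx' : res M e3 x₁ = res M e3 x₂ := hx
      obtain ⟨n, hn⟩ := H2 (res M e1.ge x₁ - res M e1.ge x₂) (by
          rw [map_sub, res_res, res_res, sub_eq_zero]
          have := congrArg (res M e2.ge) hx'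
          rwa [res_res, res_res] at this)
      refine ⟨⟨_, n, rfl⟩, ?_⟩
      rw [smul_sub, sub_eq_zero] at hn
      have := congrArg (res M e1.le) hn
      rw [res_smul, res_smul, res_res, res_res, res_self, res_self] at this
      exact (hsm ⊤ (f ^ n) x₁).trans (this.trans (hsm ⊤ (f ^ n) x₂).symm)

lemma isQuasicoherent_restrict_iff (M : X.Modules) :
    IsQuasicoherentSheaf (M.restrict hU.fromSpec) ↔ IsLocalizingOn M U := by
  rw [← isLocalizingOn_iff hU, ← isIso_fromTildeΓ_iff_isLocalizing]
  exact isQuasicoherent_iff_isIso_fromTildeΓ _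

lemma IsQuasicoherentSheaf.isLocalizingOn (hU : IsAffineOpen U) {M : X.Modules}
    (hM : IsQuasicoherentSheaf M) :
    IsLocalizingOn M U := by
  rw [← isQuasicoherent_restrict_iff hU]
  have : M.IsQuasicoherent := hM
  exact Scheme.Modules.isQuasicoherent_restrictFunctor _ _

/-- The restriction to `Spec Γ(X, U)`, read back on the site of opens of `U`. -/
def overIso (M : X.Modules) : SheafOfModules.over.{u} (R := X.ringCatSheaf) M U ≅
    (Scheme.Modules.restrictFunctor hU.isoSpec.hom ⋙ (Scheme.Modules.overEquiv U).inverse).obj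
      (M.restrict hU.fromSpec) := by
  let e := (Scheme.Modules.overEquiv U).unitIso.app
    (SheafOfModules.over.{u} (R := X.ringCatSheaf) M U)
  refine e ≪≫ (Scheme.Modules.overEquiv U).inverse.mapIso
    ((Scheme.Modules.overFunctorEquiv U).app M ≪≫
      (Scheme.Modules.restrictFunctorCongr hU.isoSpec_hom_fromSpec.symm).app M ≪≫
      (Scheme.Modules.restrictFunctorComp _ _).app M)

end

/-! ### Quasi-coherence and coherence on affine opens -/

section

variable {U : X.Opens} (hU : IsAffineOpen U)

section
universe v₁ u₁ v₂ u₂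
variable {C : Type u₁} [Category.{v₁} C] {J : GrothendieckTopology C} {R : Sheaf J RingCat.{u}}
  [HasSheafify J AddCommGrpCat.{u}] [J.WEqualsLocallyBijective AddCommGrpCat.{u}]
  {C' : Type u₂} [Category.{v₂} C'] {J' : GrothendieckTopology C'} {S : Sheaf J' RingCat.{u}}
  [HasSheafify J' AddCommGrpCat.{u}] [J'.WEqualsLocallyBijective AddCommGrpCat.{u}]

lemma nonempty_presentation_map (F : SheafOfModules.{u} R ⥤ SheafOfModules.{u} S)
    (hF : Limits.PreservesColimitsOfSize.{u, u} F)
    (η : SheafOfModules.unit S ≅ F.obj (SheafOfModules.unit R))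
    {M M' : SheafOfModules.{u} R} {N : SheafOfModules.{u} S} (P : M.Presentation) (e : M ≅ M')
    (e' : F.obj M' ≅ N) : Nonempty N.Presentation :=
  ⟨((P.ofIsIso e.hom).map F η).ofIsIso e'.hom⟩

lemma exists_generators_map (F : SheafOfModules.{u} R ⥤ SheafOfModules.{u} S)
    (hF : Limits.PreservesColimitsOfSize.{u, u} F)
    (η : SheafOfModules.unit S ≅ F.obj (SheafOfModules.unit R))
    {M M' : SheafOfModules.{u} R} {N : SheafOfModules.{u} S} (G : M.GeneratingSections)
    (hG : Finite G.I) (e : M ≅ M')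
    (e' : F.obj M' ≅ N) : ∃ G' : N.GeneratingSections, G'.IsFiniteType ∧ G'.I = G.I := by
  have : G.IsFiniteType := ⟨hG⟩
  exact ⟨((G.ofEpi e.hom).map F η).ofEpi e'.hom, inferInstance, rfl⟩
end

/-- Sheaves of modules on the spectrum of `Γ(X, U)`, moved to the site of opens of `U`. -/
def specToOver : SheafOfModules.{u} (Spec Γ(X, U)).ringCatSheaf ⥤
    SheafOfModules.{u} (X.ringCatSheaf.over U) :=
  Scheme.Modules.restrictFunctor hU.isoSpec.hom ⋙ (Scheme.Modules.overEquiv U).inverse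

lemma preservesColimits_specToOver : Limits.PreservesColimitsOfSize.{u, u} (specToOver hU) :=
  show Limits.PreservesColimitsOfSize.{u, u} (C := (Spec Γ(X, U)).Modules)
    (Scheme.Modules.restrictFunctor hU.isoSpec.hom ⋙ (Scheme.Modules.overEquiv U).inverse) from
  inferInstance

/-- The structure sheaf of the spectrum corresponds to that of the site of opens of `U`. -/
def specToOverUnit : SheafOfModules.unit _ ≅ (specToOver hU).obj (SheafOfModules.unit _) :=
  (Scheme.Modules.overEquiv U).unitIso.app (SheafOfModules.unit _) ≪≫
    (Scheme.Modules.overEquiv U).inverse.mapIso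
      (show (Scheme.Modules.overEquiv U).functor.obj (SheafOfModules.unit _) ≅
        SheafOfModules.unit _ from Iso.refl _) ≪≫
    (Scheme.Modules.overEquiv U).inverse.mapIso (Scheme.Modules.restrictUnitIso hU.isoSpec.hom).symm

/-- Global sections of the restriction to `Spec Γ(X, U)` are sections over `U`. -/
def sectionsRestrictEquiv (M : X.Modules) :
    (modulesSpecToSheaf.obj (M.restrict hU.fromSpec)).presheaf.obj (.op ⊤) ≃ₗ[Γ(X, U)]
      Γ(M, U) where
  toFun x := res M (fromSpec_image_top hU).ge (show Γ(M, hU.fromSpec ''ᵁ ⊤) from x)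
  invFun x := res M (fromSpec_image_top hU).le x
  left_inv x := (res_res M _ _ _).trans (res_self M _)
  right_inv x := (res_res M _ _ _).trans (res_self M _)
  map_add' x y := map_add (res M (fromSpec_image_top hU).ge) _ _
  map_smul' r x :=
    (congrArg (res M (fromSpec_image_top hU).ge) (restrict_smul hU M ⊤ r x)).trans (by
    rw [res_smul, resO_resO, resO_self]
    rfl)

lemma nonempty_presentation_over (hU : IsAffineOpen U) {M : X.Modules} (h : IsLocalizingOn M U) :
    Nonempty (SheafOfModules.over.{u} (R := X.ringCatSheaf) M U).Presentation := by
  rw [← isLocalizingOn_iff hU, ← isIso_fromTildeΓ_iff_isLocalizing] at h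
  let P := (presentationTilde.{u}
    ((modulesSpecToSheaf.obj (M.restrict hU.fromSpec)).presheaf.obj (.op ⊤))
    .univ (by simp) _ (Submodule.span_eq _))
  exact nonempty_presentation_map (specToOver hU) (preservesColimits_specToOver hU)
    (specToOverUnit hU) P (@asIso _ _ _ _ (M.restrict hU.fromSpec).fromTildeΓ h) (overIso hU M).symm

lemma nonempty_generators_over (hU : IsAffineOpen U) {M : X.Modules} (h : IsLocalizingOn M U)
    [hfin : Module.Finite Γ(X, U) Γ(M, U)] :
    ∃ G : (SheafOfModules.over.{u} (R := X.ringCatSheaf) M U).GeneratingSections,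
      G.IsFiniteType := by
  rw [← isLocalizingOn_iff hU, ← isIso_fromTildeΓ_iff_isLocalizing] at h
  obtain ⟨s, hsf, hs⟩ := Submodule.fg_def.mp
    (Module.Finite.equiv (sectionsRestrictEquiv hU M).symm).fg_top
  let P := (presentationTilde.{u}
    ((modulesSpecToSheaf.obj (M.restrict hU.fromSpec)).presheaf.obj (.op ⊤))
    s hs _ (Submodule.span_eq _))
  obtain ⟨G, h1, h2⟩ := exists_generators_map (specToOver hU) (preservesColimits_specToOver hU)
    (specToOverUnit hU) P.generators hsf (@asIso _ _ _ _ (M.restrict hU.fromSpec).fromTildeΓ h)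
    (overIso hU M).symm
  exact ⟨G, h1⟩

lemma coversTop_of_forall_mem {U : X → X.Opens} (hU : ∀ x, x ∈ U x) :
    (Opens.grothendieckTopology X).CoversTop U := by
  rw [Opens.coversTop_iff, IsOpenCover, eq_top_iff]
  exact fun x _ => Opens.mem_iSup.mpr ⟨x, hU x⟩

/-- Quasi-coherence can be checked on sections over the basic opens of an affine cover. -/
lemma isQuasicoherentSheaf_of_isLocalizingOn {M : X.Modules}
    (H : ∀ x : X, ∃ U : X.Opens, IsAffineOpen U ∧ x ∈ U ∧ IsLocalizingOn M U) :
    IsQuasicoherentSheaf M := by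
  choose U hU hx hM using H
  let q : SheafOfModules.QuasicoherentData (R := X.ringCatSheaf) M :=
    { I := X
      X := U
      coversTop := coversTop_of_forall_mem hx
      presentation := fun x => (nonempty_presentation_over (hU x) (hM x)).some }
  exact q.isQuasicoherent

lemma isCoherentSheaf_of_isLocalizingOn {M : X.Modules}
    (H : ∀ x : X, ∃ U : X.Opens, IsAffineOpen U ∧ x ∈ U ∧ IsLocalizingOn M U ∧
      Module.Finite Γ(X, U) Γ(M, U)) :
    IsCoherentSheaf M := by
  refine ⟨isQuasicoherentSheaf_of_isLocalizingOn fun x => ?_, ?_⟩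
  · obtain ⟨U, h1, h2, h3, -⟩ := H x
    exact ⟨U, h1, h2, h3⟩
  choose U hU hx hM hF using H
  choose G hG using fun x => nonempty_generators_over (hU x) (hM x)
  let q : SheafOfModules.LocalGeneratorsData (R := X.ringCatSheaf) M :=
    { I := X
      X := U
      coversTop := coversTop_of_forall_mem hx
      generators := G }
  have hq : q.IsFiniteType := { isFiniteType := hG }
  exact SheafOfModules.IsFiniteType.mk.{u, u, u} ⟨q, hq⟩

/-- A quotient of a finite free sheaf on an affine scheme has a finite module of global sections,
because `tilde` is fully faithful and reflects epimorphisms. -/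
lemma finite_of_epi_tilde {R : CommRingCat.{u}} {M N : (Spec R).Modules} (hM : IsIso M.fromTildeΓ)
    {ι : Type u} (hι : Finite ι) (e : tilde (ModuleCat.of R (ι →₀ R)) ≅ N) (f : N ⟶ M)
    (hf : Epi f) : Module.Finite R ((modulesSpecToSheaf.obj M).presheaf.obj (.op ⊤)) := by
  let p : tilde (ModuleCat.of R (ι →₀ R)) ⟶ tilde _ := e.hom ≫ f ≫ inv M.fromTildeΓ
  have hp : Epi p := inferInstance
  obtain ⟨g, hg⟩ := (tilde.functor R).map_surjective p
  have hg' : Epi ((tilde.functor R).map g) := by rw [hg]; exact hp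
  have hg'' : Epi g := (tilde.functor R).epi_of_epi_map hg'
  exact Module.Finite.of_surjective g.hom ((ModuleCat.epi_iff_surjective g).mp hg'')

/-- Around each point a coherent sheaf has a finite module of sections over some affine open. -/
lemma IsCoherentSheaf.exists_finite {M : X.Modules} (hM : IsCoherentSheaf M) (x : X) :
    ∃ U : X.Opens, IsAffineOpen U ∧ x ∈ U ∧ Module.Finite Γ(X, U) Γ(M, U) := by
  obtain ⟨hq, ⟨⟨q, hqf⟩⟩⟩ := hM
  obtain ⟨i, hxi⟩ : ∃ i, x ∈ q.X i := by
    have := q.coversTop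
    rw [Opens.coversTop_iff, IsOpenCover] at this
    exact Opens.mem_iSup.mp (this.ge (Opens.mem_top x))
  obtain ⟨⟨U, hU'⟩, hxU, hUi⟩ := exists_affine hxi
  have hU : IsAffineOpen U := hU'
  refine ⟨U, hU, hxU, ?_⟩
  let V : X.Opens := q.X i
  have hUV : U ≤ V := hUi
  let G : (SheafOfModules.over.{u} (R := X.ringCatSheaf) M V).GeneratingSections := q.generators i
  have hG : G.IsFiniteType := hqf.isFiniteType i
  let v : (U : Scheme) ⟶ V := X.homOfLE hUV
  let F : _ ⥤ SheafOfModules.{u} (Spec Γ(X, U)).ringCatSheaf :=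
    (Scheme.Modules.overEquiv V).functor ⋙ Scheme.Modules.restrictFunctor v ⋙
      Scheme.Modules.restrictFunctor hU.isoSpec.inv
  have : Limits.PreservesColimitsOfSize.{u, u} (Scheme.Modules.restrictFunctor v) := inferInstance
  have : Limits.PreservesColimitsOfSize.{u, u}
    (Scheme.Modules.restrictFunctor hU.isoSpec.inv) := inferInstance
  have hF : Limits.PreservesColimitsOfSize.{u, u}
    ((Scheme.Modules.overEquiv V).functor ⋙ Scheme.Modules.restrictFunctor v ⋙
      Scheme.Modules.restrictFunctor hU.isoSpec.inv) := inferInstance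
  let iso : F.obj (SheafOfModules.over.{u} (R := X.ringCatSheaf) M V) ≅
      Scheme.Modules.restrict M hU.fromSpec :=
    (Scheme.Modules.restrictFunctor v ⋙
      Scheme.Modules.restrictFunctor hU.isoSpec.inv).mapIso
        ((Scheme.Modules.overFunctorEquiv V).app M) ≪≫
    (Scheme.Modules.restrictFunctor hU.isoSpec.inv).mapIso
      ((Scheme.Modules.restrictFunctorComp _ _).symm.app M) ≪≫
    (Scheme.Modules.restrictFunctorComp _ _).symm.app M ≪≫
    (Scheme.Modules.restrictFunctorCongr (by
      rw [← hU.isoSpec_inv_ι, X.homOfLE_ι])).app M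
  let η : SheafOfModules.unit _ ≅ F.obj (SheafOfModules.unit _) :=
    (Scheme.Modules.restrictUnitIso hU.isoSpec.inv).symm ≪≫
     (Scheme.Modules.restrictFunctor hU.isoSpec.inv).mapIso (Scheme.Modules.restrictUnitIso v).symm
  obtain ⟨G', hG', hI⟩ := exists_generators_map F hF η G hG.finite (Iso.refl _) iso
  have hiso := (isIso_fromTildeΓ_iff_isLocalizing _).mpr
    ((isLocalizingOn_iff hU M).mpr (hq.isLocalizingOn hU))
  have := finite_of_epi_tilde hiso hG'.finite (tildeFinsupp G'.I) G'.π G'.epi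
  exact Module.Finite.equiv (sectionsRestrictEquiv hU M)

end

/-! ### Products of ideal sheaves of points -/

section

section CommutativeAlgebra

variable {A : Type*} [CommRing A]

lemma le_colon_iff {I J K : Ideal A} : I ≤ K.colon (J : Set A) ↔ I * J ≤ K := by
  rw [Ideal.mul_le]
  exact ⟨fun h r hr s hs => Submodule.mem_colon.mp (h hr) s hs,
    fun h r hr => Submodule.mem_colon.mpr fun s hs => h r hr s hs⟩

/-- The colon ideals `K n : ∏_{i < n} m i` form an ascending chain, which becomes stationary, and
coprimality recovers `K n` from its colon ideal. -/
lemma exists_forall_eq_mul_of_sup_eq_top [IsNoetherianRing A] (K m : ℕ → Ideal A)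
    (hK : ∀ n, K n * m n ≤ K (n + 1)) (hP : ∀ n, K n ≤ ∏ i ∈ Finset.range n, m i)
    (hm : ∀ i, K 0 ⊔ m i = ⊤) : ∃ N, ∀ n ≥ N, K (n + 1) = K n * m n := by
  let Q : ℕ → Ideal A := fun n => ∏ i ∈ Finset.range n, m i
  have hQ : ∀ n, Q (n + 1) = Q n * m n := fun n => Finset.prod_range_succ _ _
  let C : ℕ → Ideal A := fun n => (K n).colon (Q n : Set A)
  have hCQ : ∀ n, C n * Q n ≤ K n := fun n => le_colon_iff.mp le_rfl
  have hmono : Monotone C := monotone_nat_of_le_succ fun n => le_colon_iff.mpr <| by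
    rw [hQ, ← mul_assoc]
    exact (Ideal.mul_mono_left (hCQ n)).trans (hK n)
  have hKC : ∀ n, K n ≤ C n := fun n => le_colon_iff.mpr Ideal.mul_le_left
  have hco : ∀ n, IsCoprime (C n) (Q n) := fun n => IsCoprime.prod_right fun i _ =>
    Ideal.isCoprime_iff_sup_eq.mpr <| top_le_iff.mp <| (hm i).ge.trans <|
      sup_le_sup_right ((hKC 0).trans (hmono (Nat.zero_le n))) _
  have hKeq : ∀ n, K n = C n * Q n := fun n => by
    refine le_antisymm ?_ (hCQ n)
    rw [Ideal.mul_eq_inf_of_isCoprime (hco n)]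
    exact le_inf (hKC n) (hP n)
  obtain ⟨N, hN⟩ := monotone_stabilizes_iff_noetherian.mpr
    (inferInstance : IsNoetherian A A) ⟨C, hmono⟩
  refine ⟨N, fun n hn => ?_⟩
  have h1 : C N = C n := hN n hn
  have h2 : C N = C (n + 1) := hN (n + 1) (hn.trans n.le_succ)
  rw [hKeq (n + 1), hKeq n, hQ, ← h1, ← h2, mul_assoc]

/-- Nakayama's lemma over a noetherian domain. -/
lemma eq_bot_of_le_mul [IsDomain A] [IsNoetherianRing A] {I m : Ideal A} (hm : m ≠ ⊤)
    (h : I ≤ I * m) : I = ⊥ := by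
  obtain ⟨r, hr, hrI⟩ := Submodule.exists_sub_one_mem_and_smul_eq_zero_of_fg_of_le_smul m I
    (IsNoetherian.noetherian I) (by rwa [smul_eq_mul, mul_comm])
  by_contra hI
  obtain ⟨x, hx, hx0⟩ := Submodule.exists_mem_ne_zero_of_ne_bot hI
  rcases mul_eq_zero.mp (hrI x hx) with h0 | h0
  · rw [h0, zero_sub] at hr
    exact hm ((Ideal.eq_top_iff_one m).mpr (by simpa using neg_mem hr))
  · exact hx0 h0

end CommutativeAlgebra

open Scheme.IdealSheafData

lemma ideal_prod {ι : Type*} (s : Finset ι) (m : ι → X.IdealSheafData) (U : X.affineOpens) :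
    (∏ i ∈ s, m i).ideal U = ∏ i ∈ s, (m i).ideal U := by
  classical
  induction s using Finset.induction with
  | empty => simp
  | insert a s ha ih =>
    rw [Finset.prod_insert ha, Finset.prod_insert ha, ideal_mul, Pi.mul_apply, ih]

@[simp]
lemma support_pointIdeal (p : X) (hp : IsClosed {p}) :
    (pointIdeal p hp).support = ⟨{p}, hp⟩ := rfl

lemma pointIdeal_ideal_eq_top {p : X} (hp : IsClosed {p}) {U : X.affineOpens} (h : p ∉ U.1) :
    (pointIdeal p hp).ideal U = ⊤ := by
  rw [pointIdeal, vanishingIdeal_ideal]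
  convert PrimeSpectrum.vanishingIdeal_empty
  rw [Set.eq_empty_iff_forall_notMem]
  intro x hx
  have h1 : U.2.fromSpec x = p := hx
  have h2 : U.2.fromSpec x ∈ U.1 := by
    have : U.2.fromSpec x ∈ Set.range U.2.fromSpec := ⟨x, rfl⟩
    rwa [U.2.range_fromSpec] at this
  exact h (h1 ▸ h2)

lemma ideal_ne_top_of_mem_support {I : X.IdealSheafData} {p : X} (hp : p ∈ I.support)
    {U : X.affineOpens} (h : p ∈ U.1) : I.ideal U ≠ ⊤ := by
  intro h1
  rw [mem_support_iff_of_mem h, Scheme.mem_zeroLocus_iff, h1] at hp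
  exact hp 1 trivial (by simpa using h)

lemma eq_bot_of_ideal_eq_bot [IsIntegral X] {I : X.IdealSheafData} {U : X.affineOpens}
    (hU : (U.1 : Set X).Nonempty) (h : I.ideal U = ⊥) : I = ⊥ := by
  rw [← support_eq_top_iff, eq_top_iff]
  have h1 : (U.1 : Set X) ⊆ I.support := fun x hx => by
    rw [SetLike.mem_coe, mem_support_iff_of_mem (U := U) hx, Scheme.mem_zeroLocus_iff, h]
    rintro f rfl
    simp
  have h2 := (U.1.isOpen.dense hU).closure_eq
  intro x _
  exact I.support.isClosed.closure_subset_iff.mpr h1 (h2.ge trivial)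

lemma le_pointIdeal_iff {I : X.IdealSheafData} {p : X} (hp : IsClosed {p}) :
    I ≤ pointIdeal p hp ↔ p ∈ I.support := by
  rw [pointIdeal, ← le_support_iff_le_vanishingIdeal]
  exact ⟨fun h => h (Set.mem_singleton p), fun h x hx => by
    obtain rfl : x = p := hx
    exact h⟩

/-- A point of the sequence has an affine neighbourhood that contains none of finitely many other
points. -/
lemma exists_affine_avoiding {p : ℕ → X} (hp : ∀ i, IsClosed {p i})
    (hinj : Function.Injective p) (s n : ℕ) :
    ∃ U : X.affineOpens, p s ∈ U.1 ∧ ∀ i < n, i ≠ s → p i ∉ U.1 := by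
  have hfin : IsClosed (⋃ i ∈ {i | i < n ∧ i ≠ s}, ({p i} : Set X)) :=
    ((Set.finite_lt_nat n).subset fun i hi => hi.1).isClosed_biUnion fun i _ => hp i
  obtain ⟨U, hU, hle⟩ := exists_affine (x := p s) (U := ⟨_, hfin.isOpen_compl⟩) (by
    change p s ∉ _
    simp only [Set.mem_iUnion, Set.mem_singleton_iff, not_exists]
    exact fun i hi h => hi.2 (hinj h).symm)
  refine ⟨U, hU, fun i hi his h => hle h ?_⟩
  simp only [Set.mem_iUnion, Set.mem_singleton_iff]
  exact ⟨i, ⟨hi, his⟩, rfl⟩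

lemma exists_finite_affine_cover [CompactSpace X] :
    ∃ (s : Finset X) (U : X → X.affineOpens), (∀ x, x ∈ (U x).1) ∧ ⨆ x : s, (U x).1 = ⊤ := by
  choose U hU _ using fun x : X => exists_affine (x := x) (U := ⊤) trivial
  obtain ⟨s, hs⟩ := isCompact_univ.elim_finite_subcover (fun x => ((U x).1 : Set X))
    (fun x => (U x).1.isOpen) fun x _ => Set.mem_iUnion.mpr ⟨x, hU x⟩
  refine ⟨s, U, hU, eq_top_iff.mpr fun x _ => ?_⟩
  obtain ⟨y, hy⟩ := Set.mem_iUnion.mp (hs (Set.mem_univ x))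
  obtain ⟨hy1, hy2⟩ := Set.mem_iUnion.mp hy
  exact Opens.mem_iSup.mpr ⟨⟨y, hy1⟩, hy2⟩

section Chains

variable {p : ℕ → X} {hp : ∀ i, IsClosed {p i}}

lemma mul_prod_pointIdeal_le (K : ℕ → X.IdealSheafData)
    (hK : ∀ n, K n * pointIdeal (p n) (hp n) ≤ K (n + 1)) (n k : ℕ) :
    K n * ∏ i ∈ Finset.range k, pointIdeal (p (n + i)) (hp (n + i)) ≤ K (n + k) := by
  induction k with
  | zero => simp
  | succ k ih =>
    rw [Finset.prod_range_succ, ← mul_assoc]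
    exact (mul_le_mul_left ih _).trans (hK (n + k))

lemma support_prod_subset {ι : Type*} (s : Finset ι) (m : ι → X.IdealSheafData) {x : X}
    (hx : x ∈ (∏ i ∈ s, m i).support) : ∃ i ∈ s, x ∈ (m i).support := by
  classical
  induction s using Finset.induction with
  | empty =>
    exact absurd hx (by rw [Finset.prod_empty, one_eq_top, support_top]; exact id)
  | insert a s ha ih =>
    rw [Finset.prod_insert ha, support_mul] at hx
    rcases hx with h | h
    · exact ⟨a, Finset.mem_insert_self _ _, h⟩
    · obtain ⟨i, hi, hx⟩ := ih h
      exact ⟨i, Finset.mem_insert_of_mem hi, hx⟩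

/-- If every infinite set of the closed points `p i` is dense, then a chain of ideal sheaves with
`K n * m n ≤ K (n + 1)` and `K n ≤ m 0 * ⋯ * m (n - 1)` eventually satisfies
`K (n + 1) = K n * m n`, where `m i` is the ideal sheaf of `p i`. -/
theorem exists_forall_eq_mul_pointIdeal [IsIntegral X] [IsNoetherian X]
    (hinj : Function.Injective p)
    (hdense : ∀ S ⊆ Set.range p, S.Infinite → closure S = Set.univ)
    (K : ℕ → X.IdealSheafData) (hK : ∀ n, K n * pointIdeal (p n) (hp n) ≤ K (n + 1))
    (hP : ∀ n, K n ≤ ∏ i ∈ Finset.range n, pointIdeal (p i) (hp i)) :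
    ∃ N, ∀ n ≥ N, K (n + 1) = K n * pointIdeal (p n) (hp n) := by
  by_cases hbot : ∀ n, K n = ⊥
  · exact ⟨0, fun n _ => by rw [hbot, hbot, bot_mul]⟩
  push Not at hbot
  obtain ⟨n₀, hn₀⟩ := hbot
  -- only finitely many of the points lie on the zero locus of `K n₀`
  have hfin : {i | p i ∈ (K n₀).support}.Finite := by
    by_contra hinf
    have h1 := hdense (p '' {i | p i ∈ (K n₀).support}) (Set.image_subset_range _ _)
      (Set.Infinite.image hinj.injOn hinf)
    apply hn₀
    rw [← support_eq_top_iff, eq_top_iff]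
    intro x _
    refine (K n₀).support.isClosed.closure_subset_iff.mpr ?_ (h1.ge trivial)
    rintro _ ⟨i, hi, rfl⟩
    exact hi
  obtain ⟨b, hb⟩ := hfin.bddAbove
  -- from degree `n₁` on, the zero locus of `K n` meets none of the remaining points
  let n₁ := n₀ + (b + 1)
  have hco : ∀ i, K n₁ ⊔ pointIdeal (p (n₁ + i)) (hp (n₁ + i)) = ⊤ := by
    intro i
    rw [← support_eq_bot_iff, eq_bot_iff]
    intro x hx
    obtain rfl : x = p (n₁ + i) := by
      have := support_antitone (le_sup_right : _ ≤ K n₁ ⊔ pointIdeal (p (n₁ + i)) (hp (n₁ + i))) hx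
      rwa [support_pointIdeal] at this
    have h1 := support_antitone
      (le_sup_left.trans' (mul_prod_pointIdeal_le (hp := hp) K hK n₀ (b + 1))) hx
    rw [support_mul] at h1
    rcases h1 with h | h
    · have : n₁ + i ≤ b := hb h
      omega
    · obtain ⟨j, hj, h⟩ := support_prod_subset _ _ h
      rw [support_pointIdeal] at h
      have : n₁ + i = n₀ + j := hinj h
      have := Finset.mem_range.mp hj
      omega
  obtain ⟨s, U, -, hcov⟩ := exists_finite_affine_cover (X := X)
  have key : ∀ x : X, ∃ N, ∀ n ≥ N, (K (n₁ + (n + 1))).ideal (U x) =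
      (K (n₁ + n)).ideal (U x) * (pointIdeal (p (n₁ + n)) (hp (n₁ + n))).ideal (U x) := by
    intro x
    have := IsLocallyNoetherian.component_noetherian (U x)
    refine exists_forall_eq_mul_of_sup_eq_top (fun n => (K (n₁ + n)).ideal (U x))
      (fun n => (pointIdeal (p (n₁ + n)) (hp (n₁ + n))).ideal (U x)) (fun n => hK (n₁ + n) (U x))
      (fun n => ?_) fun i => congr_fun (congrArg ideal (hco i)) (U x)
    rw [← ideal_prod (Finset.range n) fun i => pointIdeal (p (n₁ + i)) (hp (n₁ + i))]
    refine (hP (n₁ + n)).trans ?_ (U x)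
    rw [Finset.prod_range_add]
    intro V
    rw [ideal_mul, Pi.mul_apply]
    exact Ideal.mul_le_right
  choose N hN using key
  refine ⟨n₁ + s.sup N, fun n hn => ?_⟩
  obtain ⟨k, rfl⟩ := Nat.exists_eq_add_of_le (show n₁ ≤ n by omega)
  refine ext_of_iSup_eq_top (fun x : s => U x) hcov fun x => ?_
  exact hN x k ((Finset.le_sup x.2).trans (by omega))

/-- The chain equal to `A n` up to `n = s` and multiplied by `m n` from then on. -/
def truncatedChain (m A : ℕ → X.IdealSheafData) (s : ℕ) : ℕ → X.IdealSheafData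
  | 0 => A 0
  | n + 1 => if n < s then A (n + 1) else truncatedChain m A s n * m n

section

variable {m A : ℕ → X.IdealSheafData} {s t n : ℕ}

lemma truncatedChain_of_le (h : n ≤ s) : truncatedChain m A s n = A n := by
  cases n with
  | zero => rfl
  | succ n => rw [truncatedChain, if_pos (Nat.lt_of_succ_le h)]

lemma truncatedChain_succ (h : s ≤ n) :
    truncatedChain m A s (n + 1) = truncatedChain m A s n * m n := by
  rw [truncatedChain, if_neg (by omega)]

lemma truncatedChain_le (hA : ∀ n, A n * m n ≤ A (n + 1)) : truncatedChain m A s n ≤ A n := by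
  induction n with
  | zero => exact le_rfl
  | succ n ih =>
    rcases lt_or_ge n s with h | h
    · rw [truncatedChain_of_le h]
    · rw [truncatedChain_succ h]
      exact (mul_le_mul_left ih _).trans (hA n)

lemma truncatedChain_mono (hA : ∀ n, A n * m n ≤ A (n + 1)) (hst : s ≤ t) :
    truncatedChain m A s n ≤ truncatedChain m A t n := by
  induction n with
  | zero => exact le_rfl
  | succ n ih =>
    rcases lt_or_ge n t with h | h
    · rw [truncatedChain_of_le (s := t) h]
      exact truncatedChain_le hA
    · rw [truncatedChain_succ h, truncatedChain_succ (hst.trans h)]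
      exact mul_le_mul_left ih _

lemma truncatedChain_mul_le (hA : ∀ n, A n * m n ≤ A (n + 1)) :
    truncatedChain m A s n * m n ≤ truncatedChain m A s (n + 1) := by
  rcases lt_or_ge n s with h | h
  · rw [truncatedChain_of_le h, truncatedChain_of_le h.le]
    exact hA n
  · rw [truncatedChain_succ h]

end

/-- If infinitely many of the points `p i` lie on a proper closed subset `Z`, the ideal sheaves of
`Z` intersected with `m 0 * ⋯ * m (n - 1)` need a new generator in each degree `s + 1` with
`p s ∈ Z`. -/
theorem exists_chain_of_not_dense [IsIntegral X] [IsNoetherian X] (hinj : Function.Injective p)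
    {D : Set X} (hD : D ⊆ Set.range p) (hinf : D.Infinite) (hne : closure D ≠ Set.univ) :
    ∃ (A : ℕ → X.IdealSheafData) (S : Set ℕ), S.Infinite ∧
      (∀ n, A n * pointIdeal (p n) (hp n) ≤ A (n + 1)) ∧
      (∀ n, A n ≤ ∏ i ∈ Finset.range n, pointIdeal (p i) (hp i)) ∧
      ∀ s ∈ S, ∀ t n, s < t → t ≤ n →
        ¬ truncatedChain (fun i => pointIdeal (p i) (hp i)) A t n ≤
          truncatedChain (fun i => pointIdeal (p i) (hp i)) A s n := by
  let m := fun i => pointIdeal (p i) (hp i)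
  let P : ℕ → X.IdealSheafData := fun n => ∏ i ∈ Finset.range n, m i
  let Z : Closeds X := ⟨closure D, isClosed_closure⟩
  let I := vanishingIdeal Z
  have hI : I ≠ ⊥ := fun h => hne <| by
    have h1 : I.support = Z := rfl
    rw [h, support_bot] at h1
    exact congrArg (fun W : Closeds X => (W : Set X)) h1.symm
  let A : ℕ → X.IdealSheafData := fun n => I ⊓ P n
  have hA : ∀ n, A n * m n ≤ A (n + 1) := fun n => by
    refine le_inf (fun U => Ideal.mul_le_left.trans inf_le_left) ?_
    change _ ≤ ∏ i ∈ Finset.range (n + 1), m i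
    rw [Finset.prod_range_succ]
    exact mul_le_mul_left inf_le_right _
  refine ⟨A, {i | p i ∈ D}, ?_, hA, fun n => inf_le_right, ?_⟩
  · refine fun hfin => hinf ((hfin.image p).subset fun x hx => ?_)
    obtain ⟨i, rfl⟩ := hD hx
    exact ⟨i, hx, rfl⟩
  intro s hs t n hst htn hle
  obtain ⟨U, hsU, hU⟩ := exists_affine_avoiding hp hinj s n
  have hm : ∀ i < n, i ≠ s → (m i).ideal U = ⊤ := fun i hi his =>
    pointIdeal_ideal_eq_top (hp i) (hU i hi his)
  have hIm : I.ideal U ≤ (m s).ideal U :=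
    (le_pointIdeal_iff (hp s)).mpr (show p s ∈ I.support from
      subset_closure hs) U
  -- on `U` only the ideal of `p s` is visible, and it contains that of `Z`
  have hAU : ∀ j ≤ n, (A j).ideal U = I.ideal U := fun j hj => by
    change I.ideal U ⊓ (∏ i ∈ Finset.range j, m i).ideal U = _
    rw [inf_eq_left, ideal_prod]
    by_cases hsj : s ∈ Finset.range j
    · rw [← Finset.mul_prod_erase _ _ hsj, Finset.prod_eq_one, mul_one]
      · exact hIm
      · intro i hi
        rw [Ideal.one_eq_top]
        rw [Finset.mem_erase, Finset.mem_range] at hi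
        exact hm i (by omega) hi.1
    · rw [Finset.prod_eq_one]
      · rw [Ideal.one_eq_top]
        exact le_top
      · intro i hi
        rw [Ideal.one_eq_top]
        rw [Finset.mem_range] at hi hsj
        exact hm i (by omega) (by omega)
  have hT : ∀ r ≤ n, s < r → ∀ j, r ≤ j → j ≤ n → (truncatedChain m A r j).ideal U = I.ideal U := by
    intro r hr hsr j hj
    induction j, hj using Nat.le_induction with
    | base => intro hjn; rw [truncatedChain_of_le le_rfl, hAU _ hjn]
    | succ j hj ih =>
      intro hjn
      rw [truncatedChain_succ hj, ideal_mul, Pi.mul_apply, ih (by omega),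
        hm j (by omega) (by omega), Ideal.mul_top]
  have hTs : ∀ j, s + 1 ≤ j → j ≤ n →
      (truncatedChain m A s j).ideal U = I.ideal U * (m s).ideal U := by
    intro j hj
    induction j, hj using Nat.le_induction with
    | base =>
      intro hjn
      rw [truncatedChain_succ le_rfl, ideal_mul, Pi.mul_apply, truncatedChain_of_le le_rfl,
        hAU _ (by omega)]
    | succ j hj ih =>
      intro hjn
      rw [truncatedChain_succ (by omega), ideal_mul, Pi.mul_apply, ih (by omega),
        hm j (by omega) (by omega), Ideal.mul_top]
  -- Nakayama's lemma applies to the ideal of `Z`, which is not zero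
  have h1 : I.ideal U ≤ I.ideal U * (m s).ideal U := by
    rw [← hT t htn hst n htn le_rfl, hT t htn hst n htn le_rfl, ← hTs n (by omega) le_rfl]
    rw [← hT t htn hst n htn le_rfl]
    exact hle U
  have : Nonempty U.1 := ⟨⟨p s, hsU⟩⟩
  have : IsNoetherianRing Γ(X, U.1) := IsLocallyNoetherian.component_noetherian U
  exact hI (eq_bot_of_ideal_eq_bot ⟨p s, hsU⟩ (eq_bot_of_le_mul
    (ideal_ne_top_of_mem_support (by rw [support_pointIdeal]; rfl) hsU) h1))

end Chains

end

/-! ### Generators of invertible sheaves -/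

/-- The section `e` is a free generator of `M` over `U`. -/
def IsGen (M : X.Modules) (U : X.Opens) (e : Γ(M, U)) : Prop :=
  ∀ (V : X.Opens) (h : V ≤ U), Function.Bijective fun f : Γ(X, V) => f • res M h e

lemma eq_zero_of_locally {U : X.Opens} {f : Γ(X, U)}
    (H : ∀ x ∈ U, ∃ (V : X.Opens) (h : V ≤ U), x ∈ V ∧ resO h f = 0) : f = 0 :=
  eq_of_locally (structureModule X) (s := ofFun f) (t := ofFun 0) fun x hx => by
    obtain ⟨V, h, hxV, hV⟩ := H x hx
    exact ⟨V, h, hxV, hV.trans (map_zero (resO h)).symm⟩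

namespace IsGen

variable {M N : X.Modules} {U : X.Opens} {e : Γ(M, U)}

lemma restrict (he : IsGen M U e) {V : X.Opens} (h : V ≤ U) : IsGen M V (res M h e) := by
  intro W hW
  simp_rw [res_res]
  exact he W (hW.trans h)

lemma injective (he : IsGen M U e) {f g : Γ(X, U)} (h : f • e = g • e) : f = g := by
  have := he U le_rfl
  simp_rw [res_self] at this
  exact this.1 h

lemma surjective (he : IsGen M U e) (s : Γ(M, U)) : ∃ f : Γ(X, U), f • e = s := by
  have := he U le_rfl
  simp_rw [res_self] at this
  exact this.2 s

/-- Local surjectivity suffices, because the coefficients glue. -/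
lemma of_locally (H₁ : ∀ (V : X.Opens) (h : V ≤ U) (f : Γ(X, V)), f • res M h e = 0 → f = 0)
    (H₂ : ∀ (V : X.Opens) (h : V ≤ U) (s : Γ(M, V)), ∀ x ∈ V, ∃ (W : X.Opens) (hW : W ≤ V), x ∈ W ∧
      ∃ f : Γ(X, W), f • res M (hW.trans h) e = res M hW s) : IsGen M U e := by
  intro V h
  have hinj : ∀ (W : X.Opens) (hW : W ≤ U) (f g : Γ(X, W)),
      f • res M hW e = g • res M hW e → f = g := fun W hW f g hfg =>
    sub_eq_zero.mp (H₁ W hW _ (by rw [sub_smul, hfg, sub_self]))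
  refine ⟨fun f g => hinj V h f g, fun s => ?_⟩
  choose W hW hxW f hf using fun x : V => H₂ V h s x x.2
  obtain ⟨t, ht⟩ := exists_glue (structureModule X) (U := V) W hW
    (fun x hx => ⟨⟨x, hx⟩, hxW ⟨x, hx⟩⟩) (fun x => ofFun (f x)) (fun i j => by
      apply hinj (W i ⊓ W j) ((inf_le_left.trans (hW i)).trans h)
      have h1 := congrArg (res M (inf_le_left : W i ⊓ W j ≤ W i)) (hf i)
      have h2 := congrArg (res M (inf_le_right : W i ⊓ W j ≤ W j)) (hf j)
      rw [res_smul, res_res, res_res] at h1 h2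
      exact h1.trans h2.symm)
  refine ⟨toFn t, eq_of_locally M fun x hx => ⟨W ⟨x, hx⟩, hW _, hxW _, ?_⟩⟩
  rw [res_smul, res_res, ← hf]
  exact congrArg (· • _) (ht ⟨x, hx⟩)

lemma structureModule (U : X.Opens) : IsGen (structureModule X) U (ofFun 1) := by
  intro V h
  have : (fun f : Γ(X, V) => f • res (NaiveBlowup.structureModule X) h (ofFun 1)) =
      fun f : Γ(X, V) => ofFun f := by
    funext f
    have h1 : resO h (1 : Γ(X, U)) = 1 := map_one _
    exact (congrArg (fun g => f * g) h1).trans (mul_one f)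
  rw [this]
  exact Function.bijective_id

lemma pushforward {τ : X ⟶ X} [IsIso τ] {e : Γ(M, τ ⁻¹ᵁ U)} (he : IsGen M (τ ⁻¹ᵁ U) e) :
    IsGen ((Scheme.Modules.pushforward τ).obj M) U e := by
  intro V h
  have h1 := he (τ ⁻¹ᵁ V) (τ.preimage_mono h)
  have h2 : Function.Bijective (τ.app V).hom := ConcreteCategory.bijective_of_isIso (τ.app V)
  exact h1.comp h2

lemma tmul {a : Γ(M, U)} {b : Γ(N, U)} (ha : IsGen M U a) (hb : IsGen N U b) :
    IsGen (tensor M N) U (tmul a b) := by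
  -- the coefficients of pure tensors with respect to the two generators
  have coef : ∀ (V : X.Opens) (h : V ≤ U), ∃ e : (Γ(M, V) ⊗[Γ(X, V)] Γ(N, V)) →ₗ[Γ(X, V)] Γ(X, V),
      e (res M h a ⊗ₜ res N h b) = 1 ∧
      ∀ q, q = e q • (res M h a ⊗ₜ[Γ(X, V)] res N h b) := by
    intro V h
    let ea : Γ(X, V) ≃ₗ[Γ(X, V)] Γ(M, V) :=
      LinearEquiv.ofBijective (LinearMap.toSpanSingleton _ _ (res M h a)) (ha V h)
    let eb : Γ(X, V) ≃ₗ[Γ(X, V)] Γ(N, V) :=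
      LinearEquiv.ofBijective (LinearMap.toSpanSingleton _ _ (res N h b)) (hb V h)
    have h1 : ea 1 = res M h a := one_smul _ _
    have h2 : eb 1 = res N h b := one_smul _ _
    let e := (TensorProduct.congr ea eb).symm.trans (TensorProduct.lid _ _)
    have he : e (res M h a ⊗ₜ res N h b) = 1 := by
      simp [e, ← h1, ← h2]
    refine ⟨e, he, fun q => e.injective ?_⟩
    rw [map_smul, LinearEquiv.coe_coe, he, smul_eq_mul, mul_one]
  refine of_locally (fun V h f hf => ?_) fun V h s x hx => ?_
  · rw [res_tmul, ← smul_tmul, NaiveBlowup.tmul] at hf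
    refine eq_zero_of_locally fun x hx => ?_
    obtain ⟨W, hW, hxW, hq⟩ := toTensor_locally_injective M N _ 0 (hf.trans (map_zero _).symm) hx
    refine ⟨W, hW, hxW, ?_⟩
    obtain ⟨e, he, -⟩ := coef W (hW.trans h)
    rw [resT_tmul, res_smul, res_res, res_res, map_zero, ← TensorProduct.smul_tmul'] at hq
    have := congrArg e hq
    rwa [map_smul, he, map_zero, smul_eq_mul, mul_one] at this
  · obtain ⟨W, hW, hxW, q, hq⟩ := toTensor_locally_surjective M N s hx
    obtain ⟨e, -, he⟩ := coef W (hW.trans h)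
    refine ⟨W, hW, hxW, e q, ?_⟩
    rw [res_tmul, NaiveBlowup.tmul, ← map_smul, ← he, hq]

end IsGen

lemma IsInvertible.exists_isGen_twist {L : X.Modules} (hL : IsInvertible L) (σ : Aut X) (n : ℤ)
    (x : X) : ∃ (V : X.Opens) (y : Γ(L, tw σ (-n) ⁻¹ᵁ V)), x ∈ V ∧
      IsGen L (tw σ (-n) ⁻¹ᵁ V) y := by
  have h0 : ∀ U : X.Opens, tw σ (-n) ⁻¹ᵁ tw σ n ⁻¹ᵁ U = U := fun U => by
    rw [← tw_preimage σ (add_neg_cancel n), tw_preimage_zero]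
  obtain ⟨U, e, hx, he : IsGen L U e⟩ := hL (tw σ n x)
  exact ⟨tw σ n ⁻¹ᵁ U, res L (h0 U).le e, hx, he.restrict (h0 U).le⟩

lemma IsInvertible.twist {L : X.Modules} (hL : IsInvertible L) (σ : Aut X) (n : ℤ) :
    IsInvertible (twist σ n L) := by
  intro x
  obtain ⟨V, y, hx, hy⟩ := hL.exists_isGen_twist σ n x
  exact ⟨V, y, hx, hy.pushforward⟩

lemma IsInvertible.tensor {M N : X.Modules} (hM : IsInvertible M) (hN : IsInvertible N) :
    IsInvertible (tensor M N) := by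
  intro x
  obtain ⟨U, a, hxU, ha : IsGen M U a⟩ := hM x
  obtain ⟨V, b, hxV, hb : IsGen N V b⟩ := hN x
  exact ⟨U ⊓ V, _, ⟨hxU, hxV⟩, (ha.restrict inf_le_left).tmul (hb.restrict inf_le_right)⟩

lemma IsInvertible.Lpow {L : X.Modules} (hL : IsInvertible L) (σ : Aut X) (n : ℕ) :
    IsInvertible (Lpow σ L n) := by
  induction n with
  | zero => exact fun x => ⟨⊤, _, trivial, IsGen.structureModule ⊤⟩
  | succ n ih => exact ih.tensor (hL.twist σ n)

/-- Products of suitable local generators of `L_n` and `L_m` generate `L_{n + m}`. -/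
lemma exists_isGen_Lmul {L : X.Modules} (hL : IsInvertible L) (σ : Aut X) (n m : ℕ)
    {U : X.Opens} {a : Γ(Lpow σ L n, U)} (ha : IsGen _ U a) {x : X} (hx : x ∈ U) :
    ∃ (V W : X.Opens) (hU : W ≤ U) (hV : W ≤ tw σ n ⁻¹ᵁ V) (b : Γ(Lpow σ L m, V)),
      x ∈ W ∧ IsGen _ V b ∧ IsGen _ W ((Lmul σ L n m).toFun hU hV a b) := by
  induction m with
  | zero =>
    refine ⟨⊤, U, le_rfl, le_top, ofFun 1, hx, IsGen.structureModule ⊤, ?_⟩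
    have h1 : resO (le_top : U ≤ tw σ n ⁻¹ᵁ ⊤) ((Scheme.Hom.app (tw σ n) ⊤).hom 1) = 1 :=
      (congrArg _ (map_one _)).trans (map_one _)
    have h2 : (Lmul σ L n 0).toFun (V := ⊤) (W := U) le_rfl le_top a (ofFun 1) = a :=
      (congrArg (fun r : Γ(X, U) => r • res (Lpow σ L n) le_rfl a) h1).trans
        ((one_smul _ _).trans (res_self _ a))
    have h3 := ha
    rw [← h2] at h3
    exact h3
  | succ m ih =>
    obtain ⟨V, W, hU, hV, b, hxW, hb, hab⟩ := ih
    obtain ⟨V', y', hxV', hy'⟩ := hL.exists_isGen_twist σ m (tw σ n x)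
    let y : Γ(twist σ m L, V') := y'
    have hy : IsGen (twist σ m L) V' y := hy'.pushforward
    have hV₁ : W ⊓ tw σ n ⁻¹ᵁ V' ≤ tw σ n ⁻¹ᵁ (V ⊓ V') := fun z hz => ⟨hV hz.1, hz.2⟩
    refine ⟨V ⊓ V', W ⊓ tw σ n ⁻¹ᵁ V', inf_le_left.trans hU, hV₁,
      tmulL σ L (res _ inf_le_left b) (res _ inf_le_right y), ⟨hxW, hxV'⟩,
      (hb.restrict inf_le_left).tmul (hy.restrict inf_le_right), ?_⟩
    have h1 := Lmul_tmul σ L n m (inf_le_left.trans hU : W ⊓ tw σ n ⁻¹ᵁ V' ≤ U) hV₁ a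
      (res _ inf_le_left b) (res _ inf_le_right y)
    have h2 := (Lmul σ L n m).toFun_res (le_refl U) (inf_le_left : V ⊓ V' ≤ V)
      (inf_le_left.trans hU : W ⊓ tw σ n ⁻¹ᵁ V' ≤ U) hV₁ a b
    rw [res_self] at h2
    have h3 : IsGen (Lpow σ L (n + m)) (W ⊓ tw σ n ⁻¹ᵁ V')
        ((Lmul σ L n m).toFun (inf_le_left.trans hU) hV₁ a (res _ inf_le_left b)) := by
      rw [h2, ← (Lmul σ L n m).res_toFun hU hV inf_le_left]
      exact hab.restrict inf_le_left
    have h4 : IsGen (twist σ (n + m : ℕ) L) (W ⊓ tw σ n ⁻¹ᵁ V')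
        (semi (shiftHom σ L (i := n) (j := m) (k := (n + m : ℕ)) (by push_cast; rfl)) hV₁
          (res _ inf_le_right y)) := by
      rw [semi_shiftHom_apply]
      refine IsGen.pushforward (M := L) (τ := tw σ (-((n + m : ℕ) : ℤ))) ?_
      have h5 : tw σ (-((n + m : ℕ) : ℤ)) ⁻¹ᵁ (W ⊓ tw σ n ⁻¹ᵁ V') ≤ tw σ (-(m : ℤ)) ⁻¹ᵁ V' := by
        rw [tw_preimage σ (show (n : ℤ) + -((n + m : ℕ) : ℤ) = -m by push_cast; ring) V']
        exact (tw σ _).preimage_mono inf_le_right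
      have h6 := hy'.restrict h5
      rw [← res_res L ((tw σ (-(m : ℤ))).preimage_mono (inf_le_right : V ⊓ V' ≤ V'))] at h6
      · exact h6
    exact (congrArg (IsGen (Lpow σ L (n + (m + 1))) _) h1).mpr (h3.tmul h4)

/-! ### Ideal sheaves times an invertible sheaf -/

lemma map_resO_ideal (K : X.IdealSheafData) (U : X.affineOpens) (f : Γ(X, U.1)) :
    (K.ideal U).map (resO (X.basicOpen_le f)) = K.ideal (X.affineBasicOpen f) :=
  K.map_ideal (U := X.affineBasicOpen f) (V := U) (X.basicOpen_le f)

/-- Membership in an ideal sheaf is local: the elements that multiply `f` into `K` form an ideal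
which lies in no prime ideal. -/
lemma mem_ideal_of_locally (K : X.IdealSheafData) {U : X.affineOpens} {f : Γ(X, U.1)}
    (H : ∀ x ∈ U.1, ∃ (V : X.affineOpens) (h : V.1 ≤ U.1), x ∈ V.1 ∧ resO h f ∈ K.ideal V) :
    f ∈ K.ideal U := by
  let C : Ideal Γ(X, U.1) := (K.ideal U).colon {f}
  have hC : ∀ g, g ∈ C ↔ g * f ∈ K.ideal U := fun g => Submodule.mem_colon_singleton
  have hx : ∀ x ∈ U.1, ∃ g ∈ C.radical, x ∈ X.basicOpen g := by
    intro x hx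
    obtain ⟨V, hV, hxV, hf⟩ := H x hx
    obtain ⟨g, hg, hxg⟩ := U.2.exists_basicOpen_le ⟨x, hxV⟩ hx
    refine ⟨g, ?_, hxg⟩
    have h1 := resO_mem_ideal K (V := X.affineBasicOpen g) hg hf
    have h2 : resO (X.basicOpen_le g) f ∈ (K.ideal U).map (resO (X.basicOpen_le g)) :=
      (map_resO_ideal K U g).ge ((resO_resO hV hg f) ▸ h1)
    have := IsAffineOpen.isLocalization_basicOpen U.2 g
    obtain ⟨_, ⟨n, rfl⟩, hn⟩ := (IsLocalization.algebraMap_mem_map_algebraMap_iff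
      (Submonoid.powers g) Γ(X, X.basicOpen g) (K.ideal U) f).mp h2
    exact ⟨n, (hC _).mpr hn⟩
  have htop : Ideal.span (C.radical : Set Γ(X, U.1)) = ⊤ := by
    rw [← IsAffineOpen.self_le_iSup_basicOpen_iff U.2]
    intro x hxU
    obtain ⟨g, hg, hxg⟩ := hx x hxU
    exact Opens.mem_iSup.mpr ⟨⟨g, hg⟩, hxg⟩
  rw [Ideal.span_eq, Ideal.radical_eq_top, Ideal.eq_top_iff_one, hC, one_mul] at htop
  exact htop

lemma IsGen.mem_smul_top_iff {L : X.Modules} {U : X.Opens} {e : Γ(L, U)} (he : IsGen L U e)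
    (I : Ideal Γ(X, U)) (f : Γ(X, U)) :
    f • e ∈ I • (⊤ : Submodule Γ(X, U) Γ(L, U)) ↔ f ∈ I := by
  refine ⟨fun h => ?_, fun h => Submodule.smul_mem_smul h trivial⟩
  have key : ∀ s ∈ I • (⊤ : Submodule Γ(X, U) Γ(L, U)), ∃ g ∈ I, s = g • e := by
    intro s hs
    induction hs using Submodule.smul_induction_on' with
    | smul r hr n _ =>
      obtain ⟨g, rfl⟩ := he.surjective n
      exact ⟨r * g, I.mul_mem_right _ hr, smul_smul r g e⟩
    | add x _ y _ hx hy =>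
      obtain ⟨g, hg, rfl⟩ := hx
      obtain ⟨g', hg', rfl⟩ := hy
      exact ⟨g + g', I.add_mem hg hg', (add_smul g g' e).symm⟩
  obtain ⟨g, hg, hfg⟩ := key _ h
  rwa [he.injective hfg]

lemma IsGen.smul_mem_idealMul_iff {L : X.Modules} {U : X.affineOpens} {e : Γ(L, U.1)}
    (he : IsGen L U.1 e) (K : X.IdealSheafData) (f : Γ(X, U.1)) :
    f • e ∈ (idealMul K L).obj U.1 ↔ f ∈ K.ideal U := by
  refine ⟨fun h => mem_ideal_of_locally K fun x hx => ?_, fun h x hx => ⟨U, le_rfl, hx, ?_⟩⟩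
  · obtain ⟨V, hV, hxV, hs⟩ := h x hx
    rw [res_smul, (he.restrict hV).mem_smul_top_iff] at hs
    exact ⟨V, hV, hxV, hs⟩
  · rw [res_self]
    exact (he.mem_smul_top_iff _ _).mpr h

/-- An invertible sheaf has a generator over small affine open neighbourhoods of each point. -/
lemma IsInvertible.exists_affine {L : X.Modules} (hL : IsInvertible L) {U : X.Opens} {x : X}
    (hx : x ∈ U) : ∃ (V : X.affineOpens) (e : Γ(L, V.1)), x ∈ V.1 ∧ V.1 ≤ U ∧ IsGen L V.1 e := by
  obtain ⟨W, e, hxW, he : IsGen L W e⟩ := hL x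
  obtain ⟨V, hxV, hV⟩ := NaiveBlowup.exists_affine (U := U ⊓ W) ⟨hx, hxW⟩
  exact ⟨V, _, hxV, hV.trans inf_le_left, he.restrict (hV.trans inf_le_right)⟩

lemma idealMul_mono {K K' : X.IdealSheafData} (h : K ≤ K') (L : X.Modules) (U : X.Opens) :
    (idealMul K L).obj U ≤ (idealMul K' L).obj U := by
  intro s hs x hx
  obtain ⟨V, hV, hxV, hs⟩ := hs x hx
  exact ⟨V, hV, hxV, Submodule.smul_mono_left (h V) hs⟩

lemma IsInvertible.le_of_idealMul_le {L : X.Modules} (hL : IsInvertible L) {K K' : X.IdealSheafData}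
    (h : ∀ U, (idealMul K L).obj U ≤ (idealMul K' L).obj U) : K ≤ K' := by
  intro U f hf
  refine mem_ideal_of_locally K' fun x hx => ?_
  obtain ⟨V, e, hxV, hV, he⟩ := hL.exists_affine hx
  refine ⟨V, hV, hxV, (he.smul_mem_idealMul_iff K' _).mp (h V.1 ?_)⟩
  exact (he.smul_mem_idealMul_iff K _).mpr (resO_mem_ideal K hV hf)

lemma isLocalizingOn_idealMul {L : X.Modules} {U : X.affineOpens} {e : Γ(L, U.1)}
    (he : IsGen L U.1 e) (K : X.IdealSheafData) : IsLocalizingOn (idealMul K L).toModules U.1 := by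
  intro f
  have hloc := U.2.isLocalization_basicOpen f
  have heD := he.restrict (X.basicOpen_le f)
  constructor
  · intro s
    obtain ⟨g, hg⟩ := heD.surjective ((idealMul K L).val s)
    have hgK : g ∈ K.ideal (X.affineBasicOpen f) :=
      (IsGen.smul_mem_idealMul_iff (U := X.affineBasicOpen f) heD K g).mp
        (hg ▸ (idealMul K L).val_mem s)
    replace hgK : g ∈ (K.ideal U).map (resO (X.basicOpen_le f)) := (map_resO_ideal K U f).ge hgK
    obtain ⟨⟨t, ⟨_, n, rfl⟩⟩, ht⟩ := (IsLocalization.mem_map_algebraMap_iff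
      (Submonoid.powers f) Γ(X, X.basicOpen f)).mp hgK
    refine ⟨n, (idealMul K L).lift (t.1 • e) ((he.smul_mem_idealMul_iff K _).mpr t.2),
      (idealMul K L).val_injective ?_⟩
    have ht' : g * resO (X.basicOpen_le f) (f ^ n) = resO (X.basicOpen_le f) t.1 := ht
    rw [Subsheaf.val_res, Subsheaf.val_lift, res_smul, ← ht', Subsheaf.val_smul, ← hg, smul_smul,
      mul_comm, map_pow]
  · intro t ht
    obtain ⟨g, hg⟩ := he.surjective ((idealMul K L).val t)
    have h1 : resO (X.basicOpen_le f) g = 0 := by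
      apply heD.injective
      rw [zero_smul, ← res_smul, hg]
      exact congrArg (idealMul K L).val ht
    obtain ⟨⟨_, n, rfl⟩, hn⟩ := (IsLocalization.map_eq_zero_iff (Submonoid.powers f)
      Γ(X, X.basicOpen f) g).mp h1
    refine ⟨n, (idealMul K L).val_injective ?_⟩
    rw [Subsheaf.val_smul, ← hg, smul_smul]
    exact (congrArg (· • e) hn).trans (zero_smul _ e)

lemma finite_idealMul [IsLocallyNoetherian X] {L : X.Modules} {U : X.affineOpens} {e : Γ(L, U.1)}
    (he : IsGen L U.1 e) (K : X.IdealSheafData) :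
    Module.Finite Γ(X, U.1) Γ((idealMul K L).toModules, U.1) := by
  have := IsLocallyNoetherian.component_noetherian U
  let φ : K.ideal U →ₗ[Γ(X, U.1)] Γ((idealMul K L).toModules, U.1) :=
    { toFun := fun f => (idealMul K L).lift (f.1 • e) ((he.smul_mem_idealMul_iff K _).mpr f.2)
      map_add' := fun f g => (idealMul K L).val_injective (add_smul f.1 g.1 e)
      map_smul' := fun r f => (idealMul K L).val_injective (mul_smul r f.1 e) }
  refine Module.Finite.of_surjective φ fun s => ?_
  obtain ⟨g, hg⟩ := he.surjective ((idealMul K L).val s)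
  refine ⟨⟨g, (he.smul_mem_idealMul_iff K g).mp ?_⟩, (idealMul K L).val_injective hg⟩
  rw [hg]
  exact (idealMul K L).val_mem s

/-! ### Quasi-coherent subsheaves of an invertible sheaf -/

/-- The ideal sheaf whose sections over an affine open are those of a quasi-coherent subsheaf of
the structure sheaf. -/
def idealOfSubsheaf (T : Subsheaf (structureModule X))
    (hT : ∀ U : X.affineOpens, IsLocalizingOn T.toModules U.1) : X.IdealSheafData where
  ideal U := T.obj U.1
  map_ideal_basicOpen U f := by
    have hloc := U.2.isLocalization_basicOpen f
    refine le_antisymm (Ideal.map_le_iff_le_comap.mpr fun g hg => T.res_mem (X.basicOpen_le f) hg)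
      fun g hg => ?_
    obtain ⟨n, t, ht⟩ := (hT U f).1 (T.lift (ofFun g) hg)
    have ht' : resO (X.basicOpen_le f) (toFn (T.val t)) = resO (X.basicOpen_le f) f ^ n * g :=
      congrArg T.val ht
    have hu : IsUnit (resO (X.basicOpen_le f) f ^ n) :=
      (RingedSpace.isUnit_res_basicOpen _ f).pow n
    have h1 : resO (X.basicOpen_le f) f ^ n * g ∈
        Ideal.map (resO (X.basicOpen_le f)) (T.obj U.1) := by
      rw [← ht']
      exact Ideal.mem_map_of_mem _ (T.val_mem t)
    exact (Ideal.unit_mul_mem_iff_mem _ hu).mp h1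

/-- The transporter of an invertible sheaf `L` into a subsheaf `S`: the functions `f` with
`f L ⊆ S`. -/
def transporter {L : X.Modules} (S : Subsheaf L) : Subsheaf (structureModule X) where
  obj U :=
    { carrier := {f | ∀ (V : X.Opens) (h : V ≤ U) (s : Γ(L, V)), resO h (toFn f) • s ∈ S.obj V}
      add_mem' := fun {f g} hf hg V h s => by
        have : toFn (f + g) = toFn f + toFn g := rfl
        rw [this, map_add, add_smul]
        exact add_mem (hf V h s) (hg V h s)
      zero_mem' := fun V h s => by
        have : toFn (0 : Γ(structureModule X, U)) = 0 := rfl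
        rw [this, map_zero, zero_smul]
        exact zero_mem _
      smul_mem' := fun r f hf V h s => by
        have : toFn (r • f) = r * toFn f := rfl
        rw [this, map_mul, mul_smul]
        exact Submodule.smul_mem _ _ (hf V h s) }
  res_mem {U V} h f hf W hW s := by
    have : toFn (res _ h f) = resO h (toFn f) := rfl
    rw [this, resO_resO]
    exact hf W _ s
  mem_of_local {U} f hf V hV s := S.mem_of_local _ fun x hx => by
    obtain ⟨W, hW, hxW, h⟩ := hf x (hV hx)
    refine ⟨V ⊓ W, inf_le_left, ⟨hx, hxW⟩, ?_⟩
    have h1 := h (V ⊓ W) inf_le_right (res L inf_le_left s)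
    have h2 : toFn (res (structureModule X) hW f) = resO hW (toFn f) := rfl
    rw [h2, resO_resO] at h1
    rw [res_smul, resO_resO]
    exact h1

lemma IsGen.mem_transporter_iff {L : X.Modules} {U : X.Opens} {e : Γ(L, U)} (he : IsGen L U e)
    (S : Subsheaf L) (f : Γ(X, U)) : ofFun f ∈ (transporter S).obj U ↔ f • e ∈ S.obj U := by
  refine ⟨fun h => ?_, fun h V hV s => ?_⟩
  · have := h U le_rfl e
    rwa [resO_self] at this
  · obtain ⟨g, rfl⟩ := (he.restrict hV).surjective s
    rw [smul_comm]
    refine Submodule.smul_mem _ _ ?_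
    have := S.res_mem hV h
    rwa [res_smul] at this

lemma isLocalizingOn_transporter {L : X.Modules} {U : X.affineOpens} {e : Γ(L, U.1)}
    (he : IsGen L U.1 e) {S : Subsheaf L} (hS : IsLocalizingOn S.toModules U.1) :
    IsLocalizingOn (transporter S).toModules U.1 := by
  intro f
  have heD := he.restrict (X.basicOpen_le f)
  constructor
  · intro s
    obtain ⟨n, t, ht⟩ := (hS f).1 (S.lift
      (toFn ((transporter S).val s) • res L (X.basicOpen_le f) e)
      ((heD.mem_transporter_iff S _).mp ((transporter S).val_mem s)))
    obtain ⟨g, hg⟩ := he.surjective (S.val t)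
    refine ⟨n, (transporter S).lift (ofFun g) ((he.mem_transporter_iff S g).mpr
      (hg ▸ S.val_mem t)), (transporter S).val_injective ?_⟩
    have h1 := congrArg S.val ht
    rw [Subsheaf.val_res, ← hg, res_smul, Subsheaf.val_smul, Subsheaf.val_lift, smul_smul] at h1
    exact heD.injective h1
  · intro t ht
    have h1 : resO (X.basicOpen_le f) (toFn ((transporter S).val t)) = 0 :=
      congrArg (transporter S).val ht
    obtain ⟨n, hn⟩ := (hS f).2 (S.lift (toFn ((transporter S).val t) • e)
      ((he.mem_transporter_iff S _).mp ((transporter S).val_mem t))) (S.val_injective (by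
        rw [Subsheaf.val_res, Subsheaf.val_lift, res_smul, h1, zero_smul]
        rfl))
    refine ⟨n, (transporter S).val_injective ?_⟩
    have h2 : (f ^ n * toFn ((transporter S).val t)) • e = (0 : Γ(X, U.1)) • e := by
      rw [mul_smul, zero_smul]
      exact congrArg S.val hn
    exact he.injective h2

/-- A quasi-coherent subsheaf of an invertible sheaf `L` is `K L` for an ideal sheaf `K`. -/
theorem IsInvertible.exists_eq_idealMul {L : X.Modules} (hL : IsInvertible L) (S : Subsheaf L)
    (hS : IsQuasicoherentSheaf S.toModules) :
    ∃ K : X.IdealSheafData, ∀ U, S.obj U = (idealMul K L).obj U := by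
  have hq : IsQuasicoherentSheaf (transporter S).toModules :=
    isQuasicoherentSheaf_of_isLocalizingOn fun x => by
      obtain ⟨U, e, hx, -, he⟩ := hL.exists_affine (U := ⊤) (x := x) trivial
      exact ⟨U.1, U.2, hx, isLocalizingOn_transporter he (hS.isLocalizingOn U.2)⟩
  let K := idealOfSubsheaf (transporter S) fun U => hq.isLocalizingOn U.2
  refine ⟨K, fun U => le_antisymm (fun s hs => ?_) fun s hs => S.mem_of_local s fun x hx => ?_⟩
  · refine (idealMul K L).mem_of_local s fun x hx => ?_
    obtain ⟨V, e, hxV, hV, he⟩ := hL.exists_affine hx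
    refine ⟨V.1, hV, hxV, ?_⟩
    obtain ⟨f, hf⟩ := he.surjective (res L hV s)
    rw [← hf, he.smul_mem_idealMul_iff]
    refine (he.mem_transporter_iff S f).mpr ?_
    rw [hf]
    exact S.res_mem hV hs
  · obtain ⟨V, e, hxV, hV, he⟩ := hL.exists_affine hx
    refine ⟨V.1, hV, hxV, ?_⟩
    obtain ⟨f, hf⟩ := he.surjective (res L hV s)
    have h1 := (idealMul K L).res_mem hV hs
    rw [← hf, he.smul_mem_idealMul_iff] at h1
    rw [← hf]
    exact (he.mem_transporter_iff S f).mp h1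

/-! ### Constructions with coherent sheaves -/

lemma app_res {M N : X.Modules} (φ : M ⟶ N) {U V : X.Opens} (h : V ≤ U) (s : Γ(M, U)) :
    φ.app V (res M h s) = res N h (φ.app U s) :=
  NatTrans.naturality_apply φ.mapPresheaf (homOfLE h).op s

lemma isZero_iff {M : X.Modules} : Limits.IsZero M ↔ ∀ (U : X.Opens) (s : Γ(M, U)), s = 0 := by
  rw [Limits.IsZero.iff_id_eq_zero]
  constructor
  · intro h U s
    have := congrArg (fun f : M ⟶ M => f.app U s) h
    exact this
  · intro h
    ext U s
    exact h U _

lemma isUnit_resO_basicOpen {U : X.Opens} (f : Γ(X, U)) : IsUnit (resO (X.basicOpen_le f) f) :=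
  RingedSpace.isUnit_res_basicOpen _ f

lemma IsLocalizingOn.finite_basicOpen {M : X.Modules} {U : X.Opens} (hM : IsLocalizingOn M U)
    (hfin : Module.Finite Γ(X, U) Γ(M, U)) (f : Γ(X, U)) :
    Module.Finite Γ(X, X.basicOpen f) Γ(M, X.basicOpen f) := by
  obtain ⟨S, hS, hspan⟩ := Submodule.fg_def.mp hfin.fg_top
  refine ⟨Submodule.fg_def.mpr ⟨res M (X.basicOpen_le f) '' S, hS.image _, ?_⟩⟩
  rw [eq_top_iff]
  intro s _
  obtain ⟨n, t, ht⟩ := (hM f).1 s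
  rw [← Submodule.smul_mem_iff_of_isUnit _ ((isUnit_resO_basicOpen f).pow n), ← ht]
  have key : ∀ t ∈ Submodule.span Γ(X, U) S, res M (X.basicOpen_le f) t ∈
      Submodule.span Γ(X, X.basicOpen f) (res M (X.basicOpen_le f) '' S) := by
    intro t ht
    induction ht using Submodule.span_induction with
    | mem x hx => exact Submodule.subset_span ⟨x, hx, rfl⟩
    | zero => rw [map_zero]; exact zero_mem _
    | add x y _ _ hx hy => rw [map_add]; exact add_mem hx hy
    | smul r x _ hx => rw [res_smul]; exact Submodule.smul_mem _ _ hx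
  exact key t (hspan ▸ trivial)

/-- Finitely many coherent sheaves are finitely generated over a common affine neighbourhood. -/
lemma exists_finite_of_isCoherentSheaf {ι : Type*} (s : Finset ι) {M : ι → X.Modules}
    (hM : ∀ i ∈ s, IsCoherentSheaf (M i)) (x : X) :
    ∃ U : X.Opens, IsAffineOpen U ∧ x ∈ U ∧ ∀ i ∈ s, Module.Finite Γ(X, U) Γ(M i, U) := by
  classical
  induction s using Finset.induction with
  | empty =>
    obtain ⟨U, hx, -⟩ := exists_affine (x := x) (U := ⊤) trivial
    exact ⟨U.1, U.2, hx, fun i hi => absurd hi (Finset.notMem_empty i)⟩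
  | insert a s _ ih =>
    obtain ⟨U, hU, hxU, hfU⟩ := ih fun i hi => hM i (Finset.mem_insert_of_mem hi)
    have ha := hM a (Finset.mem_insert_self a s)
    obtain ⟨V, hV, hxV, hfV⟩ := ha.exists_finite x
    obtain ⟨f, g, hfg, hxf⟩ := exists_basicOpen_le_affine_inter hU hV x ⟨hxU, hxV⟩
    refine ⟨X.basicOpen f, hU.basicOpen f, hxf, fun i hi => ?_⟩
    rcases Finset.mem_insert.mp hi with rfl | hi'
    · rw [hfg]
      exact (ha.1.isLocalizingOn hV).finite_basicOpen hfV g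
    · exact ((hM i hi).1.isLocalizingOn hU).finite_basicOpen (hfU i hi') f

/-- A sheaf that is a retract of a finite direct sum of coherent sheaves is coherent. -/
lemma isCoherentSheaf_of_sum_eq_id {ι : Type*} [Fintype ι] {F : X.Modules} {M : ι → X.Modules}
    (hM : ∀ i, IsCoherentSheaf (M i)) (j : ∀ i, M i ⟶ F) (p : ∀ i, F ⟶ M i)
    (h : ∑ i, p i ≫ j i = 𝟙 F) : IsCoherentSheaf F := by
  classical
  have hsum : ∀ (U : X.Opens) (s : Γ(F, U)), ∑ i, (j i).app U ((p i).app U s) = s := by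
    intro U s
    let ev : (F ⟶ F) →+ Γ(F, U) :=
      AddMonoidHom.mk' (fun φ => φ.app U s) fun φ ψ => rfl
    have h1 : ev (∑ i, p i ≫ j i) = s := by rw [h]; rfl
    rw [map_sum] at h1
    exact h1
  refine isCoherentSheaf_of_isLocalizingOn fun x => ?_
  obtain ⟨U, hU, hxU, hfin⟩ := exists_finite_of_isCoherentSheaf Finset.univ (fun i _ => hM i) x
  refine ⟨U, hU, hxU, fun f => ⟨fun s => ?_, fun t ht => ?_⟩, ?_⟩
  · choose n t ht using fun i => ((hM i).1.isLocalizingOn hU f).1 ((p i).app _ s)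
    refine ⟨Finset.univ.sup n, ∑ i, (j i).app U (f ^ (Finset.univ.sup n - n i) • t i), ?_⟩
    rw [map_sum]
    conv_rhs => rw [← hsum _ s, Finset.smul_sum]
    refine Finset.sum_congr rfl fun i _ => ?_
    rw [← app_res, res_smul, ht, smul_smul, map_pow, ← pow_add,
      Nat.sub_add_cancel (Finset.le_sup (Finset.mem_univ i)), Scheme.Modules.Hom.app_smul]
  · choose n hn using fun i => ((hM i).1.isLocalizingOn hU f).2 ((p i).app U t)
      (by rw [← app_res, ht, map_zero])
    refine ⟨Finset.univ.sup n, ?_⟩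
    rw [← hsum U t, Finset.smul_sum]
    refine Finset.sum_eq_zero fun i _ => ?_
    rw [← Nat.sub_add_cancel (Finset.le_sup (f := n) (Finset.mem_univ i)), pow_add, mul_smul,
      ← Scheme.Modules.Hom.app_smul, hn, map_zero, smul_zero]
  · have := fun i => hfin i (Finset.mem_univ i)
    let φ : (∀ i, Γ(M i, U)) →ₗ[Γ(X, U)] Γ(F, U) :=
      { toFun := fun t => ∑ i, (j i).app U (t i)
        map_add' := fun s t => by
          simp only [Pi.add_apply, map_add, Finset.sum_add_distrib]
        map_smul' := fun r t => by
          simp only [Pi.smul_apply, Scheme.Modules.Hom.app_smul, Finset.smul_sum,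
            RingHom.id_apply] }
    exact Module.Finite.of_surjective φ fun s => ⟨fun i => (p i).app U s, hsum U s⟩

instance : Limits.HasFiniteBiproducts X.Modules := Abelian.hasFiniteBiproducts

lemma isCoherentSheaf_biproduct {ι : Type} [Fintype ι] {M : ι → X.Modules}
    (hM : ∀ i, IsCoherentSheaf (M i)) : IsCoherentSheaf (Limits.biproduct M) :=
  isCoherentSheaf_of_sum_eq_id hM (Limits.biproduct.ι M) (Limits.biproduct.π M)
    Limits.biproduct.total

section pushforward

variable {τ : X ⟶ X} {M : X.Modules}

lemma pushforward_smul {U : X.Opens} (r : Γ(X, U)) (s : Γ(M, τ ⁻¹ᵁ U)) :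
    (HSMul.hSMul (β := Γ((Scheme.Modules.pushforward τ).obj M, U)) r s :
      Γ((Scheme.Modules.pushforward τ).obj M, U)) =
      ((τ.app U).hom r • s : Γ(M, τ ⁻¹ᵁ U)) := rfl

lemma isLocalizingOn_pushforward {U : X.Opens} (hM : IsLocalizingOn M (τ ⁻¹ᵁ U)) :
    IsLocalizingOn ((Scheme.Modules.pushforward τ).obj M) U := by
  intro f
  have e : τ ⁻¹ᵁ X.basicOpen f = X.basicOpen ((τ.app U).hom f) := Scheme.preimage_basicOpen τ f
  have hr : ((τ.app (X.basicOpen f)).hom (resO (X.basicOpen_le f) f)) =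
      resO (τ.preimage_mono (X.basicOpen_le f)) ((τ.app U).hom f) :=
    ConcreteCategory.congr_hom (τ.naturality (homOfLE (X.basicOpen_le f)).op) f
  refine ⟨fun (s : Γ(M, τ ⁻¹ᵁ X.basicOpen f)) => ?_, fun (t : Γ(M, τ ⁻¹ᵁ U)) ht => ?_⟩
  · obtain ⟨n, t, ht⟩ := (hM ((τ.app U).hom f)).1 (res M e.ge s)
    refine ⟨n, t, ?_⟩
    have h1 := congrArg (res M e.le) ht
    rw [res_res, res_smul, res_res, res_self, map_pow, resO_resO] at h1
    rw [pushforward_smul, map_pow, hr]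
    exact h1
  · obtain ⟨n, hn⟩ := (hM ((τ.app U).hom f)).2 t (by
      have h1 : res M (τ.preimage_mono (X.basicOpen_le f)) t = 0 := ht
      rw [← res_res M (τ.preimage_mono (X.basicOpen_le f)) e.ge, h1, map_zero])
    refine ⟨n, ?_⟩
    rw [pushforward_smul, map_pow]
    exact hn

lemma finite_pushforward [IsIso τ] {U : X.Opens} (hM : Module.Finite Γ(X, τ ⁻¹ᵁ U) Γ(M, τ ⁻¹ᵁ U)) :
    Module.Finite Γ(X, U) Γ((Scheme.Modules.pushforward τ).obj M, U) := by
  obtain ⟨S, hS, hspan⟩ := Submodule.fg_def.mp hM.fg_top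
  refine ⟨Submodule.fg_def.mpr ⟨(S : Set Γ(M, τ ⁻¹ᵁ U)), hS, ?_⟩⟩
  rw [eq_top_iff]
  intro s _
  have h1 : (s : Γ(M, τ ⁻¹ᵁ U)) ∈ Submodule.span Γ(X, τ ⁻¹ᵁ U) S := hspan ▸ trivial
  induction h1 using Submodule.span_induction with
  | mem x hx => exact Submodule.subset_span hx
  | zero =>
    exact zero_mem (Submodule.span Γ(X, U) (M := Γ((Scheme.Modules.pushforward τ).obj M, U)) S)
  | add x y _ _ hx hy =>
    exact add_mem (S := Submodule Γ(X, U) Γ((Scheme.Modules.pushforward τ).obj M, U))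
      (hx trivial) (hy trivial)
  | smul r x _ hx =>
    obtain ⟨r', rfl⟩ := (ConcreteCategory.bijective_of_isIso (τ.app U)).2 r
    exact Submodule.smul_mem (Submodule.span Γ(X, U)
      (M := Γ((Scheme.Modules.pushforward τ).obj M, U)) S) r' (hx trivial)

lemma isCoherentSheaf_pushforward [IsIso τ] (hM : IsCoherentSheaf M) :
    IsCoherentSheaf ((Scheme.Modules.pushforward τ).obj M) :=
  isCoherentSheaf_of_isLocalizingOn fun x => by
    let ρ := inv τ
    have e : ∀ V : X.Opens, τ ⁻¹ᵁ ρ ⁻¹ᵁ V = V := fun V => by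
      change (τ ≫ inv τ) ⁻¹ᵁ V = V
      rw [IsIso.hom_inv_id]
      rfl
    obtain ⟨U, hU, hx, hfin⟩ := hM.exists_finite (ρ x)
    refine ⟨ρ ⁻¹ᵁ U, hU.preimage ρ, hx, isLocalizingOn_pushforward ?_, finite_pushforward ?_⟩
    · rw [e]; exact hM.1.isLocalizingOn hU
    · rw [e]; exact hfin

end pushforward

/-! ### Local factorization of sections of products -/

lemma exists_fin_sum_of_mem_closure {A : Type*} [AddCommMonoid A] {S : Set A} {s : A}
    (h : s ∈ AddSubmonoid.closure S) :
    ∃ (r : ℕ) (t : Fin r → A), (∀ j, t j ∈ S) ∧ ∑ j, t j = s := by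
  obtain ⟨l, hl, rfl⟩ := AddSubmonoid.exists_list_of_mem_closure h
  exact ⟨l.length, l.get, fun j => hl _ (l.get_mem j), by simp [← List.sum_ofFn]⟩

lemma tw_preimage_neg (σ : Aut X) (n : ℤ) (V : X.Opens) :
    tw σ n ⁻¹ᵁ tw σ (-n) ⁻¹ᵁ V = V := by
  rw [← tw_preimage σ (neg_add_cancel n), tw_preimage_zero]

lemma tw_neg_preimage (σ : Aut X) (n : ℤ) (V : X.Opens) :
    tw σ (-n) ⁻¹ᵁ tw σ n ⁻¹ᵁ V = V := by
  rw [← tw_preimage σ (add_neg_cancel n), tw_preimage_zero]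

lemma comap_tw_comap_tw (σ : Aut X) (I : X.IdealSheafData) {m n k : ℤ} (h : m + n = k) :
    (I.comap (tw σ m)).comap (tw σ n) = I.comap (tw σ k) := by
  rw [← Scheme.IdealSheafData.comap_comp, ← tw_add σ h]

lemma comap_tw_zero (σ : Aut X) (I : X.IdealSheafData) : I.comap (tw σ 0) = I := by
  rw [tw_zero, Scheme.IdealSheafData.comap_id]

/-- Sections of an inverse image ideal sheaf under `σ^n` come from sections of the ideal sheaf. -/
lemma exists_app_eq_of_mem_comap (σ : Aut X) (K : X.IdealSheafData) (n : ℤ) {W : X.affineOpens}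
    {k : Γ(X, W.1)} (hk : k ∈ (K.comap (tw σ n)).ideal W) (h : W.1 ≤ tw σ n ⁻¹ᵁ tw σ (-n) ⁻¹ᵁ W.1) :
    ∃ κ ∈ K.ideal ⟨tw σ (-n) ⁻¹ᵁ W.1, W.2.preimage _⟩, resO h (((tw σ n).app _).hom κ) = k := by
  refine ⟨((tw σ (-n)).app W.1).hom k, ?_, ?_⟩
  · have h1 := app_mem_comap (K.comap (tw σ n)) (tw σ (-n)) (V := W)
      (W := ⟨tw σ (-n) ⁻¹ᵁ W.1, W.2.preimage _⟩) le_rfl hk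
    rwa [resO_self, comap_tw_comap_tw σ K (add_neg_cancel n), comap_tw_zero] at h1
  · have key : ∀ (τ : X ⟶ X) (_ : τ = tw σ n ≫ tw σ (-n)) (_ : τ = 𝟙 X),
        resO h (((tw σ n).app _).hom (((tw σ (-n)).app W.1).hom k)) = k := by
      intro τ h1 h2
      have h3 : (𝟙 X : X ⟶ X) = tw σ n ≫ tw σ (-n) := h2.symm.trans h1
      have h4 : resO h (((tw σ n ≫ tw σ (-n)).app W.1).hom k) = k := by
        have h5 : ∀ (ρ : X ⟶ X) (_ : 𝟙 X = ρ) (h' : W.1 ≤ ρ ⁻¹ᵁ W.1),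
            resO h' ((ρ.app W.1).hom k) = k := by
          rintro _ rfl h'
          rw [Scheme.Hom.id_app]
          exact resO_self k
        exact h5 _ h3 h
      rwa [Scheme.Hom.comp_app] at h4
    exact key (tw σ 0) (tw_add σ (neg_add_cancel n)) (tw_zero σ)

/-- Sections of `(K K'^{σ^n}) L_{n + m}` are locally sums of products of sections of `K L_n` and
of `K' L_m`. -/
lemma exists_mem_closure_Lmul {L : X.Modules} (hL : IsInvertible L) (σ : Aut X)
    (K K' : X.IdealSheafData) (n m : ℕ) {W : X.Opens} {s : Γ(Lpow σ L (n + m), W)}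
    (hs : s ∈ (idealMul (K * K'.comap (tw σ n)) (Lpow σ L (n + m))).obj W) {x : X} (hx : x ∈ W) :
    ∃ (W' : X.Opens) (hW : W' ≤ W), x ∈ W' ∧ ∀ h : W' ≤ tw σ n ⁻¹ᵁ tw σ (-n) ⁻¹ᵁ W',
      res _ hW s ∈ AddSubmonoid.closure {t : Γ(Lpow σ L (n + m), W') |
        ∃ a ∈ (idealMul K (Lpow σ L n)).obj W',
        ∃ b ∈ (idealMul K' (Lpow σ L m)).obj (tw σ (-n) ⁻¹ᵁ W'),
          t = (Lmul σ L n m).toFun le_rfl h a b} := by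
  obtain ⟨U, a, hxU, -, ha⟩ := (hL.Lpow σ n).exists_affine (U := ⊤) (x := x) trivial
  obtain ⟨V, W₁, hU, hV, b, hxW₁, hb, hab⟩ := exists_isGen_Lmul hL σ n m ha hxU
  obtain ⟨W', hxW', hW'⟩ := exists_affine (U := W ⊓ W₁) ⟨hx, hxW₁⟩
  have hWW : W'.1 ≤ W := hW'.trans inf_le_left
  have hWW₁ : W'.1 ≤ W₁ := hW'.trans inf_le_right
  have hVV : tw σ (-n) ⁻¹ᵁ W'.1 ≤ V := by
    rw [← tw_neg_preimage σ n V]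
    exact (tw σ (-n)).preimage_mono (hWW₁.trans hV)
  refine ⟨W'.1, hWW, hxW', fun h => ?_⟩
  let W'' : X.affineOpens := ⟨tw σ (-n) ⁻¹ᵁ W'.1, W'.2.preimage _⟩
  have ha' := ha.restrict (hWW₁.trans hU)
  have hb' : IsGen _ W''.1 _ := hb.restrict hVV
  have hab' : (Lmul σ L n m).toFun le_rfl h (res _ (hWW₁.trans hU) a) (res _ hVV b) =
      res _ hWW₁ ((Lmul σ L n m).toFun hU hV a b) := by
    rw [(Lmul σ L n m).toFun_res, (Lmul σ L n m).res_toFun]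
  have hgen := hab.restrict hWW₁
  obtain ⟨f, hf⟩ := hgen.surjective (res _ hWW s)
  have hfK : f ∈ K.ideal W' * (K'.comap (tw σ n)).ideal W' := by
    refine (hgen.smul_mem_idealMul_iff (K * K'.comap (tw σ n)) f).mp ?_
    rw [hf]
    exact Subsheaf.res_mem _ hWW hs
  rw [← hf]
  clear hf
  induction hfK using Submodule.mul_induction_on' with
  | mem_mul_mem k hk k' hk' =>
    obtain ⟨κ, hκ, hκk⟩ := exists_app_eq_of_mem_comap σ K' n hk' h
    refine AddSubmonoid.subset_closure ⟨k • res _ (hWW₁.trans hU) a,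
      (ha'.smul_mem_idealMul_iff K k).mpr hk, κ • res _ hVV b,
      (IsGen.smul_mem_idealMul_iff (U := W'') hb' K' κ).mpr hκ, ?_⟩
    rw [(Lmul σ L n m).smul_left, (Lmul σ L n m).smul_right, hκk, hab', resO_self, smul_smul]
  | add f _ g _ hf hg =>
    rw [add_smul]
    exact add_mem hf hg

/-! ### Maps out of coherent sheaves -/

/-- On a quasi-compact scheme, all but finitely many of the maps in a locally finite family on a
coherent sheaf vanish. -/
lemma IsLocallyFiniteFamily.exists_forall_eq_zero [CompactSpace X] {F : X.Modules}
    (hF : IsCoherentSheaf F) {N : ℤ → X.Modules} {θ : ∀ n, F ⟶ N n}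
    (hθ : IsLocallyFiniteFamily θ) : ∃ b : ℤ, ∀ n, b < n → ∀ (U : X.Opens) (s : Γ(F, U)),
      (θ n).app U s = 0 := by
  have key : ∀ x : X, ∃ (D : X.Opens) (b : ℤ), x ∈ D ∧ ∀ n, b < n →
      ∀ (U : X.Opens) (s : Γ(F, U)), ∀ y ∈ U, y ∈ D → ∃ (V : X.Opens) (h : V ≤ U), y ∈ V ∧
        (θ n).app V (res F h s) = 0 := by
    intro x
    obtain ⟨U, hU, hxU, hfin⟩ := hF.exists_finite x
    obtain ⟨S, hS, hspan⟩ := Submodule.fg_def.mp hfin.fg_top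
    choose V hV hxV hfinV using fun s : Γ(F, U) => hθ U s x hxU
    let D : X.Opens := U ⊓ hS.toFinset.inf V
    have hxD : x ∈ D := by
      exact ⟨hxU, Finset.inf_induction (p := fun W : X.Opens => x ∈ W) trivial
        (fun W₁ h₁ W₂ h₂ => ⟨h₁, h₂⟩) fun s _ => hxV s⟩
    have hbdd : (⋃ s ∈ S, {n : ℤ | (θ n).app (V s) (res F (hV s) s) ≠ 0}).Finite :=
      hS.biUnion fun s _ => hfinV s
    obtain ⟨b, hb⟩ := hbdd.bddAbove
    refine ⟨D, b, hxD, fun n hn W s y hyW hyD => ?_⟩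
    obtain ⟨g, hg, hyg⟩ := hU.exists_basicOpen_le (V := W ⊓ D) ⟨y, hyW, hyD⟩ hyD.1
    refine ⟨X.basicOpen g, hg.trans inf_le_left, hyg, ?_⟩
    obtain ⟨e, t, ht⟩ := (hF.1.isLocalizingOn hU g).1 (res F (hg.trans inf_le_left) s)
    have hzero : ∀ t ∈ Submodule.span Γ(X, U) S, (θ n).app _ (res F (X.basicOpen_le g) t) = 0 := by
      intro t ht
      induction ht using Submodule.span_induction with
      | mem r hr =>
        have h1 : (θ n).app (V r) (res F (hV r) r) = 0 := by
          by_contra h2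
          exact absurd (hb (Set.mem_biUnion hr h2)) (not_le.mpr hn)
        have h2 : X.basicOpen g ≤ V r := hg.trans <| inf_le_right.trans <| inf_le_right.trans <|
          Finset.inf_le (hS.mem_toFinset.mpr hr)
        rw [← res_res F (hV r) h2, app_res, h1, map_zero]
      | zero => rw [map_zero, map_zero]
      | add x y _ _ hx hy => rw [map_add, map_add, hx, hy, add_zero]
      | smul r x _ hx => rw [res_smul, Scheme.Modules.Hom.app_smul, hx, smul_zero]
    have h1 := hzero t (hspan ▸ trivial)
    rw [ht, Scheme.Modules.Hom.app_smul] at h1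
    exact ((isUnit_resO_basicOpen g).pow e).smul_eq_zero.mp h1
  choose D b hxD hb using key
  obtain ⟨s, hs⟩ := isCompact_univ.elim_finite_subcover (fun x => (D x : Set X))
    (fun x => (D x).isOpen) fun x _ => Set.mem_iUnion.mpr ⟨x, hxD x⟩
  obtain ⟨B, hB⟩ := (s.image b).bddAbove
  refine ⟨B, fun n hn U t => eq_of_locally (N n) fun y hy => ?_⟩
  obtain ⟨x, hx⟩ := Set.mem_iUnion.mp (hs (Set.mem_univ y))
  obtain ⟨hxs, hyx⟩ := Set.mem_iUnion.mp hx
  obtain ⟨V, hV, hyV, h⟩ := hb x n ((hB (by simpa using ⟨x, hxs, rfl⟩)).trans_lt hn) U t y hy hyx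
  exact ⟨V, hV, hyV, by rw [← app_res, h, map_zero]⟩

/-! ### Injective images -/

section image

variable {M N : X.Modules} (φ : ∀ U : X.Opens, Γ(N, U) →ₗ[Γ(X, U)] Γ(M, U))
  (hres : ∀ {U V : X.Opens} (h : V ≤ U) (s : Γ(N, U)), φ V (res N h s) = res M h (φ U s))
  (hinj : ∀ U, Function.Injective (φ U))

/-- The image of an injective map of sheaves of modules, given on sections. -/
def imageSubsheaf : Subsheaf M where
  obj U := LinearMap.range (φ U)
  res_mem := by
    rintro U V h _ ⟨t, rfl⟩
    exact ⟨res N h t, hres h t⟩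
  mem_of_local {U} s hs := by
    choose V hV hxV t ht using fun x : U => hs x x.2
    obtain ⟨r, hr⟩ := exists_glue N V hV (fun x hx => ⟨⟨x, hx⟩, hxV ⟨x, hx⟩⟩) t fun i j =>
      hinj _ (by rw [hres, hres, ht, ht, res_res, res_res])
    exact ⟨r, eq_of_locally M fun x hx => ⟨V ⟨x, hx⟩, hV _, hxV _, by rw [← hres, hr, ht]⟩⟩

lemma isLocalizingOn_imageSubsheaf {U : X.Opens} (hN : IsLocalizingOn N U) :
    IsLocalizingOn (imageSubsheaf φ hres hinj).toModules U := by
  intro f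
  refine ⟨fun s => ?_, fun t ht => ?_⟩
  · obtain ⟨r, hr⟩ := (imageSubsheaf φ hres hinj).val_mem s
    obtain ⟨n, t, ht⟩ := (hN f).1 r
    refine ⟨n, (imageSubsheaf φ hres hinj).lift (φ U t) (LinearMap.mem_range_self (φ U) t),
      Subsheaf.val_injective _ ?_⟩
    change res M _ (φ U t) = resO _ f ^ n • (imageSubsheaf φ hres hinj).val s
    rw [← hr, ← hres, ht, map_smul]
    rfl
  · obtain ⟨r, hr⟩ := (imageSubsheaf φ hres hinj).val_mem t
    obtain ⟨n, hn⟩ := (hN f).2 r (hinj _ (by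
      rw [hres, hr, map_zero]
      exact congrArg (imageSubsheaf φ hres hinj).val ht))
    refine ⟨n, Subsheaf.val_injective _ ?_⟩
    rw [Subsheaf.val_smul, ← hr, ← map_smul, hn, map_zero]
    rfl

lemma isQuasicoherentSheaf_imageSubsheaf (hN : IsQuasicoherentSheaf N) :
    IsQuasicoherentSheaf (imageSubsheaf φ hres hinj).toModules :=
  isQuasicoherentSheaf_of_isLocalizingOn fun x => by
    obtain ⟨U, hx, -⟩ := exists_affine (x := x) (U := ⊤) trivial
    exact ⟨U.1, U.2, hx, isLocalizingOn_imageSubsheaf φ hres hinj (hN.isLocalizingOn U.2)⟩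

/-- A quasi-coherent sheaf isomorphic to `K L`, with `L` invertible, is coherent. -/
lemma isCoherentSheaf_of_range_eq [IsLocallyNoetherian X] (hM : IsInvertible M)
    (hN : IsQuasicoherentSheaf N) (hinj : ∀ U, Function.Injective (φ U)) (K : X.IdealSheafData)
    (hK : ∀ U, LinearMap.range (φ U) = (idealMul K M).obj U) : IsCoherentSheaf N :=
  isCoherentSheaf_of_isLocalizingOn fun x => by
    obtain ⟨U, e, hx, -, he⟩ := hM.exists_affine (U := ⊤) (x := x) trivial
    refine ⟨U.1, U.2, hx, hN.isLocalizingOn U.2, ?_⟩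
    have := finite_idealMul he K
    let ψ : Γ(N, U.1) →ₗ[Γ(X, U.1)] Γ((idealMul K M).toModules, U.1) :=
      { toFun := fun s => (idealMul K M).lift (φ U.1 s) ((hK U.1).le ⟨s, rfl⟩)
        map_add' := fun s t => Subsheaf.val_injective _ (map_add (φ U.1) s t)
        map_smul' := fun r s => Subsheaf.val_injective _ (map_smul (φ U.1) r s) }
    refine Module.Finite.equiv
      (LinearEquiv.ofBijective ψ ⟨fun s t h => hinj _ ?_, fun s => ?_⟩).symm
    · exact congrArg (idealMul K M).val h
    · obtain ⟨t, ht⟩ := (hK U.1).ge ((idealMul K M).val_mem s)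
      exact ⟨t, Subsheaf.val_injective _ ht⟩

end image

/-! ### Criteria for coherence of graded modules -/

/-- The map of sheaves of modules given by compatible linear maps on sections. -/
def homOfSections {M N : X.Modules} (φ : ∀ U : X.Opens, Γ(M, U) →ₗ[Γ(X, U)] Γ(N, U))
    (hφ : ∀ {U V : X.Opens} (h : V ≤ U) (s : Γ(M, U)), φ V (res M h s) = res N h (φ U s)) :
    M ⟶ N :=
  ⟨PresheafOfModules.homMk
    { app := fun U => AddCommGrpCat.ofHom (φ U.unop).toAddMonoidHom
      naturality := fun U V f => by
        ext s
        exact hφ (leOfHom f.unop) s } fun U r m => (φ U.unop).map_smul r m⟩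

variable {σ : Aut X} {B : GradedBimoduleAlgebra σ}

lemma tw_neg_apply (σ : Aut X) (n : ℤ) (x : X) : tw σ (-n) (tw σ n x) = x := by
  rw [← Scheme.Hom.comp_apply, ← tw_add σ (neg_add_cancel n), tw_zero]
  rfl

section families

variable {G : ℤ → X.Modules} {S : Finset ℤ}

/-- The projections from a direct sum of sheaves indexed by `S` to its summands, extended by zero
to all integers. -/
def sumProj (G : ℤ → X.Modules) (S : Finset ℤ) (n : ℤ) :
    Limits.biproduct (fun i : S => G i) ⟶ G n :=
  if h : n ∈ S then Limits.biproduct.π (fun i : S => G i) ⟨n, h⟩ else 0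

/-- The section of the direct sum given by a section of one summand. -/
def sumIncl (i : S) (U : X.Opens) (a : Γ(G i, U)) :
    Γ(Limits.biproduct (fun i : S => G i), U) :=
  (Limits.biproduct.ι (fun i : S => G i) i).app U a

lemma sumProj_sumIncl_self (i : S) (U : X.Opens) (a : Γ(G i, U)) :
    (sumProj G S i).app U (sumIncl i U a) = a := by
  rw [sumProj, dif_pos i.2]
  have := congrArg (fun f => Scheme.Modules.Hom.app f U a)
    (Limits.biproduct.ι_π_self (fun i : S => G i) i)
  exact this

lemma sumProj_sumIncl_ne (i : S) {n : ℤ} (h : n ≠ i) (U : X.Opens) (a : Γ(G i, U)) :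
    (sumProj G S n).app U (sumIncl i U a) = 0 := by
  rw [sumProj]
  split_ifs with hn
  · have := congrArg (fun f => Scheme.Modules.Hom.app f U a)
      (Limits.biproduct.ι_π_ne (fun i : S => G i) (j := i) (j' := ⟨n, hn⟩)
        fun e => h (congrArg Subtype.val e).symm)
    exact this
  · rfl

lemma isLocallyFiniteFamily_sumProj : IsLocallyFiniteFamily (sumProj G S) := by
  intro U s x hx
  refine ⟨U, le_rfl, hx, S.finite_toSet.subset fun n hn => ?_⟩
  by_contra h
  apply hn
  rw [sumProj, dif_neg (show n ∉ S from h)]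
  rfl

end families

lemma RightModule.component_eq_zero (M : RightModule B) {F : X.Modules}
    (θ : ∀ n : ℤ, F ⟶ (Scheme.Modules.pushforward (tw σ n)).obj (M.G n)) (n : ℤ) (W : X.Opens)
    (m : ℕ) (s : Γ(F, tw σ m ⁻¹ᵁ W)) (e : Γ(B.E m, tw σ m ⁻¹ᵁ W))
    (h : (θ (n - m)).app (tw σ m ⁻¹ᵁ W) s = 0) : M.component θ n W m s e = 0 := by
  rw [RightModule.component, h]
  exact Pairing.toFun_zero_left _ _ _ _

lemma RightModule.component_eq (M : RightModule B) {F : X.Modules}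
    (θ : ∀ n : ℤ, F ⟶ (Scheme.Modules.pushforward (tw σ n)).obj (M.G n)) {i n : ℤ} (W : X.Opens)
    {m : ℕ} (h : i + m = n) (s : Γ(F, tw σ m ⁻¹ᵁ W)) (e : Γ(B.E m, tw σ m ⁻¹ᵁ W))
    {a : Γ(M.G i, tw σ i ⁻¹ᵁ tw σ m ⁻¹ᵁ W)} (ha : (θ i).app (tw σ m ⁻¹ᵁ W) s = a) :
    M.component θ n W m s e = (M.act h).toFun
      (le_of_eq (tw_preimage σ (show (m : ℤ) + i = n by omega) W))
      (le_of_eq (tw_preimage σ (show (m : ℤ) + i = n by omega) W)) a e := by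
  obtain rfl : i = n - m := by omega
  subst ha
  rfl

lemma LeftModule.component_eq_zero (M : LeftModule B) {F : X.Modules} (θ : ∀ n : ℤ, F ⟶ M.G n)
    (n : ℤ) (W : X.Opens) (m : ℕ) (e : Γ(B.E m, W)) (s : Γ(twist σ m F, W))
    (h : (θ (n - m)).app (tw σ (-(m : ℤ)) ⁻¹ᵁ W) s = 0) : M.component θ n W m e s = 0 := by
  rw [LeftModule.component, h]
  exact Pairing.toFun_zero_right _ _ _ _

lemma LeftModule.component_eq (M : LeftModule B) {F : X.Modules} (θ : ∀ n : ℤ, F ⟶ M.G n)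
    {i n : ℤ} (W : X.Opens) {m : ℕ} (h : m + i = n) (e : Γ(B.E m, W)) (s : Γ(twist σ m F, W))
    {a : Γ(M.G i, tw σ (-(m : ℤ)) ⁻¹ᵁ W)} (ha : (θ i).app (tw σ (-(m : ℤ)) ⁻¹ᵁ W) s = a) :
    M.component θ n W m e s =
      (M.act h).toFun le_rfl (le_of_eq (tw_preimage_neg σ m W).symm) e a := by
  obtain rfl : i = n - m := by omega
  subst ha
  rfl

/-- A graded right module is coherent if it is generated, locally, by finitely many of its
components and these are coherent. -/
theorem RightModule.isCoherent_of_generated (M : RightModule B) (S : Finset ℤ)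
    (hS : ∀ i ∈ S, IsCoherentSheaf (M.G i))
    (h : ∀ (d : ℤ) (U : X.Opens) (g : Γ(M.G d, U)), ∀ x ∈ U, ∃ (W : X.Opens) (hW : W ≤ U), x ∈ W ∧
      ∃ (r : ℕ) (i : Fin r → S) (m : Fin r → ℕ) (hm : ∀ j, (i j : ℤ) + m j = d)
        (a : ∀ j, Γ(M.G (i j), W)) (b : ∀ j, Γ(B.E (m j), tw σ (-(i j)) ⁻¹ᵁ W)),
        ∑ j, (M.act (hm j)).toFun le_rfl (le_of_eq (tw_preimage_neg σ (i j) W).symm) (a j) (b j) =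
          res _ hW g) :
    M.IsCoherent := by
  let G := fun n : ℤ => (Scheme.Modules.pushforward (tw σ n)).obj (M.G n)
  refine ⟨Limits.biproduct (fun i : S => G i),
    isCoherentSheaf_biproduct fun i => isCoherentSheaf_pushforward (hS i i.2), sumProj G S,
    isLocallyFiniteFamily_sumProj, fun d V g x hx => ?_⟩
  have hy : tw σ d (tw σ (-d) x) = x := by
    have := tw_neg_apply σ (-d) x
    rwa [neg_neg] at this
  obtain ⟨W, hW, hyW, r, i, m, hm, a, b, hab⟩ := h d _ g (tw σ (-d) x) (by
    change tw σ d (tw σ (-d) x) ∈ V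
    rwa [hy])
  have hWV : tw σ (-d) ⁻¹ᵁ W ≤ V := by
    rw [← tw_neg_preimage σ d V]
    exact (tw σ (-d)).preimage_mono hW
  have e1 : ∀ j, tw σ (m j) ⁻¹ᵁ tw σ (-d) ⁻¹ᵁ W = tw σ (-(i j)) ⁻¹ᵁ W := fun j =>
    (tw_preimage σ (by have := hm j; omega) W).symm
  have e2 : ∀ j, tw σ (i j) ⁻¹ᵁ tw σ (m j) ⁻¹ᵁ tw σ (-d) ⁻¹ᵁ W = W := fun j => by
    rw [e1, tw_preimage_neg]
  have e3 : tw σ d ⁻¹ᵁ tw σ (-d) ⁻¹ᵁ W = W := tw_preimage_neg σ d W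
  refine ⟨_, hWV, hyW, r, m, fun j => sumIncl (G := G) (i j) _ (res _ (e2 j).le (a j)),
    fun j => res _ (e1 j).le (b j), ?_, fun n hn => Finset.sum_eq_zero fun j _ => ?_⟩
  · have h1 := congrArg (res _ e3.le) hab
    rw [map_sum, res_res] at h1
    refine Eq.trans (Finset.sum_congr rfl fun j _ => ?_) h1
    refine (M.component_eq (sumProj G S) _ (hm j) _ _
      (sumProj_sumIncl_self (G := G) (i j) _ _)).trans ?_
    exact ((M.act (hm j)).toFun_res _ _ _ _ _ _).trans ((M.act (hm j)).res_toFun _ _ _ _ _).symm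
  · exact M.component_eq_zero _ _ _ _ _ _ (sumProj_sumIncl_ne (G := G) (i j)
      (by have := hm j; omega) _ _)

/-- A graded left module is coherent if it is generated, locally, by finitely many of its
components and these are coherent. -/
theorem LeftModule.isCoherent_of_generated (M : LeftModule B) (S : Finset ℤ)
    (hS : ∀ i ∈ S, IsCoherentSheaf (M.G i))
    (h : ∀ (d : ℤ) (U : X.Opens) (g : Γ(M.G d, U)), ∀ x ∈ U, ∃ (W : X.Opens) (hW : W ≤ U), x ∈ W ∧
      ∃ (r : ℕ) (i : Fin r → S) (m : Fin r → ℕ) (hm : ∀ j, (m j : ℤ) + i j = d)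
        (b : ∀ j, Γ(B.E (m j), W)) (a : ∀ j, Γ(M.G (i j), tw σ (-(m j : ℤ)) ⁻¹ᵁ W)),
        ∑ j, (M.act (hm j)).toFun le_rfl (le_of_eq (tw_preimage_neg σ (m j) W).symm) (b j) (a j) =
          res _ hW g) :
    M.IsCoherent := by
  refine ⟨Limits.biproduct (fun i : S => M.G i), isCoherentSheaf_biproduct fun i => hS i i.2,
    sumProj M.G S, isLocallyFiniteFamily_sumProj, fun d V g x hx => ?_⟩
  obtain ⟨W, hW, hxW, r, i, m, hm, b, a, hab⟩ := h d V g x hx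
  refine ⟨W, hW, hxW, r, m, b, fun j => sumIncl (G := M.G) (i j) _ (a j), ?_,
    fun n hn => Finset.sum_eq_zero fun j _ => ?_⟩
  · refine Eq.trans (Finset.sum_congr rfl fun j _ => ?_) hab
    rw [M.component_eq (sumProj M.G S) _ (hm j) _ _ (sumProj_sumIncl_self (G := M.G) (i j) _ _)]
  · exact M.component_eq_zero _ _ _ _ _ _ (sumProj_sumIncl_ne (G := M.G) (i j)
      (by have := hm j; omega) _ _)

/-! ### Right ideals as sequences of ideal sheaves -/

section Ipow

variable {σ : Aut X} {I : X.IdealSheafData} {K : ℕ → X.IdealSheafData}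

lemma Ipow_one : Ipow σ I 1 = I := by
  change ⊤ * I.comap (tw σ (0 : ℕ)) = I
  rw [Nat.cast_zero, comap_tw_zero]
  simp

/-- The recursion for the twists of `I_m`. -/
lemma Ipow_succ_comap (n m : ℕ) : (Ipow σ I (m + 1)).comap (tw σ n) =
    (Ipow σ I m).comap (tw σ n) * I.comap (tw σ ((n + m : ℕ) : ℤ)) := by
  rw [Ipow, comap_mul, comap_tw_comap_tw σ I (k := ((n + m : ℕ) : ℤ)) (by push_cast; ring)]

lemma mul_Ipow_comap_le (hK : ∀ n : ℕ, K n * I.comap (tw σ n) ≤ K (n + 1)) (n m : ℕ) :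
    K n * (Ipow σ I m).comap (tw σ n) ≤ K (n + m) := by
  induction m with
  | zero => simp [Ipow]
  | succ m ih =>
    rw [Ipow_succ_comap, ← mul_assoc]
    exact (mul_le_mul_left ih _).trans (hK (n + m))

lemma mul_Ipow_comap_eq {N : ℕ} (hK : ∀ n ≥ N, K (n + 1) = K n * I.comap (tw σ n)) {n : ℕ}
    (hn : N ≤ n) (m : ℕ) : K (n + m) = K n * (Ipow σ I m).comap (tw σ n) := by
  induction m with
  | zero => simp [Ipow]
  | succ m ih => rw [Ipow_succ_comap, ← mul_assoc, ← ih, ← hK (n + m) (by omega)]; rfl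

end Ipow

variable {σ : Aut X} {c : X} {hc : IsClosed {c}} {L : X.Modules}

/-- The multiplication of `rees` is that of the twisted algebra. -/
lemma val_rees_mul {n m : ℕ} {U V W : X.Opens} (hU : W ≤ U) (hV : W ≤ tw σ n ⁻¹ᵁ V)
    (a : Γ((rees σ c hc L).E n, U)) (b : Γ((rees σ c hc L).E m, V)) :
    (idealMul (Ipow σ (pointIdeal c hc) (n + m)) (Lpow σ L (n + m))).val
        (((rees σ c hc L).mul rfl).toFun hU hV a b) =
      (Lmul σ L n m).toFun hU hV ((idealMul (Ipow σ (pointIdeal c hc) n) (Lpow σ L n)).val a)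
        ((idealMul (Ipow σ (pointIdeal c hc) m) (Lpow σ L m)).val b) := rfl

namespace RightIdeal

variable (J : RightIdeal (rees σ c hc L))

/-- The inclusion of the degree `n` part of a right ideal in `L_n`, on sections. -/
def toLpow (n : ℕ) (U : X.Opens) : Γ(J.G n, U) →ₗ[Γ(X, U)] Γ(Lpow σ L n, U) where
  toFun s := (idealMul (Ipow σ (pointIdeal c hc) n) (Lpow σ L n)).val ((J.incl n).app U s)
  map_add' s t := by
    rw [map_add]
    exact Subsheaf.val_add _ _ _
  map_smul' r s := by
    rw [Scheme.Modules.Hom.app_smul]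
    exact Subsheaf.val_smul _ _ _

lemma toLpow_res (n : ℕ) {U V : X.Opens} (h : V ≤ U) (s : Γ(J.G n, U)) :
    J.toLpow n V (res _ h s) = res _ h (J.toLpow n U s) :=
  congrArg (idealMul (Ipow σ (pointIdeal c hc) n) (Lpow σ L n)).val (app_res (J.incl n) h s)

lemma toLpow_injective (n : ℕ) (U : X.Opens) : Function.Injective (J.toLpow n U) :=
  (Subsheaf.val_injective _).comp (J.incl_injective n U)

lemma toLpow_act {n m : ℕ} {U V W : X.Opens} (hU : W ≤ U) (hV : W ≤ tw σ n ⁻¹ᵁ V)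
    (a : Γ(J.G n, U)) (b : Γ((rees σ c hc L).E m, V)) :
    J.toLpow (n + m) W ((J.act (Nat.cast_add n m).symm).toFun hU hV a b) =
      (Lmul σ L n m).toFun hU hV (J.toLpow n U a)
        ((idealMul (Ipow σ (pointIdeal c hc) m) (Lpow σ L m)).val b) :=
  (congrArg (idealMul (Ipow σ (pointIdeal c hc) (n + m)) (Lpow σ L (n + m))).val
    (J.incl_act rfl hU hV a b)).trans (val_rees_mul hU hV _ b)

/-- The right ideal `J` is `⨁ K_n L_n`. -/
def IsDefinedBy (K : ℕ → X.IdealSheafData) : Prop :=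
  ∀ n U, LinearMap.range (J.toLpow n U) = (idealMul (K n) (Lpow σ L n)).obj U

variable {J} {K : ℕ → X.IdealSheafData}

lemma IsDefinedBy.le_Ipow (hJ : J.IsDefinedBy K) (hL : IsInvertible L) (n : ℕ) :
    K n ≤ Ipow σ (pointIdeal c hc) n :=
  (hL.Lpow σ n).le_of_idealMul_le fun U => by
    rw [← hJ]
    rintro _ ⟨s, rfl⟩
    exact Subsheaf.val_mem _ _

/-- Sections of `K_n I_m^{σ^n} L_{n+m}` are locally sums of products of elements of `J` of degree
`n` and elements of the algebra of degree `m`. -/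
lemma IsDefinedBy.exists_sum (hJ : J.IsDefinedBy K) (hL : IsInvertible L) {n m : ℕ} {W : X.Opens}
    {s : Γ(Lpow σ L (n + m), W)} (hs : s ∈ (idealMul
      (K n * (Ipow σ (pointIdeal c hc) m).comap (tw σ n)) (Lpow σ L (n + m))).obj W) {x : X}
    (hx : x ∈ W) :
    ∃ (W' : X.Opens) (hW : W' ≤ W), x ∈ W' ∧ ∃ (r : ℕ) (a : Fin r → Γ(J.G n, W'))
      (b : Fin r → Γ((rees σ c hc L).E m, tw σ (-n) ⁻¹ᵁ W')),
      J.toLpow (n + m) W' (∑ j, (J.act (Nat.cast_add n m).symm).toFun le_rfl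
        (le_of_eq (tw_preimage_neg σ n W').symm) (a j) (b j)) = res _ hW s := by
  obtain ⟨W', hW, hxW, h⟩ := exists_mem_closure_Lmul hL σ (K n) (Ipow σ (pointIdeal c hc) m) n m
    hs hx
  obtain ⟨r, t, ht, hsum⟩ :=
    exists_fin_sum_of_mem_closure (h (le_of_eq (tw_preimage_neg σ n W').symm))
  choose a ha b hb hab using ht
  have ha' : ∀ j, ∃ a', J.toLpow n W' a' = a j := fun j => (hJ n W').ge (ha j)
  choose a' ha' using ha'
  refine ⟨W', hW, hxW, r, a', fun j => Subsheaf.lift _ (b j) (hb j), ?_⟩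
  rw [map_sum, ← hsum]
  refine Finset.sum_congr rfl fun j _ => ?_
  refine (J.toLpow_act _ _ (a' j) _).trans ?_
  rw [ha', hab]
  rfl

lemma IsDefinedBy.mul_le (hJ : J.IsDefinedBy K) (hL : IsInvertible L) (n : ℕ) :
    K n * (pointIdeal c hc).comap (tw σ n) ≤ K (n + 1) :=
  (hL.Lpow σ (n + 1)).le_of_idealMul_le fun U s hs => by
    refine Subsheaf.mem_of_local _ s fun x hx => ?_
    rw [← Ipow_one (σ := σ) (I := pointIdeal c hc)] at hs
    obtain ⟨W, hW, hxW, r, a, b, h⟩ := hJ.exists_sum hL hs hx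
    exact ⟨W, hW, hxW, h ▸ (hJ (n + 1) W).le ⟨_, rfl⟩⟩

variable (J) in
/-- Every ideal is defined by ideal sheaves, as its components are quasi-coherent subsheaves of
the invertible sheaves `L_n`. -/
lemma exists_isDefinedBy (hL : IsInvertible L) : ∃ K, J.IsDefinedBy K := by
  have (n : ℕ) := (hL.Lpow σ n).exists_eq_idealMul
    (imageSubsheaf (J.toLpow n) (J.toLpow_res n) (J.toLpow_injective n))
    (isQuasicoherentSheaf_imageSubsheaf _ _ _ (J.quasicoherent n))
  choose K hK using this
  exact ⟨K, hK⟩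

/-- Right ideals defined by sequences with `K_{n+1} = K_n I^{σ^n}` for large `n` are coherent. -/
theorem IsDefinedBy.isCoherent [IsLocallyNoetherian X] (hJ : J.IsDefinedBy K) (hL : IsInvertible L)
    {N : ℕ} (hK : ∀ n ≥ N, K (n + 1) = K n * (pointIdeal c hc).comap (tw σ n)) :
    J.toRightModule.IsCoherent := by
  refine J.toRightModule.isCoherent_of_generated ((Finset.range (N + 1)).image Nat.cast)
    (fun i hi => ?_) fun d U g x hx => ?_
  · obtain ⟨n, -, rfl⟩ := Finset.mem_image.mp hi
    exact isCoherentSheaf_of_range_eq (J.toLpow n) (hL.Lpow σ n) (J.quasicoherent n)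
      (J.toLpow_injective n) (K n) (hJ n)
  · rcases lt_or_ge d 0 with hd | hd
    · have hg := isZero_iff.mp (J.isZero_of_neg d hd) U g
      exact ⟨U, le_rfl, hx, 0, Fin.elim0, Fin.elim0, fun j => j.elim0, fun j => j.elim0,
        fun j => j.elim0, by simp [hg]⟩
    · obtain ⟨i, m, hi, rfl, hK'⟩ : ∃ i m : ℕ, i ≤ N ∧ d = ((i + m : ℕ) : ℤ) ∧
          K (i + m) = K i * (Ipow σ (pointIdeal c hc) m).comap (tw σ i) := by
        lift d to ℕ using hd
        rcases le_total d N with h | h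
        · exact ⟨d, 0, h, rfl, by simp [Ipow]⟩
        · exact ⟨N, d - N, le_rfl, by rw [Nat.add_sub_cancel' h], mul_Ipow_comap_eq hK le_rfl _⟩
      have hs := (hJ (i + m) U).le ⟨g, rfl⟩
      rw [hK'] at hs
      obtain ⟨W, hW, hxW, r, a, b, hab⟩ := hJ.exists_sum hL hs hx
      refine ⟨W, hW, hxW, r,
        fun _ => ⟨i, Finset.mem_image.mpr ⟨i, Finset.mem_range.mpr (by omega), rfl⟩⟩,
        fun _ => m, fun _ => (Nat.cast_add i m).symm, a, b, J.toLpow_injective (i + m) W ?_⟩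
      rw [J.toLpow_res]
      exact hab

/-- If `J` is coherent, then `K_{n+1} = K_n I^{σ^n}` for large `n`. -/
theorem IsDefinedBy.exists_le_mul [CompactSpace X] (hJ : J.IsDefinedBy K) (hL : IsInvertible L)
    (hcoh : J.toRightModule.IsCoherent) :
    ∃ N, ∀ n ≥ N, K (n + 1) ≤ K n * (pointIdeal c hc).comap (tw σ n) := by
  obtain ⟨F, hF, θ, hθ, hgen⟩ := hcoh
  obtain ⟨b, hb⟩ := hθ.exists_forall_eq_zero hF
  refine ⟨b.toNat, fun n hn => (hL.Lpow σ (n + 1)).le_of_idealMul_le fun U s hs => ?_⟩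
  obtain ⟨g, rfl⟩ := (hJ (n + 1) U).ge hs
  refine Subsheaf.mem_of_local _ _ fun x hx => ?_
  have eU := tw_preimage_neg σ ((n + 1 : ℕ) : ℤ) U
  obtain ⟨W, hW, hxW, r, m, t, e, hsum, -⟩ := hgen ((n + 1 : ℕ) : ℤ)
    (tw σ (-((n + 1 : ℕ) : ℤ)) ⁻¹ᵁ U) (res _ eU.le g) (tw σ ((n + 1 : ℕ) : ℤ) x) (by
      rw [← Scheme.Hom.mem_preimage, eU]
      exact hx)
  have hWU : tw σ ((n + 1 : ℕ) : ℤ) ⁻¹ᵁ W ≤ U := ((tw σ _).preimage_mono hW).trans eU.le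
  refine ⟨_, hWU, hxW, ?_⟩
  rw [res_res] at hsum
  rw [← J.toLpow_res, ← hsum, map_sum]
  refine Submodule.sum_mem _ fun j _ => ?_
  -- each summand is a product of an element of `J` and an element of degree `m j`: it vanishes if
  -- `m j = 0`, as `θ (n + 1) = 0`, or if `m j > n + 1`, and otherwise it has a factor `I^{σ^n}`
  generalize t j = t', e j = e'
  generalize m j = m' at t' e'
  cases m' with
  | zero =>
    rw [RightModule.component_eq_zero, map_zero]
    · exact zero_mem _
    · refine hb _ ?_ _ _
      push_cast
      omega
  | succ m' =>
    rcases le_or_gt m' n with h | h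
    · obtain ⟨i, rfl⟩ := Nat.exists_eq_add_of_le' h
      rw [RightModule.component_eq J.toRightModule θ W (i := i) (by push_cast; ring) t' e' rfl]
      refine (J.toLpow_act (n := i) (m := m' + 1) _ _ _ _) ▸ Pairing.mem_idealMul
        (Lmul σ L i (m' + 1)) (K i) (Ipow σ (pointIdeal c hc) (m' + 1)) _ ?_ _ _
        ((hJ i _).le ⟨_, rfl⟩) (Subsheaf.val_mem _ _)
      rw [Ipow_succ_comap, ← mul_assoc]
      exact mul_le_mul_left (mul_Ipow_comap_le (hJ.mul_le hL) _ _) _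
    · rw [RightModule.component_eq_zero, map_zero]
      · exact zero_mem _
      · exact isZero_iff.mp (J.isZero_of_neg (((n + 1 : ℕ) : ℤ) - ((m' + 1 : ℕ) : ℤ))
          (by push_cast; omega)) (tw σ _ ⁻¹ᵁ tw σ _ ⁻¹ᵁ W) _

end RightIdeal

/-! ### Ideals given by subsheaves -/

/-- The zero subsheaf. -/
def Subsheaf.zero (M : X.Modules) : Subsheaf M where
  obj _ := ⊥
  res_mem h s hs := by
    rw [Submodule.mem_bot] at hs ⊢
    rw [hs, map_zero]
  mem_of_local s hs := eq_of_locally M fun x hx => by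
    obtain ⟨V, hV, hxV, h⟩ := hs x hx
    exact ⟨V, hV, hxV, by rw [(Submodule.mem_bot _).mp h, map_zero]⟩

lemma Subsheaf.zero_eq_zero (M : X.Modules) {U : X.Opens} (s : Γ((Subsheaf.zero M).toModules, U)) :
    s = 0 :=
  (Subsheaf.zero M).val_injective ((Submodule.mem_bot _).mp ((Subsheaf.zero M).val_mem s))

lemma isQuasicoherentSheaf_zero (M : X.Modules) :
    IsQuasicoherentSheaf (Subsheaf.zero M).toModules :=
  isQuasicoherentSheaf_of_isLocalizingOn fun x => by
    obtain ⟨U, hx, -⟩ := exists_affine (x := x) (U := ⊤) trivial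
    refine ⟨U.1, U.2, hx, fun f => ⟨fun s => ⟨0, 0, ?_⟩, fun t _ => ⟨0, Subsheaf.zero_eq_zero _ _⟩⟩⟩
    exact (Subsheaf.zero_eq_zero M _).trans (Subsheaf.zero_eq_zero M _).symm

/-- The zero pairing. -/
def Pairing.zero (τ : X ⟶ X) (M N P : X.Modules) : Pairing τ M N P where
  toFun _ _ _ _ := 0
  add_left _ _ _ _ _ := (add_zero 0).symm
  add_right _ _ _ _ _ := (add_zero 0).symm
  smul_left _ _ _ _ _ := (smul_zero _).symm
  smul_right _ _ _ _ _ := (smul_zero _).symm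
  res_toFun _ _ _ _ _ := map_zero _
  toFun_res _ _ _ _ _ _ := rfl

/-- The inclusion of a subsheaf in a larger one. -/
def Subsheaf.inclusion {M : X.Modules} (S T : Subsheaf M) (h : ∀ U, S.obj U ≤ T.obj U) :
    S.toModules ⟶ T.toModules :=
  homOfSections (fun U =>
    { toFun := fun s => T.lift (S.val s) (h U (S.val_mem s))
      map_add' := fun _ _ => rfl
      map_smul' := fun _ _ => rfl }) fun _ _ => rfl

variable {σ : Aut X} {A : GradedBimoduleAlgebra σ}

/-- The extension by zero to negative degrees of a sequence of subsheaves. -/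
def gradedPart (S : ∀ n : ℕ, Subsheaf (A.E n)) : ℤ → X.Modules
  | .ofNat n => (S n).toModules
  | .negSucc _ => (Subsheaf.zero (A.E 0)).toModules

lemma gradedPart_negSucc (S : ∀ n : ℕ, Subsheaf (A.E n)) {n : ℕ} {U : X.Opens}
    (s : Γ(gradedPart S (.negSucc n), U)) : s = 0 :=
  Subsheaf.zero_eq_zero _ s

variable (T : ∀ n, Subsheaf (A.E n)) (hT : ∀ U, (T 0).obj U = ⊤)
  (H : ∀ {n m k : ℕ} (h : n + m = k) {U V W : X.Opens} (hU : W ≤ U) (hV : W ≤ tw σ n ⁻¹ᵁ V),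
    ∀ a ∈ (T n).obj U, ∀ b ∈ (T m).obj V, (A.mul h).toFun hU hV a b ∈ (T k).obj W)
  (S : ∀ n : ℕ, Subsheaf (A.E n)) (hqc : ∀ n, IsQuasicoherentSheaf (S n).toModules)
  (hST : ∀ n U, (S n).obj U ≤ (T n).obj U)

lemma isQuasicoherentSheaf_gradedPart (hqc : ∀ n, IsQuasicoherentSheaf (S n).toModules) :
    ∀ n, IsQuasicoherentSheaf (gradedPart S n)
  | .ofNat n => hqc n
  | .negSucc _ => isQuasicoherentSheaf_zero _

section right

variable (hS : ∀ {n m k : ℕ} (h : n + m = k) {U V W : X.Opens} (hU : W ≤ U)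
    (hV : W ≤ tw σ n ⁻¹ᵁ V), ∀ a ∈ (S n).obj U, ∀ b ∈ (T m).obj V,
      (A.mul h).toFun hU hV a b ∈ (S k).obj W)

/-- The right action on subsheaves. -/
def rightAct (m : ℕ) : ∀ n k : ℤ, n + m = k →
    Pairing (tw σ n) (gradedPart S n) (T m).toModules (gradedPart S k)
  | .ofNat n, .ofNat k, h =>
    (A.mul (show n + m = k from Int.ofNat.inj h)).restrict (S n) (T m) (S k) (hS _)
  | .ofNat _, .negSucc _, _ => Pairing.zero _ _ _ _
  | .negSucc _, _, _ => Pairing.zero _ _ _ _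

/-- The right ideal given by quasi-coherent subsheaves closed under right multiplication. -/
def rightIdealOfSubsheaves : RightIdeal (A.sub T hT H) where
  G := gradedPart S
  quasicoherent := isQuasicoherentSheaf_gradedPart S hqc
  act {n m k} h := rightAct T S hS m n k h
  act_one {n U W} hU a := by
    cases n with
    | ofNat n => exact (S n).val_injective (A.mul_one hU _)
    | negSucc n => exact (gradedPart_negSucc S _).trans (gradedPart_negSucc S _).symm
  act_mul {n m p i j k} h₁ h₂ h₃ h₄ U V W U' V' Z hU hV hU' hW hV' hW' hZ hZ' a b c := by
    cases n with
    | ofNat n =>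
      obtain rfl : i = .ofNat (n + m) := h₁.symm
      obtain rfl : k = .ofNat (n + j) := h₄.symm
      exact (S _).val_injective (A.mul_assoc rfl (Int.ofNat.inj h₂) h₃ rfl hU hV hU' hW hV' hW'
        hZ hZ' _ _ _)
    | negSucc n =>
      rw [gradedPart_negSucc S a]
      refine (congrArg (fun y => (rightAct T S hS p i k h₂).toFun hU' hW y c)
        (Pairing.toFun_zero_left (rightAct T S hS m _ i h₁) hU hV b)).trans ?_
      exact (Pairing.toFun_zero_left _ _ _ _).trans (Pairing.toFun_zero_left _ _ _ _).symm
  isZero_of_neg n hn := by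
    obtain ⟨n, rfl⟩ := Int.eq_negSucc_of_lt_zero hn
    exact isZero_iff.mpr fun U s => gradedPart_negSucc S s
  incl n := (S n).inclusion (T n) (hST n)
  incl_injective n U s t h := (S n).val_injective (congrArg (T n).val h)
  incl_act h _ _ _ _ _ _ _ := rfl

/-- Quasi-coherent subsheaves closed under right multiplication are a right ideal. -/
lemma exists_rightIdeal_mem_iff (hqc : ∀ n, IsQuasicoherentSheaf (S n).toModules)
    (hST : ∀ n U, (S n).obj U ≤ (T n).obj U)
    (hS : ∀ {n m k : ℕ} (h : n + m = k) {U V W : X.Opens} (hU : W ≤ U)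
      (hV : W ≤ tw σ n ⁻¹ᵁ V), ∀ a ∈ (S n).obj U, ∀ b ∈ (T m).obj V,
        (A.mul h).toFun hU hV a b ∈ (S k).obj W) :
    ∃ J : RightIdeal (A.sub T hT H), ∀ (n : ℕ) (U : X.Opens)
    (t : Γ((T n).toModules, U)),
    (∃ s : Γ(J.G n, U), (J.incl n).app U s = t) ↔ (T n).val t ∈ (S n).obj U := by
  refine ⟨rightIdealOfSubsheaves T hT H S hqc hST hS, fun n U t => ⟨?_, fun ht => ?_⟩⟩
  · rintro ⟨s, rfl⟩
    exact (S n).val_mem s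
  · exact ⟨(S n).lift _ ht, (T n).val_injective rfl⟩

end right

section left

variable (hS : ∀ {m n k : ℕ} (h : m + n = k) {U V W : X.Opens} (hU : W ≤ U)
    (hV : W ≤ tw σ m ⁻¹ᵁ V), ∀ b ∈ (T m).obj U, ∀ a ∈ (S n).obj V,
      (A.mul h).toFun hU hV b a ∈ (S k).obj W)

/-- The left action on subsheaves. -/
def leftAct (m : ℕ) : ∀ n k : ℤ, m + n = k →
    Pairing (tw σ m) (T m).toModules (gradedPart S n) (gradedPart S k)
  | .ofNat n, .ofNat k, h =>
    (A.mul (show m + n = k from Int.ofNat.inj h)).restrict (T m) (S n) (S k) (hS _)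
  | .ofNat _, .negSucc _, _ => Pairing.zero _ _ _ _
  | .negSucc _, _, _ => Pairing.zero _ _ _ _

/-- The left ideal given by quasi-coherent subsheaves closed under left multiplication. -/
def leftIdealOfSubsheaves : LeftIdeal (A.sub T hT H) where
  G := gradedPart S
  quasicoherent := isQuasicoherentSheaf_gradedPart S hqc
  act {m n k} h := leftAct T S hS m n k h
  one_act {n V W} hV hV' a := by
    cases n with
    | ofNat n =>
      refine (S n).val_injective (Eq.trans ?_ (A.one_mul hV hV' _))
      rfl
    | negSucc n => exact (gradedPart_negSucc S _).trans (gradedPart_negSucc S _).symm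
  mul_act {m p n i j k} h₁ h₂ h₃ h₄ U V W U' V' Z hU hV hU' hW hV' hW' hZ hZ' b c a := by
    cases n with
    | ofNat n =>
      obtain rfl : j = .ofNat (p + n) := h₃.symm
      obtain rfl : k = .ofNat (i + n) := h₂.symm
      exact (S _).val_injective (A.mul_assoc h₁ rfl rfl (Int.ofNat.inj h₄) hU hV hU' hW hV' hW'
        hZ hZ' _ _ _)
    | negSucc n =>
      rw [gradedPart_negSucc S a]
      refine Eq.trans ?_ (congrArg (fun y => (leftAct T S hS m j k h₄).toFun hZ hZ' b y)
        (Pairing.toFun_zero_right (leftAct T S hS p _ j h₃) hV' hW' c)).symm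
      exact (Pairing.toFun_zero_right _ _ _ _).trans (Pairing.toFun_zero_right _ _ _ _).symm
  isZero_of_neg n hn := by
    obtain ⟨n, rfl⟩ := Int.eq_negSucc_of_lt_zero hn
    exact isZero_iff.mpr fun U s => gradedPart_negSucc S s
  incl n := (S n).inclusion (T n) (hST n)
  incl_injective n U s t h := (S n).val_injective (congrArg (T n).val h)
  incl_act h _ _ _ _ _ _ _ := rfl

/-- Quasi-coherent subsheaves closed under left multiplication are a left ideal. -/
lemma exists_leftIdeal_mem_iff (hqc : ∀ n, IsQuasicoherentSheaf (S n).toModules)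
    (hST : ∀ n U, (S n).obj U ≤ (T n).obj U)
    (hS : ∀ {m n k : ℕ} (h : m + n = k) {U V W : X.Opens} (hU : W ≤ U)
      (hV : W ≤ tw σ m ⁻¹ᵁ V), ∀ b ∈ (T m).obj U, ∀ a ∈ (S n).obj V,
        (A.mul h).toFun hU hV b a ∈ (S k).obj W) :
    ∃ J : LeftIdeal (A.sub T hT H), ∀ (n : ℕ) (U : X.Opens)
    (t : Γ((T n).toModules, U)),
    (∃ s : Γ(J.G n, U), (J.incl n).app U s = t) ↔ (T n).val t ∈ (S n).obj U := by
  refine ⟨leftIdealOfSubsheaves T hT H S hqc hST hS, fun n U t => ⟨?_, fun ht => ?_⟩⟩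
  · rintro ⟨s, rfl⟩
    exact (S n).val_mem s
  · exact ⟨(S n).lift _ ht, (T n).val_injective rfl⟩

end left

/-! ### Left ideals as sequences of ideal sheaves -/

section Ipow

variable {σ : Aut X} {I : X.IdealSheafData} {K : ℕ → X.IdealSheafData}

lemma Ipow_succ' (m : ℕ) : Ipow σ I (m + 1) = I * (Ipow σ I m).comap (tw σ (1 : ℕ)) := by
  rw [add_comm, ← Ipow_mul, Ipow_one]

lemma Ipow_succ_mul_comap (J : X.IdealSheafData) (m : ℕ) :
    Ipow σ I (m + 1) * J.comap (tw σ ((m + 1 : ℕ) : ℤ)) =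
      I * (Ipow σ I m * J.comap (tw σ m)).comap (tw σ (1 : ℕ)) := by
  rw [Ipow_succ', comap_mul, comap_tw_comap_tw σ J (k := ((m + 1 : ℕ) : ℤ)) (by push_cast; ring),
    mul_assoc]

lemma comap_tw_mono {J J' : X.IdealSheafData} (h : J ≤ J') (n : ℤ) :
    J.comap (tw σ n) ≤ J'.comap (tw σ n) :=
  Scheme.IdealSheafData.comap_mono (tw σ n) h

lemma Ipow_mul_comap_le (hK : ∀ n : ℕ, I * (K n).comap (tw σ (1 : ℕ)) ≤ K (n + 1)) (m n : ℕ) :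
    Ipow σ I m * (K n).comap (tw σ m) ≤ K (m + n) := by
  induction m with
  | zero => simp [Ipow, comap_tw_zero]
  | succ m ih =>
    rw [Ipow_succ_mul_comap, show m + 1 + n = m + n + 1 by ring]
    exact (mul_le_mul_right (comap_tw_mono ih _) _).trans (hK (m + n))

lemma Ipow_mul_comap_eq {N : ℕ} (hK : ∀ n ≥ N, K (n + 1) = I * (K n).comap (tw σ (1 : ℕ))) {n : ℕ}
    (hn : N ≤ n) (m : ℕ) : K (m + n) = Ipow σ I m * (K n).comap (tw σ m) := by
  induction m with
  | zero => simp [Ipow, comap_tw_zero]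
  | succ m ih =>
    rw [Ipow_succ_mul_comap, ← ih, show m + 1 + n = m + n + 1 by ring]
    exact hK (m + n) (by omega)

end Ipow

variable {σ : Aut X} {c : X} {hc : IsClosed {c}} {L : X.Modules}

namespace LeftIdeal

variable (J : LeftIdeal (rees σ c hc L))

/-- The inclusion of the degree `n` part of a left ideal in `L_n`, on sections. -/
def toLpow (n : ℕ) (U : X.Opens) : Γ(J.G n, U) →ₗ[Γ(X, U)] Γ(Lpow σ L n, U) where
  toFun s := (idealMul (Ipow σ (pointIdeal c hc) n) (Lpow σ L n)).val ((J.incl n).app U s)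
  map_add' s t := by
    rw [map_add]
    exact Subsheaf.val_add _ _ _
  map_smul' r s := by
    rw [Scheme.Modules.Hom.app_smul]
    exact Subsheaf.val_smul _ _ _

lemma toLpow_res (n : ℕ) {U V : X.Opens} (h : V ≤ U) (s : Γ(J.G n, U)) :
    J.toLpow n V (res _ h s) = res _ h (J.toLpow n U s) :=
  congrArg (idealMul (Ipow σ (pointIdeal c hc) n) (Lpow σ L n)).val (app_res (J.incl n) h s)

lemma toLpow_injective (n : ℕ) (U : X.Opens) : Function.Injective (J.toLpow n U) :=
  (Subsheaf.val_injective _).comp (J.incl_injective n U)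

lemma toLpow_act {m n : ℕ} {U V W : X.Opens} (hU : W ≤ U) (hV : W ≤ tw σ m ⁻¹ᵁ V)
    (b : Γ((rees σ c hc L).E m, U)) (a : Γ(J.G n, V)) :
    J.toLpow (m + n) W ((J.act (Nat.cast_add m n).symm).toFun hU hV b a) =
      (Lmul σ L m n).toFun hU hV
        ((idealMul (Ipow σ (pointIdeal c hc) m) (Lpow σ L m)).val b) (J.toLpow n V a) :=
  (congrArg (idealMul (Ipow σ (pointIdeal c hc) (m + n)) (Lpow σ L (m + n))).val
    (J.incl_act rfl hU hV b a)).trans (val_rees_mul hU hV b _)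

/-- The left ideal `J` is `⨁ K_n L_n`. -/
def IsDefinedBy (K : ℕ → X.IdealSheafData) : Prop :=
  ∀ n U, LinearMap.range (J.toLpow n U) = (idealMul (K n) (Lpow σ L n)).obj U

variable {J} {K : ℕ → X.IdealSheafData}

lemma IsDefinedBy.le_Ipow (hJ : J.IsDefinedBy K) (hL : IsInvertible L) (n : ℕ) :
    K n ≤ Ipow σ (pointIdeal c hc) n :=
  (hL.Lpow σ n).le_of_idealMul_le fun U => by
    rw [← hJ]
    rintro _ ⟨s, rfl⟩
    exact Subsheaf.val_mem _ _

/-- Sections of `I_m K_n^{σ^m} L_{m+n}` are locally sums of products of elements of the algebra of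
degree `m` and elements of `J` of degree `n`. -/
lemma IsDefinedBy.exists_sum (hJ : J.IsDefinedBy K) (hL : IsInvertible L) {m n : ℕ} {W : X.Opens}
    {s : Γ(Lpow σ L (m + n), W)} (hs : s ∈ (idealMul
      (Ipow σ (pointIdeal c hc) m * (K n).comap (tw σ m)) (Lpow σ L (m + n))).obj W) {x : X}
    (hx : x ∈ W) :
    ∃ (W' : X.Opens) (hW : W' ≤ W), x ∈ W' ∧ ∃ (r : ℕ) (b : Fin r → Γ((rees σ c hc L).E m, W'))
      (a : Fin r → Γ(J.G n, tw σ (-m) ⁻¹ᵁ W')),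
      J.toLpow (m + n) W' (∑ j, (J.act (Nat.cast_add m n).symm).toFun le_rfl
        (le_of_eq (tw_preimage_neg σ m W').symm) (b j) (a j)) = res _ hW s := by
  obtain ⟨W', hW, hxW, h⟩ := exists_mem_closure_Lmul hL σ (Ipow σ (pointIdeal c hc) m) (K n) m n
    hs hx
  obtain ⟨r, t, ht, hsum⟩ :=
    exists_fin_sum_of_mem_closure (h (le_of_eq (tw_preimage_neg σ m W').symm))
  choose b hb a ha hab using ht
  have ha' : ∀ j, ∃ a', J.toLpow n _ a' = a j := fun j => (hJ n _).ge (ha j)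
  choose a' ha' using ha'
  refine ⟨W', hW, hxW, r, fun j => Subsheaf.lift _ (b j) (hb j), a', ?_⟩
  rw [map_sum, ← hsum]
  refine Finset.sum_congr rfl fun j _ => ?_
  refine (J.toLpow_act _ _ _ (a' j)).trans ?_
  rw [ha', hab]
  rfl

lemma IsDefinedBy.mul_le (hJ : J.IsDefinedBy K) (hL : IsInvertible L) (n : ℕ) :
    pointIdeal c hc * (K n).comap (tw σ (1 : ℕ)) ≤ K (n + 1) := by
  rw [add_comm]
  exact (hL.Lpow σ (1 + n)).le_of_idealMul_le fun U s hs => by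
    refine Subsheaf.mem_of_local _ s fun x hx => ?_
    nth_rw 1 [← Ipow_one (σ := σ) (I := pointIdeal c hc)] at hs
    obtain ⟨W, hW, hxW, r, a, b, h⟩ := hJ.exists_sum hL hs hx
    exact ⟨W, hW, hxW, h ▸ (hJ (1 + n) W).le ⟨_, rfl⟩⟩

variable (J) in
/-- Every ideal is defined by ideal sheaves, as its components are quasi-coherent subsheaves of
the invertible sheaves `L_n`. -/
lemma exists_isDefinedBy (hL : IsInvertible L) : ∃ K, J.IsDefinedBy K := by
  have (n : ℕ) := (hL.Lpow σ n).exists_eq_idealMul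
    (imageSubsheaf (J.toLpow n) (J.toLpow_res n) (J.toLpow_injective n))
    (isQuasicoherentSheaf_imageSubsheaf _ _ _ (J.quasicoherent n))
  choose K hK using this
  exact ⟨K, hK⟩

/-- Left ideals defined by sequences with `K_{n+1} = I K_n^σ` for large `n` are coherent. -/
theorem IsDefinedBy.isCoherent [IsLocallyNoetherian X] (hJ : J.IsDefinedBy K) (hL : IsInvertible L)
    {N : ℕ} (hK : ∀ n ≥ N, K (n + 1) = pointIdeal c hc * (K n).comap (tw σ (1 : ℕ))) :
    J.toLeftModule.IsCoherent := by
  refine J.toLeftModule.isCoherent_of_generated ((Finset.range (N + 1)).image Nat.cast)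
    (fun i hi => ?_) fun d U g x hx => ?_
  · obtain ⟨n, -, rfl⟩ := Finset.mem_image.mp hi
    exact isCoherentSheaf_of_range_eq (J.toLpow n) (hL.Lpow σ n) (J.quasicoherent n)
      (J.toLpow_injective n) (K n) (hJ n)
  · rcases lt_or_ge d 0 with hd | hd
    · have hg := isZero_iff.mp (J.isZero_of_neg d hd) U g
      exact ⟨U, le_rfl, hx, 0, Fin.elim0, Fin.elim0, fun j => j.elim0, fun j => j.elim0,
        fun j => j.elim0, by simp [hg]⟩
    · obtain ⟨i, m, hi, rfl, hK'⟩ : ∃ i m : ℕ, i ≤ N ∧ d = ((m + i : ℕ) : ℤ) ∧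
          K (m + i) = Ipow σ (pointIdeal c hc) m * (K i).comap (tw σ m) := by
        lift d to ℕ using hd
        rcases le_total d N with h | h
        · exact ⟨d, 0, h, by simp, by simp [Ipow, comap_tw_zero]⟩
        · exact ⟨N, d - N, le_rfl, by rw [Nat.sub_add_cancel h], Ipow_mul_comap_eq hK le_rfl _⟩
      have hs := (hJ (m + i) U).le ⟨g, rfl⟩
      rw [hK'] at hs
      obtain ⟨W, hW, hxW, r, b, a, hab⟩ := hJ.exists_sum hL hs hx
      refine ⟨W, hW, hxW, r,
        fun _ => ⟨i, Finset.mem_image.mpr ⟨i, Finset.mem_range.mpr (by omega), rfl⟩⟩,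
        fun _ => m, fun _ => (Nat.cast_add m i).symm, b, a, J.toLpow_injective (m + i) W ?_⟩
      rw [J.toLpow_res]
      exact hab

/-- If `J` is coherent, then `K_{n+1} = I K_n^σ` for large `n`. -/
theorem IsDefinedBy.exists_le_mul [CompactSpace X] (hJ : J.IsDefinedBy K) (hL : IsInvertible L)
    (hcoh : J.toLeftModule.IsCoherent) :
    ∃ N, ∀ n ≥ N, K (n + 1) ≤ pointIdeal c hc * (K n).comap (tw σ (1 : ℕ)) := by
  obtain ⟨F, hF, θ, hθ, hgen⟩ := hcoh
  obtain ⟨b, hb⟩ := hθ.exists_forall_eq_zero hF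
  refine ⟨b.toNat, fun n hn => (hL.Lpow σ (n + 1)).le_of_idealMul_le fun U s hs => ?_⟩
  obtain ⟨g, rfl⟩ := (hJ (n + 1) U).ge hs
  refine Subsheaf.mem_of_local _ _ fun x hx => ?_
  obtain ⟨W, hW, hxW, r, m, e, t, hsum, -⟩ := hgen ((n + 1 : ℕ) : ℤ) U g x hx
  refine ⟨W, hW, hxW, ?_⟩
  rw [← J.toLpow_res, ← hsum, map_sum]
  refine Submodule.sum_mem _ fun j _ => ?_
  -- each summand is a product of an element of degree `m j` and an element of `J`: it vanishes if
  -- `m j = 0`, as `θ (n + 1) = 0`, or if `m j > n + 1`, and otherwise it has a factor `I`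
  generalize t j = t', e j = e'
  generalize m j = m' at t' e'
  cases m' with
  | zero =>
    rw [LeftModule.component_eq_zero, map_zero]
    · exact zero_mem _
    · refine hb _ ?_ _ _
      push_cast
      omega
  | succ m' =>
    rcases le_or_gt m' n with h | h
    · obtain ⟨i, rfl⟩ := Nat.exists_eq_add_of_le h
      have hi : m' + 1 + i = m' + i + 1 := by ring
      have key : ∀ (k : ℕ) (_ : m' + 1 + i = k), J.toLpow k W
          (J.component θ (k : ℤ) W (m' + 1) e' t') ∈ (idealMul (Ipow σ (pointIdeal c hc) (m' + 1) *
            (K i).comap (tw σ ((m' + 1 : ℕ) : ℤ))) (Lpow σ L k)).obj W := by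
        rintro _ rfl
        rw [LeftModule.component_eq J.toLeftModule θ W (i := i) (by push_cast; ring) e' t' rfl]
        exact (J.toLpow_act (n := i) (m := m' + 1) _ _ _ _) ▸
          Pairing.mem_idealMul (Lmul σ L (m' + 1) i) (Ipow σ (pointIdeal c hc) (m' + 1)) (K i) _
            le_rfl _ _ (Subsheaf.val_mem _ _) ((hJ i _).le ⟨_, rfl⟩)
      refine idealMul_mono ?_ _ _ (key _ hi)
      rw [Ipow_succ_mul_comap]
      exact mul_le_mul_right (comap_tw_mono (Ipow_mul_comap_le (hJ.mul_le hL) _ _) _) _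
    · rw [LeftModule.component_eq_zero, map_zero]
      · exact zero_mem _
      · exact isZero_iff.mp (J.isZero_of_neg (((n + 1 : ℕ) : ℤ) - ((m' + 1 : ℕ) : ℤ))
          (by push_cast; omega)) (tw σ _ ⁻¹ᵁ W) _

end LeftIdeal

/-! ### The orbit of the point -/

lemma isClosed_tw (σ : Aut X) {c : X} (hc : IsClosed {c}) (n : ℤ) : IsClosed {tw σ n c} := by
  have : ({tw σ n c} : Set X) = tw σ (-n) ⁻¹' {c} := by
    ext x
    simp only [Set.mem_singleton_iff, Set.mem_preimage]
    constructor
    · rintro rfl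
      exact tw_neg_apply σ n c
    · rintro rfl
      have := tw_neg_apply σ (-n) x
      rwa [neg_neg, eq_comm] at this
  rw [this]
  exact hc.preimage (tw σ (-n)).continuous

lemma comap_pointIdeal_le (σ : Aut X) (n : ℤ) {p q : X} (hp : IsClosed {p}) (hq : IsClosed {q})
    (h : tw σ n q = p) : (pointIdeal p hp).comap (tw σ n) ≤ pointIdeal q hq := by
  rw [← Scheme.IdealSheafData.le_map_iff_comap_le, pointIdeal, pointIdeal,
    Scheme.IdealSheafData.map_vanishingIdeal]
  refine Scheme.IdealSheafData.vanishingIdeal_antimono ?_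
  rw [TopologicalSpace.Closeds.closure_le]
  rintro _ ⟨x, hx, rfl⟩
  rw [Set.mem_singleton_iff.mp hx, h]
  rfl

/-- The inverse image of the ideal sheaf of a closed point. -/
lemma comap_pointIdeal (σ : Aut X) (n : ℤ) {p q : X} (hp : IsClosed {p}) (hq : IsClosed {q})
    (h : tw σ n q = p) : (pointIdeal p hp).comap (tw σ n) = pointIdeal q hq := by
  refine le_antisymm (comap_pointIdeal_le σ n hp hq h) ?_
  have h1 := comap_tw_mono (σ := σ) (comap_pointIdeal_le σ (-n) hq hp (h ▸ tw_neg_apply σ n q)) n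
  rwa [comap_tw_comap_tw σ _ (neg_add_cancel n), comap_tw_zero] at h1

lemma comap_tw_pointIdeal (σ : Aut X) {c : X} (hc : IsClosed {c}) {n m : ℤ} (h : m = -n) :
    (pointIdeal c hc).comap (tw σ n) = pointIdeal (tw σ m c) (isClosed_tw σ hc m) := by
  subst h
  refine comap_pointIdeal σ n _ _ ?_
  have := tw_neg_apply σ (-n) c
  rwa [neg_neg] at this

lemma tw_injective {σ : Aut X} {c : X} (hc' : ∀ n : ℤ, n ≠ 0 → tw σ n c ≠ c) :
    Function.Injective fun n : ℤ => tw σ n c := by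
  intro m n h
  by_contra hmn
  refine hc' (-n + m) (by omega) ?_
  rw [tw_add σ (rfl : -n + m = -n + m), Scheme.Hom.comp_apply]
  have h' : tw σ m c = tw σ n c := h
  rw [h', tw_neg_apply]

/-- The points `c_0, c_1, …`: `forwardPoint σ c n` is `c_n`. -/
def forwardPoint (σ : Aut X) (c : X) (n : ℕ) : X := tw σ (-(n : ℤ)) c

/-- The points `c_{-1}, c_{-2}, …`: `backwardPoint σ c n` is `c_{-n-1}`. -/
def backwardPoint (σ : Aut X) (c : X) (n : ℕ) : X := tw σ ((n + 1 : ℕ) : ℤ) c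

section points

variable (σ : Aut X) {c : X}

lemma isClosed_forwardPoint (hc : IsClosed {c}) (n : ℕ) : IsClosed {forwardPoint σ c n} :=
  isClosed_tw σ hc _

lemma isClosed_backwardPoint (hc : IsClosed {c}) (n : ℕ) : IsClosed {backwardPoint σ c n} :=
  isClosed_tw σ hc _

variable {σ} (hc : IsClosed {c})

lemma forwardPoint_injective (hc' : ∀ n : ℤ, n ≠ 0 → tw σ n c ≠ c) :
    Function.Injective (forwardPoint σ c) := fun m n h => by
  have := tw_injective hc' h
  omega

lemma backwardPoint_injective (hc' : ∀ n : ℤ, n ≠ 0 → tw σ n c ≠ c) :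
    Function.Injective (backwardPoint σ c) := fun m n h => by
  have := tw_injective hc' h
  omega

lemma comap_pointIdeal_forward (n : ℕ) : (pointIdeal c hc).comap (tw σ n) =
    pointIdeal (forwardPoint σ c n) (isClosed_forwardPoint σ hc n) :=
  comap_tw_pointIdeal σ hc rfl

lemma comap_pointIdeal_backward (n : ℕ) : (pointIdeal c hc).comap (tw σ (-((n + 1 : ℕ) : ℤ))) =
    pointIdeal (backwardPoint σ c n) (isClosed_backwardPoint σ hc n) :=
  comap_tw_pointIdeal σ hc (by push_cast; ring)

lemma Ipow_eq_prod_forward (n : ℕ) : Ipow σ (pointIdeal c hc) n = ∏ i ∈ Finset.range n,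
    pointIdeal (forwardPoint σ c i) (isClosed_forwardPoint σ hc i) := by
  induction n with
  | zero => simp [Ipow]
  | succ n ih => rw [Ipow, Finset.prod_range_succ, ih, comap_pointIdeal_forward]

/-- The twist of `I_n` by `σ^{-n}` is the product of the ideal sheaves of `c_{-1}, …, c_{-n}`. -/
lemma comap_Ipow_eq_prod_backward (n : ℕ) : (Ipow σ (pointIdeal c hc) n).comap (tw σ (-(n : ℤ))) =
    ∏ i ∈ Finset.range n, pointIdeal (backwardPoint σ c i) (isClosed_backwardPoint σ hc i) := by
  induction n with
  | zero => simp [Ipow]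
  | succ n ih =>
    rw [Ipow_succ', comap_mul, comap_tw_comap_tw σ _ (k := -(n : ℤ)) (by push_cast; ring), ih,
      comap_pointIdeal_backward, Finset.prod_range_succ, mul_comm]

lemma setOf_orbitPoint_nonneg :
    {x | ∃ i : ℤ, 0 ≤ i ∧ x = orbitPoint σ c i} = Set.range (forwardPoint σ c) := by
  ext x
  constructor
  · rintro ⟨i, hi, rfl⟩
    lift i to ℕ using hi
    exact ⟨i, rfl⟩
  · rintro ⟨n, rfl⟩
    exact ⟨n, by omega, rfl⟩

lemma setOf_orbitPoint_neg :
    {x | ∃ i : ℤ, i < 0 ∧ x = orbitPoint σ c i} = Set.range (backwardPoint σ c) := by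
  ext x
  constructor
  · rintro ⟨i, hi, rfl⟩
    obtain ⟨n, rfl⟩ := Int.eq_negSucc_of_lt_zero hi
    exact ⟨n, rfl⟩
  · rintro ⟨n, rfl⟩
    exact ⟨.negSucc n, Int.negSucc_lt_zero n, rfl⟩

lemma setOf_orbitPoint : {x | ∃ i : ℤ, x = orbitPoint σ c i} =
    Set.range (forwardPoint σ c) ∪ Set.range (backwardPoint σ c) := by
  rw [← setOf_orbitPoint_nonneg, ← setOf_orbitPoint_neg]
  ext x
  constructor
  · rintro ⟨i, hi⟩
    rcases lt_or_ge i 0 with h | h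
    · exact Or.inr ⟨i, h, hi⟩
    · exact Or.inl ⟨i, h, hi⟩
  · rintro (⟨i, -, hi⟩ | ⟨i, -, hi⟩) <;> exact ⟨i, hi⟩

end points

lemma isCriticallyDense_range_iff {p : ℕ → X} (hp : ∀ n, IsClosed {p n})
    (hinj : Function.Injective p) : IsCriticallyDense (Set.range p) ↔
      ∀ S ⊆ Set.range p, S.Infinite → closure S = Set.univ :=
  ⟨fun h => h.2.2, fun h => ⟨Set.infinite_range_of_injective hinj, by
    rintro _ ⟨n, rfl⟩
    exact hp n, h⟩⟩

lemma isCriticallyDense_union_iff {C D : Set X} (hC : C.Infinite) (hD : D.Infinite) :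
    IsCriticallyDense (C ∪ D) ↔ IsCriticallyDense C ∧ IsCriticallyDense D := by
  constructor
  · rintro ⟨-, h1, h2⟩
    exact ⟨⟨hC, fun x hx => h1 x (Or.inl hx), fun S hS => h2 S (hS.trans Set.subset_union_left)⟩,
      ⟨hD, fun x hx => h1 x (Or.inr hx), fun S hS => h2 S (hS.trans Set.subset_union_right)⟩⟩
  · rintro ⟨⟨-, h1, h2⟩, ⟨-, h3, h4⟩⟩
    refine ⟨hC.mono Set.subset_union_left, fun x hx => hx.elim (h1 x) (h3 x), fun S hS hinf => ?_⟩
    rw [← Set.inter_eq_self_of_subset_left hS, Set.inter_union_distrib_left,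
      Set.infinite_union] at hinf
    rcases hinf with h | h
    · exact Set.eq_univ_of_subset (closure_mono Set.inter_subset_left)
        (h2 _ Set.inter_subset_right h)
    · exact Set.eq_univ_of_subset (closure_mono Set.inter_subset_left)
        (h4 _ Set.inter_subset_right h)

/-! ### Noetherianity and critical density -/

section noetherian

variable {σ : Aut X} {c : X} {hc : IsClosed {c}} {L : X.Modules} {K : ℕ → X.IdealSheafData}

lemma isQuasicoherentSheaf_idealMul (hL : IsInvertible L) (K : X.IdealSheafData) :
    IsQuasicoherentSheaf (idealMul K L).toModules :=
  isQuasicoherentSheaf_of_isLocalizingOn fun x => by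
    obtain ⟨U, e, hx, -, he⟩ := hL.exists_affine (U := ⊤) (x := x) trivial
    exact ⟨U.1, U.2, hx, isLocalizingOn_idealMul he K⟩

variable (hc L) in
/-- The sheaves `I_n L_n` are closed under multiplication. -/
lemma mul_mem_idealMul_Ipow {n m k : ℕ} (h : n + m = k) {U V W : X.Opens} (hU : W ≤ U)
    (hV : W ≤ tw σ n ⁻¹ᵁ V) : ∀ a ∈ (idealMul (Ipow σ (pointIdeal c hc) n) (Lpow σ L n)).obj U,
      ∀ b ∈ (idealMul (Ipow σ (pointIdeal c hc) m) (Lpow σ L m)).obj V,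
        ((twistedAlgebra σ L).mul h).toFun hU hV a b ∈
          (idealMul (Ipow σ (pointIdeal c hc) k) (Lpow σ L k)).obj W := by
  intro a ha b hb
  refine Pairing.mem_idealMul _ _ _ _ ?_ hU hV ha hb
  rw [← h, Ipow_mul]

/-- Ideal sheaves `K_n ≤ I_n` with `K_n I^{σ^n} ≤ K_{n+1}` define a right ideal. -/
lemma exists_rightIdeal (hL : IsInvertible L) (hKI : ∀ n, K n ≤ Ipow σ (pointIdeal c hc) n)
    (hK : ∀ n : ℕ, K n * (pointIdeal c hc).comap (tw σ n) ≤ K (n + 1)) :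
    ∃ J : RightIdeal (rees σ c hc L), J.IsDefinedBy K := by
  obtain ⟨J, hJ⟩ := exists_rightIdeal_mem_iff (A := twistedAlgebra σ L)
    (fun n => idealMul (Ipow σ (pointIdeal c hc) n) (Lpow σ L n)) (fun U => idealMul_top _ U)
    (mul_mem_idealMul_Ipow hc L) (fun n => idealMul (K n) (Lpow σ L n))
    (fun n => isQuasicoherentSheaf_idealMul (hL.Lpow σ n) (K n))
    (fun n U => idealMul_mono (hKI n) _ U) (by
      rintro n m _ rfl U V W hU hV a ha b hb
      exact Pairing.mem_idealMul _ _ _ _ (mul_Ipow_comap_le hK n m) hU hV ha hb)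
  refine ⟨J, fun n U => ?_⟩
  ext t
  constructor
  · rintro ⟨s, rfl⟩
    exact (hJ n U _).mp ⟨s, rfl⟩
  · intro ht
    obtain ⟨s, hs⟩ := (hJ n U (Subsheaf.lift _ t (idealMul_mono (hKI n) _ U ht))).mpr ht
    exact ⟨s, congrArg (idealMul (Ipow σ (pointIdeal c hc) n) (Lpow σ L n)).val hs⟩

/-- Ideal sheaves `K_n ≤ I_n` with `I K_n^σ ≤ K_{n+1}` define a left ideal. -/
lemma exists_leftIdeal (hL : IsInvertible L) (hKI : ∀ n, K n ≤ Ipow σ (pointIdeal c hc) n)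
    (hK : ∀ n : ℕ, pointIdeal c hc * (K n).comap (tw σ (1 : ℕ)) ≤ K (n + 1)) :
    ∃ J : LeftIdeal (rees σ c hc L), J.IsDefinedBy K := by
  obtain ⟨J, hJ⟩ := exists_leftIdeal_mem_iff (A := twistedAlgebra σ L)
    (fun n => idealMul (Ipow σ (pointIdeal c hc) n) (Lpow σ L n)) (fun U => idealMul_top _ U)
    (mul_mem_idealMul_Ipow hc L) (fun n => idealMul (K n) (Lpow σ L n))
    (fun n => isQuasicoherentSheaf_idealMul (hL.Lpow σ n) (K n))
    (fun n U => idealMul_mono (hKI n) _ U) (by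
      rintro n m _ rfl U V W hU hV a ha b hb
      exact Pairing.mem_idealMul _ _ _ _ (Ipow_mul_comap_le hK n m) hU hV ha hb)
  refine ⟨J, fun n U => ?_⟩
  ext t
  constructor
  · rintro ⟨s, rfl⟩
    exact (hJ n U _).mp ⟨s, rfl⟩
  · intro ht
    obtain ⟨s, hs⟩ := (hJ n U (Subsheaf.lift _ t (idealMul_mono (hKI n) _ U ht))).mpr ht
    exact ⟨s, congrArg (idealMul (Ipow σ (pointIdeal c hc) n) (Lpow σ L n)).val hs⟩

/-- Twisting by `σ^{-n}` in degree `n` turns the condition `K_{n+1} = I K_n^σ` on left ideals into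
`K_{n+1} = K_n I_{c_{-n-1}}`. -/
lemma comap_pointIdeal_mul_comap (K : X.IdealSheafData) (n : ℕ) :
    (pointIdeal c hc * K.comap (tw σ (1 : ℕ))).comap (tw σ (-((n + 1 : ℕ) : ℤ))) =
      K.comap (tw σ (-(n : ℤ))) *
        pointIdeal (backwardPoint σ c n) (isClosed_backwardPoint σ hc n) := by
  rw [comap_mul, comap_tw_comap_tw σ _ (k := -(n : ℤ)) (by push_cast; ring),
    comap_pointIdeal_backward, mul_comm]

lemma comap_tw_neg_comap_tw (K : X.IdealSheafData) (n : ℤ) :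
    (K.comap (tw σ (-n))).comap (tw σ n) = K := by
  rw [comap_tw_comap_tw σ _ (neg_add_cancel n), comap_tw_zero]

lemma comap_tw_comap_tw_neg (K : X.IdealSheafData) (n : ℤ) :
    (K.comap (tw σ n)).comap (tw σ (-n)) = K := by
  rw [comap_tw_comap_tw σ _ (add_neg_cancel n), comap_tw_zero]

variable [IsIntegral X] [IsNoetherian X]

theorem isRightNoetherian_of_dense (hL : IsInvertible L) (hc' : ∀ n : ℤ, n ≠ 0 → tw σ n c ≠ c)
    (h : ∀ S ⊆ Set.range (forwardPoint σ c), S.Infinite → closure S = Set.univ) :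
    IsRightNoetherian (rees σ c hc L) := by
  intro J
  obtain ⟨K, hJ⟩ := J.exists_isDefinedBy hL
  obtain ⟨N, hN⟩ := exists_forall_eq_mul_pointIdeal (hp := isClosed_forwardPoint σ hc)
    (forwardPoint_injective hc') h K
    (fun n => comap_pointIdeal_forward (σ := σ) hc n ▸ hJ.mul_le hL n)
    fun n => Ipow_eq_prod_forward (σ := σ) hc n ▸ hJ.le_Ipow hL n
  exact hJ.isCoherent hL fun n hn => comap_pointIdeal_forward (σ := σ) hc n ▸ hN n hn

theorem dense_of_isRightNoetherian (hL : IsInvertible L) (hc' : ∀ n : ℤ, n ≠ 0 → tw σ n c ≠ c)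
    (h : IsRightNoetherian (rees σ c hc L)) :
    ∀ S ⊆ Set.range (forwardPoint σ c), S.Infinite → closure S = Set.univ := by
  intro D hD hinf
  by_contra hne
  obtain ⟨A, S, hS, hA, hAP, hAS⟩ := exists_chain_of_not_dense
    (hp := isClosed_forwardPoint σ hc) (forwardPoint_injective hc') hD hinf hne
  obtain ⟨J, hJ⟩ := exists_rightIdeal (σ := σ) (hc := hc) (K := A) hL
    (fun n => Ipow_eq_prod_forward (σ := σ) hc n ▸ hAP n)
    fun n => comap_pointIdeal_forward (σ := σ) hc n ▸ hA n
  obtain ⟨N, hN⟩ := hJ.exists_le_mul hL (h J)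
  obtain ⟨s, hs, hNs⟩ := hS.exists_gt N
  refine hAS s hs (s + 1) (s + 1) (by omega) le_rfl ?_
  rw [truncatedChain_of_le le_rfl, truncatedChain_succ le_rfl, truncatedChain_of_le le_rfl,
    ← comap_pointIdeal_forward]
  exact hN s hNs.le

theorem isLeftNoetherian_of_dense (hL : IsInvertible L) (hc' : ∀ n : ℤ, n ≠ 0 → tw σ n c ≠ c)
    (h : ∀ S ⊆ Set.range (backwardPoint σ c), S.Infinite → closure S = Set.univ) :
    IsLeftNoetherian (rees σ c hc L) := by
  intro J
  obtain ⟨K, hJ⟩ := J.exists_isDefinedBy hL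
  obtain ⟨N, hN⟩ := exists_forall_eq_mul_pointIdeal (hp := isClosed_backwardPoint σ hc)
    (backwardPoint_injective hc') h (fun n => (K n).comap (tw σ (-(n : ℤ))))
    (fun n => comap_pointIdeal_mul_comap (σ := σ) (hc := hc) (K n) n ▸
      comap_tw_mono (hJ.mul_le hL n) _)
    fun n => comap_Ipow_eq_prod_backward (σ := σ) hc n ▸ comap_tw_mono (hJ.le_Ipow hL n) _
  refine hJ.isCoherent hL (N := N) fun n hn => ?_
  have h1 := (hN n hn).trans (comap_pointIdeal_mul_comap (hc := hc) (K n) n).symm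
  rw [← comap_tw_neg_comap_tw (σ := σ) (K (n + 1)) ((n + 1 : ℕ) : ℤ), h1, comap_tw_neg_comap_tw]

theorem dense_of_isLeftNoetherian (hL : IsInvertible L) (hc' : ∀ n : ℤ, n ≠ 0 → tw σ n c ≠ c)
    (h : IsLeftNoetherian (rees σ c hc L)) :
    ∀ S ⊆ Set.range (backwardPoint σ c), S.Infinite → closure S = Set.univ := by
  intro D hD hinf
  by_contra hne
  obtain ⟨A, S, hS, hA, hAP, hAS⟩ := exists_chain_of_not_dense
    (hp := isClosed_backwardPoint σ hc) (backwardPoint_injective hc') hD hinf hne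
  have hmul : ∀ n : ℕ,
      (A n * pointIdeal (backwardPoint σ c n) (isClosed_backwardPoint σ hc n)).comap
        (tw σ ((n + 1 : ℕ) : ℤ)) =
        pointIdeal c hc * ((A n).comap (tw σ n)).comap (tw σ (1 : ℕ)) := fun n => by
    rw [← comap_tw_neg_comap_tw (σ := σ) (pointIdeal c hc * _) ((n + 1 : ℕ) : ℤ),
      comap_pointIdeal_mul_comap, comap_tw_comap_tw_neg]
  obtain ⟨J, hJ⟩ := exists_leftIdeal (σ := σ) (hc := hc) (K := fun n => (A n).comap (tw σ n)) hL
    (fun n => by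
      rw [← comap_tw_neg_comap_tw (σ := σ) (Ipow _ _ n) n, comap_Ipow_eq_prod_backward]
      exact comap_tw_mono (hAP n) _)
    fun n => hmul n ▸ comap_tw_mono (hA n) _
  obtain ⟨N, hN⟩ := hJ.exists_le_mul hL (h J)
  obtain ⟨s, hs, hNs⟩ := hS.exists_gt N
  refine hAS s hs (s + 1) (s + 1) (by omega) le_rfl ?_
  rw [truncatedChain_of_le le_rfl, truncatedChain_succ le_rfl, truncatedChain_of_le le_rfl]
  have h1 := hN s hNs.le
  rw [← hmul] at h1
  have h2 := comap_tw_mono (σ := σ) h1 (-((s + 1 : ℕ) : ℤ))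
  rwa [comap_tw_comap_tw_neg, comap_tw_comap_tw_neg] at h2

theorem isRightNoetherian_iff (hL : IsInvertible L) (hc' : ∀ n : ℤ, n ≠ 0 → tw σ n c ≠ c) :
    IsRightNoetherian (rees σ c hc L) ↔
      IsCriticallyDense {x | ∃ i : ℤ, 0 ≤ i ∧ x = orbitPoint σ c i} := by
  rw [setOf_orbitPoint_nonneg, isCriticallyDense_range_iff (isClosed_forwardPoint σ hc)
    (forwardPoint_injective hc')]
  exact ⟨dense_of_isRightNoetherian hL hc', isRightNoetherian_of_dense hL hc'⟩

theorem isLeftNoetherian_iff (hL : IsInvertible L) (hc' : ∀ n : ℤ, n ≠ 0 → tw σ n c ≠ c) :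
    IsLeftNoetherian (rees σ c hc L) ↔
      IsCriticallyDense {x | ∃ i : ℤ, i < 0 ∧ x = orbitPoint σ c i} := by
  rw [setOf_orbitPoint_neg, isCriticallyDense_range_iff (isClosed_backwardPoint σ hc)
    (backwardPoint_injective hc')]
  exact ⟨dense_of_isLeftNoetherian hL hc', isLeftNoetherian_of_dense hL hc'⟩

theorem isNoetherianAlgebra_iff (hL : IsInvertible L) (hc' : ∀ n : ℤ, n ≠ 0 → tw σ n c ≠ c) :
    IsNoetherianAlgebra (rees σ c hc L) ↔
      IsCriticallyDense {x | ∃ i : ℤ, x = orbitPoint σ c i} := by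
  rw [setOf_orbitPoint, isCriticallyDense_union_iff
    (Set.infinite_range_of_injective (forwardPoint_injective hc'))
    (Set.infinite_range_of_injective (backwardPoint_injective hc')), ← setOf_orbitPoint_nonneg,
    ← setOf_orbitPoint_neg, ← isRightNoetherian_iff hL hc', ← isLeftNoetherian_iff hL hc']
  rfl

end noetherian

/-! ### Quotient sheaves -/

namespace Subsheaf

variable {M : X.Modules} (S : Subsheaf M)

/-- The presheaf quotient `U ↦ M(U) / S(U)`. -/
def presheafQuotient : X.PresheafOfModules where
  obj U := ModuleCat.of _ (M.val.obj U ⧸ S.toSubmodule.obj U)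
  map {U V} f := ModuleCat.semilinearMapAddEquiv _ _ _ <|
    (S.toSubmodule.obj U).mapQ (S.toSubmodule.obj V) (M.val.restrictₛₗ f) (S.toSubmodule.map f)
  map_id U := by
    ext x
    refine congrArg (Submodule.Quotient.mk (p := S.toSubmodule.obj U)) ?_
    exact ConcreteCategory.congr_hom (M.presheaf.map_id U) x
  map_comp {U V W} f g := by
    ext x
    refine congrArg (Submodule.Quotient.mk (p := S.toSubmodule.obj W)) ?_
    exact ConcreteCategory.congr_hom (M.presheaf.map_comp f g) x

/-- The quotient sheaf `M / S`. -/
def quotient : X.Modules :=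
  (PresheafOfModules.sheafification (𝟙 X.ringCatSheaf.obj)).obj S.presheafQuotient

/-- The map from the presheaf quotient to the quotient sheaf. -/
def quotientUnit : S.presheafQuotient ⟶ S.quotient.val :=
  (PresheafOfModules.sheafificationAdjunction (𝟙 X.ringCatSheaf.obj)).unit.app S.presheafQuotient

/-- The class of a section of `M` in `M / S`. -/
def toQuotient (U : X.Opens) : Γ(M, U) →ₗ[Γ(X, U)] Γ(S.quotient, U) :=
  ((S.quotientUnit).app (.op U)).hom ∘ₗ (S.obj U).mkQ

lemma toQuotient_res {U V : X.Opens} (h : V ≤ U) (s : Γ(M, U)) :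
    S.toQuotient V (res M h s) = res _ h (S.toQuotient U s) :=
  PresheafOfModules.naturality_apply S.quotientUnit (homOfLE h).op
    (Submodule.Quotient.mk (p := S.obj U) s)

lemma exists_toQuotient_eq {U : X.Opens} (t : Γ(S.quotient, U)) {x : X} (hx : x ∈ U) :
    ∃ (V : X.Opens) (h : V ≤ U), x ∈ V ∧ ∃ s, S.toQuotient V s = res _ h t := by
  have := Presheaf.imageSieve_mem (Opens.grothendieckTopology X)
    (CategoryTheory.toSheafify (Opens.grothendieckTopology X) S.presheafQuotient.presheaf)
    (U := .op U) t
  obtain ⟨V, f, ⟨q, hq⟩, hxV⟩ := this x hx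
  obtain ⟨s, rfl⟩ := Submodule.Quotient.mk_surjective _ q
  exact ⟨V, leOfHom f, hxV, s, hq⟩

lemma toQuotient_eq_zero_iff {U : X.Opens} {s : Γ(M, U)} : S.toQuotient U s = 0 ↔ s ∈ S.obj U := by
  constructor
  · intro hs
    refine S.mem_of_local s fun x hx => ?_
    have := Presheaf.equalizerSieve_mem (Opens.grothendieckTopology X)
      (CategoryTheory.toSheafify (Opens.grothendieckTopology X) S.presheafQuotient.presheaf)
      (X := .op U) (Submodule.Quotient.mk (p := S.obj U) s) 0
      (hs.trans (map_zero (S.toQuotient U)).symm)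
    obtain ⟨V, f, hq, hxV⟩ := this x hx
    refine ⟨V, leOfHom f, hxV, (Submodule.Quotient.mk_eq_zero (S.obj V)).mp ?_⟩
    exact hq.trans (map_zero _)
  · intro hs
    exact (congrArg _ ((Submodule.Quotient.mk_eq_zero (S.obj U)).mpr hs)).trans
      (map_zero ((S.quotientUnit).app (.op U)).hom)

variable {S}

lemma exists_pow_smul_quotient_eq_zero (hM : IsQuasicoherentSheaf M)
    (hS : IsQuasicoherentSheaf S.toModules) {U : X.Opens} (hU : IsAffineOpen U) (f : Γ(X, U))
    {q : Γ(S.quotient, U)} (hq : res _ (X.basicOpen_le f) q = 0) : ∃ m : ℕ, f ^ m • q = 0 := by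
  have key : ∀ x : U, ∃ (W : X.Opens) (h : W ≤ U) (m : ℕ), x.1 ∈ W ∧
      res _ h (f ^ m • q) = 0 := by
    rintro ⟨x, hx⟩
    obtain ⟨V, hV, hxV, s, hs⟩ := S.exists_toQuotient_eq q hx
    obtain ⟨W, hxW, hW⟩ := exists_affine hxV
    let f' := resO (hW.trans hV) f
    have hle : X.basicOpen f' ≤ X.basicOpen f := by
      have := X.basicOpen_res f (homOfLE (hW.trans hV)).op
      exact this.le.trans inf_le_right
    have h1 : res _ (X.basicOpen_le f') (res _ hW s) ∈ S.obj (X.basicOpen f') := by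
      rw [← S.toQuotient_eq_zero_iff, S.toQuotient_res, S.toQuotient_res, hs, res_res, res_res,
        ← res_res _ (X.basicOpen_le f) hle, hq, map_zero]
    obtain ⟨a, j, hj⟩ := (hS.isLocalizingOn W.2 f').1 (S.lift _ h1)
    have hj' := congrArg S.val hj
    rw [S.val_res, S.val_smul, S.val_lift] at hj'
    obtain ⟨b, hb⟩ := (hM.isLocalizingOn W.2 f').2 (f' ^ a • res _ hW s - S.val j) (by
      rw [map_sub, hj', res_smul, map_pow, sub_self])
    refine ⟨W.1, hW.trans hV, b + a, hxW, ?_⟩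
    rw [smul_sub, sub_eq_zero, smul_smul, ← pow_add] at hb
    rw [res_smul, map_pow, ← res_res _ hV hW, ← hs, ← S.toQuotient_res, ← map_smul,
      S.toQuotient_eq_zero_iff]
    change f' ^ (b + a) • _ ∈ _
    rw [hb]
    exact Submodule.smul_mem _ _ (S.val_mem j)
  choose W hW m hxW hm using key
  obtain ⟨t, ht⟩ := hU.isCompact.elim_finite_subcover (fun x : U => (W x : Set X))
    (fun x => (W x).isOpen) fun x hx => Set.mem_iUnion.mpr ⟨⟨x, hx⟩, hxW ⟨x, hx⟩⟩
  refine ⟨t.sup m, eq_of_locally _ fun y hy => ?_⟩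
  obtain ⟨x, hx⟩ := Set.mem_iUnion.mp (ht hy)
  obtain ⟨hxt, hyx⟩ := Set.mem_iUnion.mp hx
  refine ⟨W x, hW x, hyx, ?_⟩
  rw [← Nat.sub_add_cancel (Finset.le_sup (f := m) hxt), pow_add, mul_smul, res_smul, hm x,
    smul_zero, map_zero]

/-- Over an affine open subset, sections of the quotient of quasi-coherent sheaves lift. -/
lemma toQuotient_surjective (hM : IsQuasicoherentSheaf M) (hS : IsQuasicoherentSheaf S.toModules)
    {U : X.Opens} (hU : IsAffineOpen U) : Function.Surjective (S.toQuotient U) := by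
  intro s
  -- the functions `g` for which `g s` lifts form an ideal, which is not contained in any prime
  let I : Ideal Γ(X, U) :=
    (LinearMap.range (S.toQuotient U)).comap (LinearMap.toSpanSingleton Γ(X, U) _ s)
  suffices h : I = ⊤ by
    have h1 : (1 : Γ(X, U)) ∈ I := h ▸ trivial
    obtain ⟨t, ht⟩ := h1
    exact ⟨t, ht.trans (one_smul _ s)⟩
  rw [← Ideal.span_eq I, ← hU.self_le_iSup_basicOpen_iff]
  intro x hx
  obtain ⟨V, hV, hxV, t, ht⟩ := S.exists_toQuotient_eq s hx
  obtain ⟨g, hg, hxg⟩ := hU.exists_basicOpen_le (V := V) ⟨x, hxV⟩ hx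
  obtain ⟨n, t', ht'⟩ := (hM.isLocalizingOn hU g).1 (res _ hg t)
  obtain ⟨m, hm⟩ := exists_pow_smul_quotient_eq_zero hM hS hU g
    (q := S.toQuotient U t' - g ^ n • s) (by
      rw [map_sub, ← S.toQuotient_res, ht', map_smul, S.toQuotient_res, ht, res_res, res_smul,
        map_pow, sub_self])
  rw [smul_sub, sub_eq_zero, smul_smul, ← pow_add] at hm
  have hmem : g ^ (m + n + 1) ∈ I := by
    refine ⟨g • g ^ m • t', ?_⟩
    rw [map_smul, map_smul, hm, smul_smul, ← pow_succ']
    rfl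
  refine TopologicalSpace.Opens.mem_iSup.mpr ⟨⟨_, hmem⟩, ?_⟩
  rwa [Scheme.basicOpen_pow _ _ (Nat.succ_pos _)]

lemma isQuasicoherentSheaf_quotient (hM : IsQuasicoherentSheaf M)
    (hS : IsQuasicoherentSheaf S.toModules) : IsQuasicoherentSheaf S.quotient :=
  isQuasicoherentSheaf_of_isLocalizingOn fun x => by
    obtain ⟨U, hx, -⟩ := exists_affine (x := x) (U := ⊤) trivial
    refine ⟨U.1, U.2, hx, fun f => ⟨fun s => ?_,
      fun t ht => exists_pow_smul_quotient_eq_zero hM hS U.2 f ht⟩⟩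
    obtain ⟨s, rfl⟩ := toQuotient_surjective hM hS (U.2.basicOpen f) s
    obtain ⟨n, t, ht⟩ := (hM.isLocalizingOn U.2 f).1 s
    exact ⟨n, S.toQuotient _ t, by rw [← S.toQuotient_res, ht, map_smul]⟩

end Subsheaf

/-! ### Quotients of graded modules -/

namespace Pairing

variable {τ : X ⟶ X} {M N P : X.Modules} (β : Pairing τ M N P) (S : Subsheaf M) (T : Subsheaf P)

lemma toFun_res_left {U U' V W : X.Opens} (hU : U' ≤ U) (hW : W ≤ U') (hV : W ≤ τ ⁻¹ᵁ V)
    (a : Γ(M, U)) (b : Γ(N, V)) :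
    β.toFun hW hV (res M hU a) b = β.toFun (hW.trans hU) hV a b := by
  have := β.toFun_res hU le_rfl hW hV a b
  rwa [res_self] at this

lemma toFun_sub_left {U V W : X.Opens} (hU : W ≤ U) (hV : W ≤ τ ⁻¹ᵁ V) (a a' : Γ(M, U))
    (b : Γ(N, V)) : β.toFun hU hV (a - a') b = β.toFun hU hV a b - β.toFun hU hV a' b := by
  rw [eq_sub_iff_add_eq, ← β.add_left, sub_add_cancel]

/-- The product of sections of `M` and `N`, modulo `T`, depends only on the class of the first
factor modulo `S`. -/
def Descends : Prop :=
  ∀ {U V W : X.Opens} (hU : W ≤ U) (hV : W ≤ τ ⁻¹ᵁ V), ∀ a ∈ S.obj U, ∀ b : Γ(N, V),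
    β.toFun hU hV a b ∈ T.obj W

variable {β S T}

lemma Descends.toQuotient_eq (H : β.Descends S T) {U V W : X.Opens} (hU : W ≤ U)
    (hV : W ≤ τ ⁻¹ᵁ V) {a a' : Γ(M, U)} (h : S.toQuotient U a = S.toQuotient U a') (b : Γ(N, V)) :
    T.toQuotient W (β.toFun hU hV a b) = T.toQuotient W (β.toFun hU hV a' b) := by
  rw [← sub_eq_zero, ← map_sub, ← β.toFun_sub_left, T.toQuotient_eq_zero_iff]
  refine H hU hV _ ?_ b
  rw [← S.toQuotient_eq_zero_iff, map_sub, h, sub_self]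

/-- The products of local lifts of `a` with `b` glue modulo `T`. -/
lemma Descends.exists_prod (H : β.Descends S T) {U V W : X.Opens} (hU : W ≤ U)
    (hV : W ≤ τ ⁻¹ᵁ V) (a : Γ(S.quotient, U)) (b : Γ(N, V)) :
    ∃ y : Γ(T.quotient, W), ∀ (W' : X.Opens) (hW : W' ≤ W) (a' : Γ(M, W')),
      S.toQuotient W' a' = res _ (hW.trans hU) a →
        res _ hW y = T.toQuotient W' (β.toFun le_rfl (hW.trans hV) a' b) := by
  choose Z hZ hxZ l hl using fun x : W => S.exists_toQuotient_eq a (hU x.2)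
  let Z' : W → X.Opens := fun x => Z x ⊓ W
  have hZ' : ∀ x, Z' x ≤ W := fun x => inf_le_right
  obtain ⟨y, hy⟩ := exists_glue T.quotient Z' hZ' (fun x hx => ⟨⟨x, hx⟩, hxZ ⟨x, hx⟩, hx⟩)
    (fun x => T.toQuotient _ (β.toFun inf_le_left ((hZ' x).trans hV) (l x) b)) fun x x' => by
      rw [← T.toQuotient_res, ← T.toQuotient_res, β.res_toFun, β.res_toFun,
        ← β.toFun_res_left (inf_le_left.trans inf_le_left) le_rfl,
        ← β.toFun_res_left (inf_le_right.trans inf_le_left) le_rfl]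
      refine H.toQuotient_eq _ _ ?_ b
      rw [S.toQuotient_res, S.toQuotient_res, hl, hl, res_res, res_res]
  refine ⟨y, fun W' hW a' ha' => eq_of_locally _ fun x hx => ?_⟩
  let x' : W := ⟨x, hW hx⟩
  refine ⟨W' ⊓ Z' x', inf_le_left, ⟨hx, hxZ x', hW hx⟩, ?_⟩
  have h1 := congrArg (res T.quotient (inf_le_right : W' ⊓ Z' x' ≤ Z' x')) (hy x')
  rw [res_res] at h1 ⊢
  rw [h1, ← T.toQuotient_res, ← T.toQuotient_res, β.res_toFun, β.res_toFun,
    ← β.toFun_res_left (inf_le_right.trans inf_le_left) le_rfl,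
    ← β.toFun_res_left (U' := W' ⊓ Z' x') inf_le_left le_rfl]
  refine H.toQuotient_eq _ _ ?_ b
  rw [S.toQuotient_res, S.toQuotient_res, hl, ha', res_res, res_res]

/-- The product of a section of a quotient and a section of `N`. -/
def Descends.prod (H : β.Descends S T) {U V W : X.Opens} (hU : W ≤ U) (hV : W ≤ τ ⁻¹ᵁ V)
    (a : Γ(S.quotient, U)) (b : Γ(N, V)) : Γ(T.quotient, W) :=
  (H.exists_prod hU hV a b).choose

lemma Descends.res_prod (H : β.Descends S T) {U V W W' : X.Opens} (hU : W ≤ U)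
    (hV : W ≤ τ ⁻¹ᵁ V) (hW : W' ≤ W) {a : Γ(S.quotient, U)} (b : Γ(N, V)) {a' : Γ(M, W')}
    (ha : S.toQuotient W' a' = res _ (hW.trans hU) a) :
    res _ hW (H.prod hU hV a b) = T.toQuotient W' (β.toFun le_rfl (hW.trans hV) a' b) :=
  (H.exists_prod hU hV a b).choose_spec W' hW a' ha

/-- Sections may be compared locally, where `a` lifts. -/
lemma Descends.eq_of_lift (S : Subsheaf M) {Q : X.Modules} {U W : X.Opens} (hU : W ≤ U)
    (a : Γ(S.quotient, U)) {y y' : Γ(Q, W)} (h : ∀ (W' : X.Opens) (hW : W' ≤ W) (a' : Γ(M, W')),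
      S.toQuotient W' a' = res _ (hW.trans hU) a → res _ hW y = res _ hW y') : y = y' := by
  refine eq_of_locally _ fun x hx => ?_
  obtain ⟨Z, hZ, hxZ, l, hl⟩ := S.exists_toQuotient_eq a (hU hx)
  refine ⟨Z ⊓ W, inf_le_right, ⟨hxZ, hx⟩, h _ _ (res _ inf_le_left l) ?_⟩
  rw [S.toQuotient_res, hl, res_res]

/-- A pairing descends to quotients. -/
def quotient (H : β.Descends S T) : Pairing τ S.quotient N T.quotient where
  toFun hU hV a b := H.prod hU hV a b
  add_left hU hV a a' b := Descends.eq_of_lift S hU a fun W₁ hW₁ l hl => by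
    refine Descends.eq_of_lift S (hW₁.trans hU) a' fun W₂ hW₂ l' hl' => ?_
    have hl₂ : S.toQuotient W₂ (res _ hW₂ l) = res _ ((hW₂.trans hW₁).trans hU) a := by
      rw [S.toQuotient_res, hl, res_res]
    rw [res_res, res_res, map_add, H.res_prod hU hV _ b hl₂, H.res_prod hU hV _ b hl',
      H.res_prod hU hV _ b (a' := res _ hW₂ l + l') (by rw [map_add, map_add, hl₂, hl']),
      β.add_left, map_add]
  add_right hU hV a b b' := Descends.eq_of_lift S hU a fun W₁ hW₁ l hl => by
    rw [map_add, H.res_prod hU hV _ _ hl, H.res_prod hU hV _ _ hl, H.res_prod hU hV _ _ hl,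
      β.add_right, map_add]
  smul_left hU hV r a b := Descends.eq_of_lift S hU a fun W₁ hW₁ l hl => by
    rw [res_smul, H.res_prod hU hV _ _ hl, H.res_prod hU hV _ _ (a' := resO (hW₁.trans hU) r • l)
      (by rw [map_smul, hl, res_smul]), β.smul_left, map_smul, resO_resO, resO_resO]
  smul_right hU hV r a b := Descends.eq_of_lift S hU a fun W₁ hW₁ l hl => by
    rw [res_smul, H.res_prod hU hV _ _ hl, H.res_prod hU hV _ _ hl, β.smul_right, map_smul,
      resO_resO]
  res_toFun hU hV hW a b := Descends.eq_of_lift S (hW.trans hU) a fun W₁ hW₁ l hl => by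
    rw [res_res, H.res_prod _ _ _ _ hl, H.res_prod _ _ _ _ hl]
  toFun_res hU hV hWU hWV a b := Descends.eq_of_lift S (hWU.trans hU) a fun W₁ hW₁ l hl => by
    rw [H.res_prod _ _ _ _ hl, H.res_prod _ _ _ _ (a' := l) (by rw [hl, res_res])]
    have := β.toFun_res (le_refl W₁) hV le_rfl (hW₁.trans hWV) l b
    rw [res_self] at this
    rw [this]

lemma quotient_toFun (H : β.Descends S T) {U U' V W : X.Opens} (hU : W ≤ U) (hV : W ≤ τ ⁻¹ᵁ V)
    (hU' : U' ≤ U) (hW : W ≤ U') {a : Γ(S.quotient, U)} {a' : Γ(M, U')}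
    (ha : S.toQuotient U' a' = res _ hU' a) (b : Γ(N, V)) :
    (quotient H).toFun hU hV a b = T.toQuotient W (β.toFun hW hV a' b) := by
  have := H.res_prod hU hV le_rfl (a := a) b (a' := res _ hW a') (by
    rw [S.toQuotient_res, ha, res_res])
  rw [res_self] at this
  refine this.trans ?_
  rw [β.toFun_res_left]

end Pairing

variable {σ : Aut X} {B : GradedBimoduleAlgebra σ}

namespace RightModule

/-- The quotient of a graded right module by subsheaves that form a submodule. -/
def quotient (M : RightModule B) (S : ∀ n, Subsheaf (M.G n))
    (hS : ∀ n, IsQuasicoherentSheaf (S n).toModules)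
    (H : ∀ {n : ℤ} {m : ℕ} {k : ℤ} (h : n + m = k), (M.act h).Descends (S n) (S k)) :
    RightModule B where
  G n := (S n).quotient
  quasicoherent n := Subsheaf.isQuasicoherentSheaf_quotient (M.quasicoherent n) (hS n)
  act h := Pairing.quotient (H h)
  act_one hU a := Pairing.Descends.eq_of_lift (S _) hU a fun W₁ hW₁ l hl =>
    ((Pairing.quotient (H _)).res_toFun _ _ hW₁ a B.one).trans <|
      (Pairing.quotient_toFun (H _) _ _ (hW₁.trans hU) le_rfl hl _).trans <|
        (congrArg _ (M.act_one le_rfl l)).trans <| by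
          rw [(S _).toQuotient_res, hl, res_res, res_res]
  act_mul {n m p i j k} h₁ h₂ h₃ h₄ U V W U' V' Z hU hV hU' hW hV' hW' hZ hZ' a b c :=
    Pairing.Descends.eq_of_lift (S n) hZ a fun W₁ hW₁ l hl => by
      have h0 : (S i).toQuotient W₁
          ((M.act h₁).toFun le_rfl ((hW₁.trans hU').trans hV) l b) =
            res _ (hW₁.trans hU') ((Pairing.quotient (H h₁)).toFun hU hV a b) := by
        rw [Pairing.res_toFun, Pairing.quotient_toFun (H h₁) _ _ (hW₁.trans hZ) le_rfl hl]
      rw [Pairing.res_toFun, Pairing.res_toFun,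
        Pairing.quotient_toFun (H h₂) _ _ (hW₁.trans hU') le_rfl h0,
        Pairing.quotient_toFun (H h₄) _ _ (hW₁.trans hZ) le_rfl hl]
      exact congrArg _ (M.act_mul h₁ h₂ h₃ h₄ le_rfl _ le_rfl _ hV' hW' le_rfl _ l b c)

/-- The projection to the quotient. -/
def toQuotient (M : RightModule B) (S : ∀ n, Subsheaf (M.G n))
    (hS : ∀ n, IsQuasicoherentSheaf (S n).toModules)
    (H : ∀ {n : ℤ} {m : ℕ} {k : ℤ} (h : n + m = k), (M.act h).Descends (S n) (S k)) :
    Hom M (M.quotient S hS H) where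
  app n := homOfSections (S n).toQuotient fun h s => (S n).toQuotient_res h s
  app_act h _ _ _ hU hV _ b :=
    (Pairing.quotient_toFun (H h) hU hV le_rfl hU (res_self _ _).symm b).symm

lemma isSurjective_toQuotient (M : RightModule B) (S : ∀ n, Subsheaf (M.G n))
    (hS : ∀ n, IsQuasicoherentSheaf (S n).toModules)
    (H : ∀ {n : ℤ} {m : ℕ} {k : ℤ} (h : n + m = k), (M.act h).Descends (S n) (S k)) :
    (M.toQuotient S hS H).IsSurjective := fun n _ t _ hx => (S n).exists_toQuotient_eq t hx

/-- Quotients of coherent graded modules are coherent. -/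
lemma Hom.IsSurjective.isCoherent {M Q : RightModule B} {π : Hom M Q} (hπ : π.IsSurjective)
    (hM : M.IsCoherent) : Q.IsCoherent := by
  obtain ⟨F, hF, θ, hθ, hgen⟩ := hM
  let θ' : ∀ n : ℤ, F ⟶ (Scheme.Modules.pushforward (tw σ n)).obj (Q.G n) :=
    fun n => θ n ≫ (Scheme.Modules.pushforward (tw σ n)).map (π.app n)
  have hcomp : ∀ (n : ℤ) (W : X.Opens) (m : ℕ) (s : Γ(F, tw σ m ⁻¹ᵁ W))
      (e : Γ(B.E m, tw σ m ⁻¹ᵁ W)), Q.component θ' n W m s e =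
        (π.app n).app _ (M.component θ n W m s e) := fun n W m s e =>
    (π.app_act _ _ _ _ _).symm
  refine ⟨F, hF, θ', fun U s x hx => ?_, fun d V g x hx => ?_⟩
  · obtain ⟨V, hV, hxV, hfin⟩ := hθ U s x hx
    refine ⟨V, hV, hxV, hfin.subset fun n hn h => hn ?_⟩
    exact (congrArg ((π.app n).app (tw σ n ⁻¹ᵁ V)) h).trans (map_zero _)
  · have hy : tw σ d (tw σ (-d) x) = x := by
      have := tw_neg_apply σ (-d) x
      rwa [neg_neg] at this
    obtain ⟨V', hV', hyV', s, hs⟩ := hπ d _ g (tw σ (-d) x) (by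
      change tw σ d (tw σ (-d) x) ∈ V
      rwa [hy])
    have e1 := tw_preimage_neg σ d V'
    have hVV : tw σ (-d) ⁻¹ᵁ V' ≤ V := by
      rw [← tw_neg_preimage σ d V]
      exact (tw σ (-d)).preimage_mono hV'
    obtain ⟨W, hW, hxW, r, m, t, e, h1, h2⟩ := hgen d (tw σ (-d) ⁻¹ᵁ V') (res _ e1.le s) x hyV'
    refine ⟨W, hW.trans hVV, hxW, r, m, t, e, ?_, fun n hn => ?_⟩
    · simp only [hcomp]
      rw [← map_sum, h1, res_res, app_res, hs, res_res]
    · simp only [hcomp]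
      rw [← map_sum, h2 n hn, map_zero]

/-- A coherent graded module that is not bounded is not torsion. -/
lemma not_isTorsion {Q : RightModule B} (hQ : Q.IsCoherent) (h : ¬ Q.IsBounded) :
    ¬ Q.IsTorsion := fun ht =>
  h (ht Q ⟨fun _ => 𝟙 _, by intros; rfl⟩ (fun _ _ _ _ h => h) hQ)

end RightModule

namespace RightIdeal

variable {J J' : RightIdeal B} (hJ : J.Le J')

/-- The inclusion of a section of a right ideal in a larger right ideal. -/
def leSection (hJ : J.Le J') {n : ℕ} {U : X.Opens} (s : Γ(J.G n, U)) : Γ(J'.G n, U) :=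
  (hJ n U _ ⟨s, rfl⟩).choose

lemma incl_leSection {n : ℕ} {U : X.Opens} (s : Γ(J.G n, U)) :
    (J'.incl n).app U (leSection hJ s) = (J.incl n).app U s :=
  (hJ n U _ ⟨s, rfl⟩).choose_spec

/-- The inclusion of right ideals, on sections. -/
def leMap (hJ : J.Le J') (n : ℕ) (U : X.Opens) : Γ(J.G n, U) →ₗ[Γ(X, U)] Γ(J'.G n, U) where
  toFun := leSection hJ
  map_add' s t := J'.incl_injective n U (by
    rw [map_add, incl_leSection, incl_leSection, incl_leSection, map_add])
  map_smul' r s := J'.incl_injective n U (by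
    rw [RingHom.id_apply, Scheme.Modules.Hom.app_smul, incl_leSection, incl_leSection,
      Scheme.Modules.Hom.app_smul])

lemma incl_leMap (n : ℕ) (U : X.Opens) (s : Γ(J.G n, U)) :
    (J'.incl n).app U (leMap hJ n U s) = (J.incl n).app U s :=
  incl_leSection hJ s

lemma leMap_res (n : ℕ) {U V : X.Opens} (h : V ≤ U) (s : Γ(J.G n, U)) :
    leMap hJ n V (res _ h s) = res _ h (leMap hJ n U s) :=
  J'.incl_injective n V (by rw [incl_leMap, app_res, app_res, incl_leMap])

lemma leMap_injective (n : ℕ) (U : X.Opens) : Function.Injective (leMap hJ n U) := fun s t h =>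
  J.incl_injective n U (by rw [← incl_leMap hJ, h, incl_leMap])

/-- The right ideal `J`, as a family of subsheaves of a larger ideal. -/
def subsheaf (hJ : J.Le J') : ∀ n : ℤ, Subsheaf (J'.G n)
  | .ofNat n => imageSubsheaf (leMap hJ n) (leMap_res hJ n) (leMap_injective hJ n)
  | .negSucc _ => Subsheaf.zero _

lemma isQuasicoherentSheaf_subsheaf : ∀ n, IsQuasicoherentSheaf (subsheaf hJ n).toModules
  | .ofNat n => isQuasicoherentSheaf_imageSubsheaf (leMap hJ n) (leMap_res hJ n)
    (leMap_injective hJ n) (J.quasicoherent n)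
  | .negSucc _ => isQuasicoherentSheaf_zero _

lemma mem_subsheaf {n : ℕ} {U : X.Opens} {s : Γ(J'.G n, U)} :
    s ∈ (subsheaf hJ n).obj U ↔ J.Mem ((J'.incl n).app U s) := by
  constructor
  · rintro ⟨t, rfl⟩
    exact ⟨t, (incl_leMap hJ n U t).symm⟩
  · rintro ⟨t, ht⟩
    exact ⟨t, J'.incl_injective n U ((incl_leMap hJ n U t).trans ht)⟩

lemma descends_subsheaf {n : ℤ} {m : ℕ} {k : ℤ} (h : n + m = k) :
    (J'.act h).Descends (subsheaf hJ n) (subsheaf hJ k) := by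
  intro U V W hU hV a ha b
  cases n with
  | ofNat n =>
    obtain rfl : k = ((n + m : ℕ) : ℤ) := h.symm
    obtain ⟨t, ht⟩ := (mem_subsheaf hJ).mp ha
    exact (mem_subsheaf hJ).mpr ⟨(J.act (Nat.cast_add n m).symm).toFun hU hV t b,
      (J.incl_act rfl hU hV t b).trans ((congrArg
        (fun y => (B.mul rfl).toFun hU hV y b) ht).trans (J'.incl_act rfl hU hV a b).symm)⟩
  | negSucc n =>
    rw [(Submodule.mem_bot _).mp ha, Pairing.toFun_zero_left]
    exact zero_mem _

/-- The factor of a coherent right ideal by a smaller right ideal that differs from it in all large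
degrees is not torsion. -/
theorem exists_isFactor_not_isTorsion (hJ : J.Le J') (hcoh : J'.toRightModule.IsCoherent) {N : ℕ}
    (hN : ∀ n ≥ N, ∃ (U : X.Opens) (t : Γ(B.E n, U)), J'.Mem t ∧ ¬ J.Mem t) :
    ∃ (Q : RightModule B) (π : RightModule.Hom J'.toRightModule Q),
      IsFactor J J' Q π ∧ ¬ Q.IsTorsion := by
  have hsurj := J'.toRightModule.isSurjective_toQuotient (subsheaf hJ)
    (isQuasicoherentSheaf_subsheaf hJ) (descends_subsheaf hJ)
  refine ⟨_, J'.toRightModule.toQuotient (subsheaf hJ) (isQuasicoherentSheaf_subsheaf hJ)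
    (descends_subsheaf hJ), ⟨hsurj, fun n U s => ?_⟩,
    RightModule.not_isTorsion (hsurj.isCoherent hcoh) fun hb => ?_⟩
  · exact (subsheaf hJ n).toQuotient_eq_zero_iff.trans (mem_subsheaf hJ)
  · have hb' : {n : ℤ | ¬ Limits.IsZero (subsheaf hJ n).quotient}.Finite := hb
    refine Set.infinite_of_injective_forall_mem
      (s := {n : ℤ | ¬ Limits.IsZero (subsheaf hJ n).quotient})
      (f := fun i : ℕ => ((N + i : ℕ) : ℤ))
      (fun i j hij => by simpa using hij) (fun i hz => ?_) hb'
    obtain ⟨U, t, ⟨s, rfl⟩, ht⟩ := hN (N + i) (Nat.le_add_right _ _)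
    refine ht ((mem_subsheaf hJ).mp ((subsheaf hJ _).toQuotient_eq_zero_iff.mp ?_))
    exact isZero_iff.mp hz _ _

end RightIdeal

/-! ### Chains of right ideals -/

section chains

variable {σ : Aut X} {c : X} {hc : IsClosed {c}} {L : X.Modules}

namespace RightIdeal

variable {J J' : RightIdeal (rees σ c hc L)} {K K' : ℕ → X.IdealSheafData}

lemma IsDefinedBy.mem_iff (hJ : J.IsDefinedBy K) {n : ℕ} {U : X.Opens}
    {t : Γ((rees σ c hc L).E n, U)} : J.Mem t ↔
      (idealMul (Ipow σ (pointIdeal c hc) n) (Lpow σ L n)).val t ∈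
        (idealMul (K n) (Lpow σ L n)).obj U := by
  rw [← hJ n U]
  constructor
  · rintro ⟨s, rfl⟩
    exact ⟨s, rfl⟩
  · rintro ⟨s, hs⟩
    exact ⟨s, Subsheaf.val_injective _ hs⟩

lemma IsDefinedBy.le (hJ : J.IsDefinedBy K) (hJ' : J'.IsDefinedBy K') (h : ∀ n, K n ≤ K' n) :
    J.Le J' := fun n U _ ht =>
  hJ'.mem_iff.mpr (idealMul_mono (h n) _ U (hJ.mem_iff.mp ht))

lemma IsDefinedBy.exists_mem_not_mem (hJ : J.IsDefinedBy K) (hJ' : J'.IsDefinedBy K')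
    (hL : IsInvertible L) {n : ℕ} (h : ¬ K' n ≤ K n) :
    ∃ (U : X.Opens) (t : Γ((rees σ c hc L).E n, U)), J'.Mem t ∧ ¬ J.Mem t := by
  by_contra! hcon
  refine h ((hL.Lpow σ n).le_of_idealMul_le fun U s hs => ?_)
  obtain ⟨g, rfl⟩ := (hJ' n U).ge hs
  exact hJ.mem_iff.mp (hcon U _ ⟨g, rfl⟩)

end RightIdeal

/-- If the orbit is not critically dense, the right ideals `J s` obtained by stopping the production
of new generators in degree `s` form the chain, `s` running through the degrees in which a new
generator is needed. -/
theorem exists_chain_of_not_isRightNoetherian [IsIntegral X] [IsNoetherian X]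
    (hL : IsInvertible L) (hc' : ∀ n : ℤ, n ≠ 0 → tw σ n c ≠ c)
    (h : ¬ IsRightNoetherian (rees σ c hc L)) :
    ∃ J : ℕ → RightIdeal (rees σ c hc L), (∀ j, (J j).toRightModule.IsCoherent) ∧
      ∀ j, (J j).Le (J (j + 1)) ∧ ∃ (Q : RightModule (rees σ c hc L))
        (π : RightModule.Hom (J (j + 1)).toRightModule Q),
        RightIdeal.IsFactor (J j) (J (j + 1)) Q π ∧ ¬ Q.IsTorsion := by
  have h1 := mt (isRightNoetherian_of_dense hL hc') h
  push Not at h1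
  obtain ⟨D, hD, hinf, hne⟩ := h1
  obtain ⟨A, S, hS, hA, hAP, hAS⟩ := exists_chain_of_not_dense
    (hp := isClosed_forwardPoint σ hc) (forwardPoint_injective hc') hD hinf hne
  let T := truncatedChain
    (fun i => pointIdeal (forwardPoint σ c i) (isClosed_forwardPoint σ hc i)) A
  have hJ (s : ℕ) : ∃ J : RightIdeal (rees σ c hc L), J.IsDefinedBy (T s) :=
    exists_rightIdeal hL
      (fun n => Ipow_eq_prod_forward (σ := σ) hc n ▸ (truncatedChain_le hA).trans (hAP n))
      fun n => comap_pointIdeal_forward (σ := σ) hc n ▸ truncatedChain_mul_le hA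
  choose J hJ using hJ
  have hcoh (s : ℕ) : (J s).toRightModule.IsCoherent :=
    (hJ s).isCoherent hL (N := s) fun n hn =>
      comap_pointIdeal_forward (σ := σ) hc n ▸ truncatedChain_succ hn
  have := hS.to_subtype
  classical
  have hφ := (Nat.orderEmbeddingOfSet S).strictMono
  refine ⟨fun j => J (Nat.orderEmbeddingOfSet S j), fun j => hcoh _, fun j => ?_⟩
  have hlt := hφ j.lt_succ_self
  have hle := (hJ _).le (hJ _) fun n => truncatedChain_mono (n := n) hA hlt.le
  exact ⟨hle, RightIdeal.exists_isFactor_not_isTorsion hle (hcoh _) fun n hn =>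
    (hJ _).exists_mem_not_mem (hJ _) hL
      (hAS _ ((Nat.orderEmbeddingOfSet_range S).le ⟨j, rfl⟩) _ n hlt hn)⟩

end chains

/-! ### Projective schemes are noetherian -/

section projective

attribute [local instance] MvPolynomial.gradedAlgebra

/-- Projective space is of finite type over the spectrum of the degree `0` part of the polynomial
ring, which is the base field. -/
theorem IsProjectiveScheme.isNoetherian {k : Type u} [Field k] {f : X ⟶ Spec (CommRingCat.of k)}
    (hf : IsProjectiveScheme f) : IsNoetherian X := by
  obtain ⟨n, i, hi, -⟩ := hf
  let 𝒜 := MvPolynomial.homogeneousSubmodule (Fin (n + 1)) k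
  have : IsScalarTower k (𝒜 0) (MvPolynomial (Fin (n + 1)) k) :=
    IsScalarTower.of_algebraMap_eq (R := k) (S := 𝒜 0) (A := MvPolynomial (Fin (n + 1)) k)
      fun _ => rfl
  have hft : Algebra.FiniteType (𝒜 0) (MvPolynomial (Fin (n + 1)) k) :=
    Algebra.FiniteType.of_restrictScalars_finiteType k _ _
  have hN : IsNoetherianRing (CommRingCat.of (𝒜 0)) := by
    refine isNoetherianRing_of_surjective k (𝒜 0) (algebraMap k (𝒜 0)) fun x => ?_
    have hx : x.1 ∈ (1 : Submodule k (MvPolynomial (Fin (n + 1)) k)) := by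
      rw [← MvPolynomial.homogeneousSubmodule_zero]
      exact x.2
    obtain ⟨y, hy⟩ := Submodule.mem_one.mp hx
    exact ⟨y, Subtype.ext hy⟩
  let g := i ≫ Proj.toSpecZero 𝒜
  have : IsLocallyNoetherian X := LocallyOfFiniteType.isLocallyNoetherian g
  have : CompactSpace X := QuasiCompact.compactSpace_of_compactSpace g
  exact {}

end projective

end NaiveBlowup

end

theorem proposition3 {k : Type u} [Field k] [IsAlgClosed k] {X : Scheme.{u}} [IsIntegral X]
    (f : X ⟶ Spec (CommRingCat.of k)) (hf : NaiveBlowup.IsProjectiveScheme f)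
    (σ : Aut X) (hσ : σ.hom ≫ f = f)
    (L : X.Modules) (hL : NaiveBlowup.IsInvertible L)
    (c : X) (hc : IsClosed {c}) (hc' : ∀ n : ℤ, n ≠ 0 → NaiveBlowup.tw σ n c ≠ c) :
    (NaiveBlowup.IsRightNoetherian (NaiveBlowup.rees σ c hc L) ↔
      NaiveBlowup.IsCriticallyDense {x | ∃ i : ℤ, 0 ≤ i ∧ x = NaiveBlowup.orbitPoint σ c i}) ∧
    (NaiveBlowup.IsLeftNoetherian (NaiveBlowup.rees σ c hc L) ↔
      NaiveBlowup.IsCriticallyDense {x | ∃ i : ℤ, i < 0 ∧ x = NaiveBlowup.orbitPoint σ c i}) ∧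
    (NaiveBlowup.IsNoetherianAlgebra (NaiveBlowup.rees σ c hc L) ↔
      NaiveBlowup.IsCriticallyDense {x | ∃ i : ℤ, x = NaiveBlowup.orbitPoint σ c i}) ∧
    (¬ NaiveBlowup.IsRightNoetherian (NaiveBlowup.rees σ c hc L) →
      ∃ J : ℕ → NaiveBlowup.RightIdeal (NaiveBlowup.rees σ c hc L),
        (∀ j, (J j).toRightModule.IsCoherent) ∧
        ∀ j, (J j).Le (J (j + 1)) ∧
          ∃ (Q : NaiveBlowup.RightModule (NaiveBlowup.rees σ c hc L))
            (π : NaiveBlowup.RightModule.Hom (J (j + 1)).toRightModule Q),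
            NaiveBlowup.RightIdeal.IsFactor (J j) (J (j + 1)) Q π ∧ ¬ Q.IsTorsion) := by
  have := hf.isNoetherian
  exact ⟨NaiveBlowup.isRightNoetherian_iff hL hc', NaiveBlowup.isLeftNoetherian_iff hL hc',
    NaiveBlowup.isNoetherianAlgebra_iff hL hc',
    NaiveBlowup.exists_chain_of_not_isRightNoetherian hL hc'⟩
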